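/- Let $m,\gamma,\kappa>0$, let $\mathbb T=\mathbb R/2\pi\mathbb Z$, and let $(\mu_t)_{t\ge 0}$ be a global measure-valued solution of the kinetic Kuramoto equation with inertia $$\partial_t f+\partial_\theta(\omega f)+\partial_\omega\big(\mathcal F_a[f]f\big)=0,\qquad \mathcal F_a[f](\theta,\omega,t)=\frac1m\Big(-\gamma\omega+\kappa\int_{\mathbb T\times\mathbb R}\sin(\theta_*-\theta)\,f(\theta_*,\omega_*,t)\,d\theta_*d\omega_*\Big)$$ on $\mathbb T\times\mathbb R$. That is, each $\mu_t$ is a Borel probability measure on $\mathbb T\times\mathbb R$ with $\int\omega^2\,d\mu_t<\infty$, and for every compactly supported $C^1$ function $\phi(\theta,\omega,t)$ on $\mathbb T\times\mathbb R\times[0,\infty)$ the map $t\mapsto\int\phi(\cdot,\cdot,t)\,d\mu_t$ is continuous on $[0,\infty)$ and $$\int\phi(\cdot,\cdot,t)\,d\mu_t-\int\phi(\cdot,\cdot,0)\,d\mu_0=\int_0^t\int\big(\partial_s\phi+\omega\,\partial_\theta\phi+\mathcal F_a[\mu_s]\,\partial_\omega\phi\big)\,d\mu_s\,ds,\qquad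 t\ge0 .$$ Let $R_k(t)=\big|\int_{\mathbb T\times\mathbb R}e^{\mathrm i\theta}\,d\mu_t(\theta,\omega)\big|$ be the order parameter, and suppose that $$\frac12\int_{\mathbb T\times\mathbb R}\omega^2\,d\mu_0(\theta,\omega)\le\frac{\kappa R_k(0)^2}{2m}.$$ Then the following holds. 1. If $R_k(0)=0$, then the solution stays in a phase-locked state: for all $t\ge0$, $\mu_t=\mu_0$, $\mu_t$ is concentrated on $\{\omega=0\}$, and $R_k(t)=0$. 2. If $R_k(0)>0$, then there is $R_*>0$ with $R_k(t)\ge R_*$ for all $t\ge0$, the limit $\lim_{t\to\infty}R_k(t)$ exists and is positive, and $\mu_t$ tends to a bi-polar state of type $(c_1,c_2)$: there are $c_1>c_2\ge0$ with $c_1+c_2=1$ and $\varphi^*\in\mathbb T$ such that, as $t\to\infty$, $$\mu_t\to\big(c_1\delta_{\varphi^*}+c_2\delta_{\varphi^*+\pi}\big)\otimes\delta_0$$ weakly and in the Wasserstein 2-distance on $\mathbb T\times\mathbb R$ (for the distance $(|\theta-\theta'|^2+|\omega-\omega'|^2)^{1/2}$, with $|\theta-\theta'|$ the arc length). -/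

import Mathlib

open MeasureTheory Filter Set
open scoped ENNReal Topology

namespace KineticKuramoto

noncomputable section

/-- The circle `ℝ / 2πℤ`, with its arc-length distance. -/
abbrev Torus : Type := AddCircle (2 * Real.pi)

/-- The phase space of pairs (phase `θ`, frequency `ω`). -/
abbrev Phase : Type := Torus × ℝ

/-- The sine function on the circle. -/
def torusSin : Torus → ℝ := Real.sin_periodic.lift

/-- The complex number `e^{iθ}` for `θ` in the circle. -/
def torusExp (θ : Torus) : ℂ := (AddCircle.toCircle θ : ℂ)

/-- The force
`F_a[μ](θ, ω) = (1/m) (-γ ω + κ ∫ sin (θ_* - θ) dμ(θ_*, ω_*))`. -/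
def force (m γ κ : ℝ) (μ : Measure Phase) (θ : Torus) (ω : ℝ) : ℝ :=
  (1 / m) * (-γ * ω + κ * ∫ z, torusSin (z.1 - θ) ∂μ)

/-- The order parameter `R_k = |∫ e^{iθ} dμ(θ, ω)|`. -/
def orderParameter (μ : Measure Phase) : ℝ := ‖∫ z, torusExp z.1 ∂μ‖

/-- Test functions `φ(θ, ω, t)`: continuously differentiable and compactly supported on
`Torus × ℝ × ℝ`. Only their values at times `t ≥ 0` are used. -/
structure IsTestFunction (φ : Torus → ℝ → ℝ → ℝ) : Prop where
  contDiff : ContDiff ℝ 1 (fun p : ℝ × ℝ × ℝ => φ (p.1 : Torus) p.2.1 p.2.2)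
  hasCompactSupport : HasCompactSupport (fun p : Torus × ℝ × ℝ => φ p.1 p.2.1 p.2.2)

/-- The partial derivative in the phase variable. -/
def dTheta (φ : Torus → ℝ → ℝ → ℝ) (θ : Torus) (ω t : ℝ) : ℝ :=
  deriv (fun h : ℝ => φ (θ + (h : Torus)) ω t) 0

/-- The partial derivative in the frequency variable. -/
def dOmega (φ : Torus → ℝ → ℝ → ℝ) (θ : Torus) (ω t : ℝ) : ℝ :=
  deriv (fun w : ℝ => φ θ w t) ω

/-- The partial derivative in the time variable. -/
def dTime (φ : Torus → ℝ → ℝ → ℝ) (θ : Torus) (ω t : ℝ) : ℝ :=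
  deriv (fun s : ℝ => φ θ ω s) t

/-- `μ` is a global measure-valued solution, weakly continuous with values in the probability
measures with finite second moment, of the kinetic Kuramoto equation with inertia
`∂_t f + ∂_θ (ω f) + ∂_ω (F_a[f] f) = 0` on `Torus × ℝ`. Only times `t ≥ 0` matter; the second
moment only involves `ω` because the circle is bounded. -/
structure IsMeasureValuedSolution (m γ κ : ℝ) (μ : ℝ → ProbabilityMeasure Phase) : Prop where
  finite_second_moment : ∀ t, 0 ≤ t → Integrable (fun z : Phase => z.2 ^ 2) (μ t : Measure Phase)
  weakly_continuous : ∀ φ, IsTestFunction φ →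
    ContinuousOn (fun t : ℝ => ∫ z, φ z.1 z.2 t ∂(μ t : Measure Phase)) (Ici 0)
  weak_equation : ∀ φ, IsTestFunction φ → ∀ t, 0 ≤ t →
    (∫ z, φ z.1 z.2 t ∂(μ t : Measure Phase)) - ∫ z, φ z.1 z.2 0 ∂(μ 0 : Measure Phase) =
      ∫ s in (0 : ℝ)..t, ∫ z, (dTime φ z.1 z.2 s + z.2 * dTheta φ z.1 z.2 s
        + force m γ κ (μ s : Measure Phase) z.1 z.2 * dOmega φ z.1 z.2 s) ∂(μ s : Measure Phase)

/-- `ν` is a bi-polar state of type `(c₁, c₂)`: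
`ν = (c₁ δ_φ + c₂ δ_{φ+π}) ⊗ δ_0` for some `φ`, with `c₁ > c₂ ≥ 0` and `c₁ + c₂ = 1`. -/
def IsBipolarState (c₁ c₂ : ℝ) (ν : Measure Phase) : Prop :=
  0 ≤ c₂ ∧ c₂ < c₁ ∧ c₁ + c₂ = 1 ∧ ∃ φ : Torus,
    ν = (ENNReal.ofReal c₁ • Measure.dirac φ
      + ENNReal.ofReal c₂ • Measure.dirac (φ + ((Real.pi : ℝ) : Torus))).prod
        (Measure.dirac (0 : ℝ))

/-- The Wasserstein 2-distance on `Torus × ℝ`, as an infimum over all couplings, for the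
product distance `‖(θ, ω) - (θ', ω')‖² = |θ - θ'|² + |ω - ω'|²`. -/
def wasserstein2 (μ ν : Measure Phase) : ℝ≥0∞ :=
  ⨅ (ρ : Measure (Phase × Phase)) (_ : ρ.map Prod.fst = μ) (_ : ρ.map Prod.snd = ν),
    (∫⁻ p, (edist p.1.1 p.2.1 ^ 2 + edist p.1.2 p.2.2 ^ 2) ∂ρ) ^ (1 / 2 : ℝ)

end

end KineticKuramoto

/-!
The energy, kinetic energy minus `κ / (2m) * R²`, has derivative `-(γ / m) ∫ ω²`, and the assumption
says that it is nonpositive initially; hence `∫ ω² ≤ (κ / m) R²` for all time. Since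
`(R²)' = -2 ∫ R sin(θ - ψ) ω`, with `ψ` the mean phase, this bounds `|(R²)'|` by a multiple of `R²`.
If `R` vanishes initially it therefore always does, all frequencies are zero, and nothing moves. If
`R` is initially positive, the energy is negative at positive times and `R` is bounded below.

In the second case `∫ R sin(θ - ψ) ω` decreases at the rate `κ / (2m) ∫ R² sin²(θ - ψ)`, up to a
multiple of `∫ ω²`, which the dissipation of energy controls. So both integrals are integrable in
time, they tend to zero, and `R` converges. The mean phase is harder, because its derivative is only
square integrable. Let `Z₁`, `Z₂` be the first two Fourier modes. Once the spread `∫ R² sin²(θ - ψ)`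
is small, `Z₂` is almost `exp(2iψ)`, and the mean frequency decays exponentially, so the derivative
of `Z₂` is bounded by the two integrals and an exponential. Hence `Z₂` converges, then `Z₁²`, whose
product with the conjugate of `Z₂` is asymptotically real, and `Z₁` by continuity.

With `φ` the limit of the phase, `∫ sin²(θ - φ)` and `∫ ω²` tend to zero while `∫ cos(θ - φ)` tends
to `lim R`. Sending the share `(1 + cos(θ - φ)) / 2` of the mass at `θ` to `φ` and the rest to
`φ + π` costs little, and shifting mass between the two poles to match the limit weights costs
little more. This is convergence in the Wasserstein distance, which implies weak convergence.
-/

namespace KineticKuramoto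

open scoped ContDiff

noncomputable section

/-! ### Limits on a half line -/

section HalfLine

variable {f f' g : ℝ → ℝ}

lemma integrableOn_Ioi_of_deriv_le_neg (hf : ∀ t, 0 ≤ t → HasDerivWithinAt f (f' t) (Ici 0) t)
    (hgc : Continuous g) (hg : ∀ t, 0 ≤ t → 0 ≤ g t) (hle : ∀ t, 0 ≤ t → f' t ≤ -g t) {B : ℝ}
    (hB : ∀ t, 0 ≤ t → B ≤ f t) : IntegrableOn g (Ioi 0) := by
  refine integrableOn_Ioi_of_intervalIntegral_norm_bounded (f 0 - B) 0
    (fun n : ℕ => hgc.integrableOn_Ioc) tendsto_natCast_atTop_atTop ?_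
  filter_upwards with n
  have hn : (0 : ℝ) ≤ n := n.cast_nonneg
  calc ∫ x in (0 : ℝ)..n, ‖g x‖ = ∫ x in (0 : ℝ)..n, g x :=
        intervalIntegral.integral_congr fun x hx =>
          Real.norm_of_nonneg (hg x (by rw [uIcc_of_le hn] at hx; exact hx.1))
    _ ≤ -f n - -f 0 :=
        intervalIntegral.integral_le_sub_of_hasDeriv_right_of_le hn
          (fun t ht => (hf t ht.1).neg.continuousWithinAt.mono Icc_subset_Ici_self)
          (fun t ht => (hf t ht.1.le).neg.mono (Ioi_subset_Ici_self.trans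
            (Ici_subset_Ici.2 ht.1.le)))
          hgc.integrableOn_Icc fun t ht => le_neg_of_le_neg (hle t ht.1.le)
    _ ≤ f 0 - B := by linarith [hB n hn]

lemma hasDerivAt_of_pos (hf : ∀ t, 0 ≤ t → HasDerivWithinAt f (f' t) (Ici 0) t) {t : ℝ}
    (ht : 0 < t) : HasDerivAt f (f' t) t :=
  (hf t ht.le).hasDerivAt (Ici_mem_nhds ht)

lemma integrableOn_Ioi_deriv_of_abs_le (hf : ∀ t, 0 ≤ t → HasDerivWithinAt f (f' t) (Ici 0) t)
    (hle : ∀ t, 0 ≤ t → |f' t| ≤ g t) (hg : IntegrableOn g (Ioi 0)) :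
    IntegrableOn (deriv f) (Ioi 0) := by
  refine hg.mono' (measurable_deriv f).aestronglyMeasurable ?_
  filter_upwards [ae_restrict_mem measurableSet_Ioi] with t ht
  rw [(hasDerivAt_of_pos hf ht).deriv]
  exact hle t (le_of_lt ht)

lemma exists_tendsto_of_abs_deriv_le (hf : ∀ t, 0 ≤ t → HasDerivWithinAt f (f' t) (Ici 0) t)
    (hle : ∀ t, 0 ≤ t → |f' t| ≤ g t) (hg : IntegrableOn g (Ioi 0)) :
    ∃ l, Tendsto f atTop (𝓝 l) :=
  ⟨_, tendsto_limUnder_of_hasDerivAt_of_integrableOn_Ioi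
    (fun _ ht => (hasDerivAt_of_pos hf ht).differentiableAt.hasDerivAt)
    (integrableOn_Ioi_deriv_of_abs_le hf hle hg)⟩

lemma tendsto_zero_of_abs_deriv_le (hf : ∀ t, 0 ≤ t → HasDerivWithinAt f (f' t) (Ici 0) t)
    (hle : ∀ t, 0 ≤ t → |f' t| ≤ g t) (hg : IntegrableOn g (Ioi 0))
    (hfint : IntegrableOn f (Ioi 0)) : Tendsto f atTop (𝓝 0) :=
  tendsto_zero_of_hasDerivAt_of_integrableOn_Ioi
    (fun _ ht => (hasDerivAt_of_pos hf ht).differentiableAt.hasDerivAt)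
    (integrableOn_Ioi_deriv_of_abs_le hf hle hg) hfint

lemma antitoneOn_of_deriv_nonpos (hf : ∀ t, 0 ≤ t → HasDerivWithinAt f (f' t) (Ici 0) t)
    (hle : ∀ t, 0 ≤ t → f' t ≤ 0) : AntitoneOn f (Ici 0) := by
  refine antitoneOn_of_hasDerivWithinAt_nonpos (f' := f') (convex_Ici 0)
    (fun t ht => (hf t ht).continuousWithinAt) (fun t ht => ?_) fun t ht => ?_
  · exact (hf t (interior_subset ht)).mono interior_subset
  · exact hle t (interior_subset ht)

end HalfLine

lemma tendsto_complexMk {u v : ℝ → ℝ} {p q : ℝ} (hu : Tendsto u atTop (𝓝 p))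
    (hv : Tendsto v atTop (𝓝 q)) : Tendsto (fun t => (⟨u t, v t⟩ : ℂ)) atTop (𝓝 ⟨p, q⟩) :=
  (Complex.equivRealProdCLM.symm.continuous.tendsto (p, q)).comp (hu.prodMk_nhds hv)

lemma tendsto_one_of_tendsto_sq {f : ℝ → ℂ} (hre : ∀ᶠ t in atTop, 0 ≤ (f t).re)
    (hlim : Tendsto (fun t => f t ^ 2) atTop (𝓝 1)) : Tendsto f atTop (𝓝 1) := by
  rw [tendsto_iff_norm_sub_tendsto_zero] at hlim ⊢
  refine squeeze_zero' (Eventually.of_forall fun t => norm_nonneg _) ?_ hlim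
  filter_upwards [hre] with t ht
  have hone : 1 ≤ ‖f t + 1‖ := by
    refine le_trans ?_ (Complex.re_le_norm _)
    simpa using ht
  calc ‖f t - 1‖ ≤ ‖f t + 1‖ * ‖f t - 1‖ := le_mul_of_one_le_left (norm_nonneg _) hone
    _ = ‖f t ^ 2 - 1‖ := by rw [← norm_mul]; ring_nf

/-- The real part cannot change sign without vanishing. -/
lemma eventually_re_pos_or_eventually_re_neg {f : ℝ → ℂ} (hf : Continuous f)
    (hlim : Tendsto (fun t => f t ^ 2) atTop (𝓝 1)) :
    (∀ᶠ t in atTop, 0 < (f t).re) ∨ ∀ᶠ t in atTop, (f t).re < 0 := by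
  have hre : Tendsto (fun t => (f t ^ 2).re) atTop (𝓝 1) :=
    (Complex.continuous_re.tendsto 1).comp hlim
  obtain ⟨T, hT⟩ := eventually_atTop.1 (hre.eventually_const_lt zero_lt_one)
  have hne (t : ℝ) (ht : T ≤ t) : (f t).re ≠ 0 := by
    intro hzero
    have hpos := hT t ht
    rw [sq, Complex.mul_re, hzero] at hpos
    nlinarith [mul_self_nonneg (f t).im]
  by_contra! hcon
  obtain ⟨hpos, hneg⟩ := hcon
  obtain ⟨s, hs, hs0⟩ := (hpos.and_eventually (eventually_ge_atTop T)).exists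
  obtain ⟨t, ht, ht0⟩ := (hneg.and_eventually (eventually_ge_atTop T)).exists
  obtain ⟨u, hu, hzero⟩ := isPreconnected_Ici.intermediate_value hs0 ht0
    (Complex.continuous_re.comp hf).continuousOn ⟨hs, ht⟩
  exact hne u hu hzero

lemma exists_tendsto_of_tendsto_sq {f : ℝ → ℂ} (hf : Continuous f) {a : ℂ} (ha : a ≠ 0)
    (hlim : Tendsto (fun t => f t ^ 2) atTop (𝓝 a)) :
    ∃ b, b ^ 2 = a ∧ Tendsto f atTop (𝓝 b) := by
  obtain ⟨r, rfl⟩ : ∃ r : ℂ, r ^ 2 = a := IsAlgClosed.exists_pow_nat_eq a two_pos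
  have hr : r ≠ 0 := by
    rintro rfl
    simp at ha
  have hquot : Tendsto (fun t => (f t / r) ^ 2) atTop (𝓝 1) := by
    rw [← div_self ha]
    simpa only [div_pow] using hlim.div_const (r ^ 2)
  rcases eventually_re_pos_or_eventually_re_neg (hf.div_const r) hquot with hpos | hneg
  · refine ⟨r, rfl, ?_⟩
    have hone := tendsto_one_of_tendsto_sq (hpos.mono fun t => le_of_lt) hquot
    simpa [div_mul_cancel₀ _ hr] using hone.mul_const r
  · refine ⟨-r, neg_sq r, ?_⟩
    have hone := tendsto_one_of_tendsto_sq (f := fun t => -(f t / r))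
      (hneg.mono fun t ht => by simpa using ht.le) (by simpa using hquot)
    simpa [div_mul_cancel₀ _ hr] using hone.mul_const (-r)

/-! ### Smooth functions on the circle -/

instance factTwoPiPos : Fact (0 < 2 * Real.pi) := ⟨Real.two_pi_pos⟩

/-- The cosine function on the circle. -/
def torusCos : Torus → ℝ := Real.cos_periodic.lift

/-- The derivative of a function on the circle. -/
def torusDeriv (a : Torus → ℝ) (θ : Torus) : ℝ :=
  deriv (fun h : ℝ => a (θ + (h : Torus))) 0

/-- Smoothness of a function on the circle, expressed through its `2π`-periodic lift to `ℝ`. -/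
def TorusSmooth (a : Torus → ℝ) : Prop := ContDiff ℝ ∞ (fun x : ℝ => a (x : Torus))

@[simp] lemma torusSin_coe (x : ℝ) : torusSin (x : Torus) = Real.sin x := rfl

@[simp] lemma torusCos_coe (x : ℝ) : torusCos (x : Torus) = Real.cos x := rfl

lemma torusExp_coe (x : ℝ) : torusExp (x : Torus) = Complex.exp (x * Complex.I) := by
  unfold torusExp
  rw [AddCircle.toCircle_apply_mk, div_self (by positivity), one_mul, Circle.coe_exp]

lemma torusExp_eq (θ : Torus) : torusExp θ = (torusCos θ : ℂ) + torusSin θ * Complex.I := by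
  induction θ using QuotientAddGroup.induction_on with
  | H x =>
    rw [torusExp_coe, Complex.exp_mul_I]
    simp

lemma torusSin_sub (α β : Torus) :
    torusSin (α - β) = torusSin α * torusCos β - torusCos α * torusSin β := by
  induction α using QuotientAddGroup.induction_on with
  | H x =>
    induction β using QuotientAddGroup.induction_on with
    | H y => exact Real.sin_sub x y

lemma torusCos_sub (α β : Torus) :
    torusCos (α - β) = torusCos α * torusCos β + torusSin α * torusSin β := by
  induction α using QuotientAddGroup.induction_on with
  | H x =>
    induction β using QuotientAddGroup.induction_on with
    | H y => exact Real.cos_sub x y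

lemma torusSin_sq_add_torusCos_sq (θ : Torus) : torusSin θ ^ 2 + torusCos θ ^ 2 = 1 := by
  induction θ using QuotientAddGroup.induction_on with
  | H x => exact Real.sin_sq_add_cos_sq x

lemma torusDeriv_coe (a : Torus → ℝ) (x : ℝ) :
    torusDeriv a (x : Torus) = deriv (fun y : ℝ => a (y : Torus)) x := by
  unfold torusDeriv
  have : (fun h : ℝ => a ((x : Torus) + (h : Torus)))
      = fun h : ℝ => (fun y : ℝ => a (y : Torus)) (x + h) := by
    funext h; simp
  rw [this, deriv_comp_const_add (fun y : ℝ => a (y : Torus)) x 0, add_zero]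

lemma torusDeriv_eq_of_hasDerivAt {a a' : Torus → ℝ}
    (h : ∀ x : ℝ, HasDerivAt (fun y : ℝ => a (y : Torus)) (a' (x : Torus)) x) :
    torusDeriv a = a' := by
  funext θ
  induction θ using QuotientAddGroup.induction_on with
  | H x => exact (torusDeriv_coe a x).trans (h x).deriv

@[simp] lemma torusDeriv_torusSin : torusDeriv torusSin = torusCos :=
  torusDeriv_eq_of_hasDerivAt fun x => Real.hasDerivAt_sin x

@[simp] lemma torusDeriv_torusCos : torusDeriv torusCos = fun θ => -torusSin θ :=
  torusDeriv_eq_of_hasDerivAt fun x => Real.hasDerivAt_cos x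

@[simp] lemma torusDeriv_const (c : ℝ) : torusDeriv (fun _ => c) = fun _ => 0 :=
  torusDeriv_eq_of_hasDerivAt fun x => hasDerivAt_const x c

namespace TorusSmooth

lemma const (c : ℝ) : TorusSmooth (fun _ => c) := contDiff_const

lemma torusSin : TorusSmooth torusSin := Real.contDiff_sin

lemma torusCos : TorusSmooth torusCos := Real.contDiff_cos

variable {a b : Torus → ℝ}

lemma mul (ha : TorusSmooth a) (hb : TorusSmooth b) : TorusSmooth (fun θ => a θ * b θ) :=
  ContDiff.mul ha hb

lemma add (ha : TorusSmooth a) (hb : TorusSmooth b) : TorusSmooth (fun θ => a θ + b θ) :=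
  ContDiff.add ha hb

lemma torusDeriv (ha : TorusSmooth a) : TorusSmooth (torusDeriv a) := by
  unfold TorusSmooth
  simp_rw [torusDeriv_coe]
  exact (contDiff_infty_iff_deriv.1 ha).2

lemma hasDerivAt (ha : TorusSmooth a) (x : ℝ) :
    HasDerivAt (fun y : ℝ => a (y : Torus)) (KineticKuramoto.torusDeriv a (x : Torus)) x := by
  rw [torusDeriv_coe]
  exact ((contDiff_infty_iff_deriv.1 ha).1 x).hasDerivAt

lemma torusDeriv_mul (ha : TorusSmooth a) (hb : TorusSmooth b) :
    KineticKuramoto.torusDeriv (fun θ => a θ * b θ) =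
      fun θ => KineticKuramoto.torusDeriv a θ * b θ + a θ * KineticKuramoto.torusDeriv b θ :=
  torusDeriv_eq_of_hasDerivAt fun x => (ha.hasDerivAt x).mul (hb.hasDerivAt x)

lemma continuous (ha : TorusSmooth a) : Continuous a :=
  continuous_coinduced_dom.2 (ContDiff.continuous ha)

lemma exists_bound (ha : TorusSmooth a) : ∃ A : ℝ, 0 ≤ A ∧ ∀ θ, |a θ| ≤ A := by
  obtain ⟨A, hA⟩ := isCompact_univ.exists_bound_of_continuousOn ha.continuous.continuousOn
  exact ⟨A, (norm_nonneg _).trans (hA 0 (mem_univ _)), fun θ => hA θ (mem_univ _)⟩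

end TorusSmooth

lemma torusDeriv_torusSin_mul_torusSin :
    torusDeriv (fun θ => torusSin θ * torusSin θ) = fun θ => 2 * (torusSin θ * torusCos θ) := by
  ext θ
  rw [TorusSmooth.torusDeriv_mul .torusSin .torusSin, torusDeriv_torusSin]
  ring

lemma torusDeriv_torusSin_mul_torusCos :
    torusDeriv (fun θ => torusSin θ * torusCos θ) =
      fun θ => 1 * (torusCos θ * torusCos θ) + -1 * (torusSin θ * torusSin θ) := by
  ext θ
  rw [TorusSmooth.torusDeriv_mul .torusSin .torusCos, torusDeriv_torusSin, torusDeriv_torusCos]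
  ring

lemma torusDeriv_torusCos_mul_torusCos :
    torusDeriv (fun θ => torusCos θ * torusCos θ) = fun θ => -2 * (torusSin θ * torusCos θ) := by
  ext θ
  rw [TorusSmooth.torusDeriv_mul .torusCos .torusCos, torusDeriv_torusCos]
  ring

lemma abs_torusSin_le_one (θ : Torus) : |torusSin θ| ≤ 1 :=
  (sq_le_one_iff_abs_le_one _).1 (by
    linarith [torusSin_sq_add_torusCos_sq θ, sq_nonneg (torusCos θ)])

lemma abs_torusCos_le_one (θ : Torus) : |torusCos θ| ≤ 1 :=
  (sq_le_one_iff_abs_le_one _).1 (by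
    linarith [torusSin_sq_add_torusCos_sq θ, sq_nonneg (torusSin θ)])

/-! ### Cutoff functions -/

/-- A smooth bump function, equal to `1` on `[-1, 1]` and to `0` outside `[-√2, √2]`. -/
def bump (x : ℝ) : ℝ := Real.smoothTransition (2 - x ^ 2)

/-- The rescaled bump function, equal to `1` on `[-(n + 1), n + 1]`. -/
def cutoff (n : ℕ) (x : ℝ) : ℝ := bump (x / (n + 1))

lemma contDiff_bump : ContDiff ℝ ∞ bump := by
  unfold bump
  exact Real.smoothTransition.contDiff.comp (by fun_prop)

lemma bump_eq_one {x : ℝ} (hx : |x| ≤ 1) : bump x = 1 := by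
  refine Real.smoothTransition.one_of_one_le ?_
  linarith [(sq_le_one_iff_abs_le_one x).2 hx]

lemma bump_eq_zero {x : ℝ} (hx : 2 ≤ x ^ 2) : bump x = 0 :=
  Real.smoothTransition.zero_of_nonpos (by linarith)

lemma hasCompactSupport_bump : HasCompactSupport bump := by
  refine HasCompactSupport.intro (isCompact_Icc (a := (-2 : ℝ)) (b := 2)) fun x hx => ?_
  refine bump_eq_zero ?_
  by_contra h
  exact hx ⟨by nlinarith, by nlinarith⟩

lemma contDiff_cutoff (n : ℕ) : ContDiff ℝ ∞ (cutoff n) :=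
  contDiff_bump.comp (contDiff_id.div_const _)

lemma cutoff_nonneg (n : ℕ) (x : ℝ) : 0 ≤ cutoff n x := Real.smoothTransition.nonneg _

lemma cutoff_le_one (n : ℕ) (x : ℝ) : cutoff n x ≤ 1 := Real.smoothTransition.le_one _

lemma abs_cutoff_le_one (n : ℕ) (x : ℝ) : |cutoff n x| ≤ 1 := by
  rw [abs_of_nonneg (cutoff_nonneg n x)]; exact cutoff_le_one n x

lemma cutoff_eq_one {n : ℕ} {x : ℝ} (hx : |x| ≤ n + 1) : cutoff n x = 1 := by
  refine bump_eq_one ?_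
  have : (0 : ℝ) < n + 1 := by positivity
  rw [abs_div, abs_of_pos this]
  exact (div_le_one this).2 hx

lemma hasCompactSupport_cutoff (n : ℕ) : HasCompactSupport (cutoff n) := by
  have : (0 : ℝ) < n + 1 := by positivity
  exact hasCompactSupport_bump.comp_homeomorph
    (Homeomorph.mulRight₀ ((n : ℝ) + 1)⁻¹ (by positivity))

lemma deriv_cutoff (n : ℕ) (x : ℝ) :
    deriv (cutoff n) x = deriv bump (x / (n + 1)) / (n + 1) := by
  have h1 := ((contDiff_infty_iff_deriv.1 contDiff_bump).1 (x / (n + 1))).hasDerivAt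
  have h2 := h1.comp x ((hasDerivAt_id x).div_const ((n : ℝ) + 1))
  refine (h2.deriv).trans ?_
  simp [div_eq_mul_inv]

lemma deriv_cutoff_eq_zero {n : ℕ} {x : ℝ} (hx : |x| < n + 1) : deriv (cutoff n) x = 0 := by
  have : cutoff n =ᶠ[𝓝 x] fun _ => 1 := by
    filter_upwards [(isOpen_lt continuous_abs continuous_const).mem_nhds hx] with y hy
    exact cutoff_eq_one (le_of_lt hy)
  rw [this.deriv_eq, deriv_const]

lemma exists_bound_deriv_cutoff :
    ∃ B : ℝ, 0 ≤ B ∧ ∀ (n : ℕ) (x : ℝ), (1 + |x|) * |deriv (cutoff n) x| ≤ B := by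
  have hc : Continuous fun x : ℝ => x * deriv bump x :=
    continuous_id.mul (contDiff_bump.continuous_deriv (by simp))
  obtain ⟨B, hB⟩ := hc.bounded_above_of_compact_support hasCompactSupport_bump.deriv.mul_left
  have hB0 : 0 ≤ B := (norm_nonneg _).trans (hB 0)
  refine ⟨2 * B, by positivity, fun n x => ?_⟩
  rcases lt_or_ge |x| (n + 1) with hx | hx
  · rw [deriv_cutoff_eq_zero hx]
    simpa using hB0
  · have hx1 : 1 ≤ |x| := le_trans (by simp) hx
    have hscale : |x| * |deriv (cutoff n) x| ≤ B := by
      rw [← abs_mul, deriv_cutoff, mul_div_left_comm, mul_comm, ← Real.norm_eq_abs]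
      exact hB (x / (n + 1))
    rw [one_add_mul]
    linarith [le_mul_of_one_le_left (abs_nonneg (deriv (cutoff n) x)) hx1]

lemma monotone_cutoff (x : ℝ) : Monotone fun n : ℕ => cutoff n x := by
  refine fun k n hkn => Real.smoothTransition.monotone (sub_le_sub_left ?_ 2)
  rw [div_pow, div_pow]
  gcongr

lemma tendsto_cutoff (x : ℝ) : Tendsto (fun n : ℕ => cutoff n x) atTop (𝓝 1) := by
  refine tendsto_const_nhds.congr' ?_
  filter_upwards [eventually_ge_atTop ⌈|x|⌉₊] with n hn
  have : |x| ≤ n := (Nat.le_ceil _).trans (by exact_mod_cast hn)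
  exact (cutoff_eq_one (by linarith)).symm

lemma tendsto_deriv_cutoff (x : ℝ) : Tendsto (fun n : ℕ => deriv (cutoff n) x) atTop (𝓝 0) := by
  refine tendsto_const_nhds.congr' ?_
  filter_upwards [eventually_ge_atTop ⌈|x|⌉₊] with n hn
  have : |x| ≤ n := (Nat.le_ceil _).trans (by exact_mod_cast hn)
  exact (deriv_cutoff_eq_zero (by linarith)).symm

/-! ### Moments and the generator -/

/-- The measure `μ_t`, frozen at its initial value for negative times, which makes all the
functions of time below continuous on the whole line. -/
def state (μ : ℝ → ProbabilityMeasure Phase) (t : ℝ) : Measure Phase := μ (max t 0)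

/-- The moment `∫ a(θ) b(ω) dμ_t`. -/
def moment (μ : ℝ → ProbabilityMeasure Phase) (a : Torus → ℝ) (b : ℝ → ℝ) (t : ℝ) : ℝ :=
  ∫ z, a z.1 * b z.2 ∂state μ t

/-- The generator `ω ∂_θ + F_a[ν] ∂_ω` of the characteristic flow, applied to `a(θ) b(ω)`. -/
def generator (m γ κ : ℝ) (ν : Measure Phase) (a : Torus → ℝ) (b : ℝ → ℝ) (z : Phase) : ℝ :=
  torusDeriv a z.1 * (z.2 * b z.2) + force m γ κ ν z.1 z.2 * (a z.1 * deriv b z.2)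

/-- A bound, up to a constant and uniformly in the measure, for `a(θ) b(ω)` and for its image under
the generator. -/
def generatorWeight (a : Torus → ℝ) (b : ℝ → ℝ) (z : Phase) : ℝ :=
  |a z.1 * b z.2| + |torusDeriv a z.1 * (z.2 * b z.2)| + (1 + |z.2|) * |a z.1 * deriv b z.2|

instance (μ : ℝ → ProbabilityMeasure Phase) (t : ℝ) : IsProbabilityMeasure (state μ t) :=
  inferInstanceAs (IsProbabilityMeasure (μ (max t 0) : Measure Phase))

lemma state_of_nonneg (μ : ℝ → ProbabilityMeasure Phase) {t : ℝ} (ht : 0 ≤ t) :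
    state μ t = μ t := by
  rw [state, max_eq_left ht]

section Force

variable {m γ κ : ℝ} {ν : Measure Phase}

lemma TorusSmooth.integrable [IsFiniteMeasure ν] {a : Torus → ℝ} (ha : TorusSmooth a) :
    Integrable (fun z : Phase => a z.1) ν := by
  obtain ⟨A, -, hA⟩ := ha.exists_bound
  exact Integrable.of_bound (ha.continuous.comp continuous_fst).aestronglyMeasurable A
    (Eventually.of_forall fun z => hA z.1)

lemma integral_torusSin_sub [IsFiniteMeasure ν] (θ : Torus) :
    ∫ z, torusSin (z.1 - θ) ∂ν =
      (∫ z, torusSin z.1 ∂ν) * torusCos θ - (∫ z, torusCos z.1 ∂ν) * torusSin θ := by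
  simp_rw [torusSin_sub]
  rw [integral_sub (TorusSmooth.torusSin.integrable.mul_const _)
    (TorusSmooth.torusCos.integrable.mul_const _), integral_mul_const, integral_mul_const]

lemma abs_integral_torusSin_sub_le [IsProbabilityMeasure ν] (θ : Torus) :
    |∫ z, torusSin (z.1 - θ) ∂ν| ≤ 1 := by
  simpa using norm_integral_le_of_norm_le_const (μ := ν) (C := 1)
    (f := fun z : Phase => torusSin (z.1 - θ)) (Eventually.of_forall fun z => abs_torusSin_le_one _)

lemma continuous_force [IsFiniteMeasure ν] :
    Continuous fun z : Phase => force m γ κ ν z.1 z.2 := by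
  simp_rw [force, integral_torusSin_sub]
  have hsin := TorusSmooth.torusSin.continuous
  have hcos := TorusSmooth.torusCos.continuous
  fun_prop

lemma abs_force_le [IsProbabilityMeasure ν] (hm : 0 < m) (hγ : 0 < γ) (hκ : 0 < κ) (θ : Torus)
    (w : ℝ) : |force m γ κ ν θ w| ≤ (γ + κ) / m * (1 + |w|) := by
  have hσ := abs_integral_torusSin_sub_le (ν := ν) θ
  rw [force]
  set σ := ∫ z, torusSin (z.1 - θ) ∂ν
  have hsum : |-γ * w + κ * σ| ≤ γ * |w| + κ * |σ| := by
    refine (abs_add_le _ _).trans (le_of_eq ?_)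
    rw [abs_mul, abs_mul, abs_neg, abs_of_pos hγ, abs_of_pos hκ]
  calc |1 / m * (-γ * w + κ * σ)|
      = 1 / m * |-γ * w + κ * σ| := by rw [abs_mul, abs_of_pos (by positivity)]
    _ ≤ 1 / m * ((γ + κ) * (1 + |w|)) := by
        gcongr
        nlinarith [abs_nonneg w, abs_nonneg σ]
    _ = (γ + κ) / m * (1 + |w|) := by ring

end Force

section Generator

variable {m γ κ : ℝ} {ν : Measure Phase} {a : Torus → ℝ} {b : ℝ → ℝ}

lemma continuous_fst_mul_snd (ha : TorusSmooth a) (hb : Continuous b) :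
    Continuous fun z : Phase => a z.1 * b z.2 :=
  (ha.continuous.comp continuous_fst).mul (hb.comp continuous_snd)

lemma continuous_generatorWeight (ha : TorusSmooth a) (hb : ContDiff ℝ ∞ b) :
    Continuous (generatorWeight a b) := by
  have hval := continuous_fst_mul_snd ha hb.continuous
  have htransport := continuous_fst_mul_snd ha.torusDeriv (continuous_id.mul hb.continuous)
  have hforce := continuous_fst_mul_snd ha (hb.continuous_deriv (by simp))
  exact (hval.abs.add htransport.abs).add
    ((continuous_const.add continuous_snd.abs).mul hforce.abs)

lemma generatorWeight_nonneg (z : Phase) : 0 ≤ generatorWeight a b z := by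
  unfold generatorWeight
  positivity

lemma abs_mul_le_generatorWeight (z : Phase) : |a z.1 * b z.2| ≤ generatorWeight a b z := by
  have hforce : 0 ≤ (1 + |z.2|) * |a z.1 * deriv b z.2| := by positivity
  have htransport := abs_nonneg (torusDeriv a z.1 * (z.2 * b z.2))
  unfold generatorWeight
  linarith

lemma integrable_of_generatorWeight (ha : TorusSmooth a) (hb : ContDiff ℝ ∞ b)
    (hI : Integrable (generatorWeight a b) ν) : Integrable (fun z : Phase => a z.1 * b z.2) ν :=
  hI.mono' (continuous_fst_mul_snd ha hb.continuous).aestronglyMeasurable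
    (Eventually.of_forall abs_mul_le_generatorWeight)

lemma abs_generator_le [IsProbabilityMeasure ν] (hm : 0 < m) (hγ : 0 < γ) (hκ : 0 < κ)
    (z : Phase) :
    |generator m γ κ ν a b z| ≤ (1 + (γ + κ) / m) * generatorWeight a b z := by
  have hforce : |force m γ κ ν z.1 z.2 * (a z.1 * deriv b z.2)| ≤
      (γ + κ) / m * ((1 + |z.2|) * |a z.1 * deriv b z.2|) := by
    rw [abs_mul, ← mul_assoc]
    gcongr
    exact abs_force_le hm hγ hκ z.1 z.2
  have hc : 0 ≤ (γ + κ) / m := by positivity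
  have hval := abs_nonneg (a z.1 * b z.2)
  have htransport := abs_nonneg (torusDeriv a z.1 * (z.2 * b z.2))
  have hderiv : 0 ≤ (1 + |z.2|) * |a z.1 * deriv b z.2| := by positivity
  refine (abs_add_le _ _).trans ?_
  rw [generatorWeight]
  nlinarith [mul_nonneg hc hval, mul_nonneg hc htransport]

lemma integrable_transport_of_generatorWeight (ha : TorusSmooth a) (hb : ContDiff ℝ ∞ b)
    (hI : Integrable (generatorWeight a b) ν) :
    Integrable (fun z : Phase => torusDeriv a z.1 * (z.2 * b z.2)) ν := by
  refine hI.mono' (continuous_fst_mul_snd ha.torusDeriv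
    (continuous_id.mul hb.continuous)).aestronglyMeasurable (Eventually.of_forall fun z => ?_)
  have : 0 ≤ (1 + |z.2|) * |a z.1 * deriv b z.2| := by positivity
  rw [Real.norm_eq_abs, generatorWeight]
  linarith [abs_nonneg (a z.1 * b z.2)]

lemma mul_abs_deriv_le_generatorWeight (z : Phase) :
    (1 + |z.2|) * |a z.1 * deriv b z.2| ≤ generatorWeight a b z := by
  rw [generatorWeight]
  linarith [abs_nonneg (a z.1 * b z.2), abs_nonneg (torusDeriv a z.1 * (z.2 * b z.2))]

lemma integrable_mul_deriv_of_generatorWeight (ha : TorusSmooth a) (hb : ContDiff ℝ ∞ b)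
    (hI : Integrable (generatorWeight a b) ν) {g : Phase → ℝ} (hg : Continuous g)
    (hg1 : ∀ z, |g z| ≤ 1 + |z.2|) :
    Integrable (fun z : Phase => g z * (a z.1 * deriv b z.2)) ν := by
  refine hI.mono' (hg.mul (continuous_fst_mul_snd ha
    (hb.continuous_deriv (by simp)))).aestronglyMeasurable
    (Eventually.of_forall fun z => ?_)
  rw [Real.norm_eq_abs, abs_mul]
  exact (mul_le_mul_of_nonneg_right (hg1 z) (abs_nonneg _)).trans
    (mul_abs_deriv_le_generatorWeight z)

lemma integral_generator [IsProbabilityMeasure ν] (ha : TorusSmooth a) (hb : ContDiff ℝ ∞ b)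
    (hI : Integrable (generatorWeight a b) ν) :
    ∫ z, generator m γ κ ν a b z ∂ν =
      ∫ z, torusDeriv a z.1 * (z.2 * b z.2) ∂ν - γ / m * ∫ z, z.2 * (a z.1 * deriv b z.2) ∂ν +
        κ / m * ((∫ z, torusSin z.1 ∂ν) * ∫ z, torusCos z.1 * (a z.1 * deriv b z.2) ∂ν -
          (∫ z, torusCos z.1 ∂ν) * ∫ z, torusSin z.1 * (a z.1 * deriv b z.2) ∂ν) := by
  set S := ∫ z, torusSin z.1 ∂ν with hS
  set C := ∫ z, torusCos z.1 ∂ν with hC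
  have htransport := integrable_transport_of_generatorWeight ha hb hI
  have hfriction := (integrable_mul_deriv_of_generatorWeight ha hb hI continuous_snd
    fun z => by linarith).const_mul (γ / m)
  have hcos := (integrable_mul_deriv_of_generatorWeight ha hb hI
    (TorusSmooth.torusCos.continuous.comp continuous_fst)
    fun z => (abs_torusCos_le_one z.1).trans (by simp)).const_mul S
  have hsin := (integrable_mul_deriv_of_generatorWeight ha hb hI
    (TorusSmooth.torusSin.continuous.comp continuous_fst)
    fun z => (abs_torusSin_le_one z.1).trans (by simp)).const_mul C
  simp only [Function.comp_apply] at hcos hsin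
  calc ∫ z, generator m γ κ ν a b z ∂ν
      = ∫ z, (torusDeriv a z.1 * (z.2 * b z.2) - γ / m * (z.2 * (a z.1 * deriv b z.2)) +
          κ / m * (S * (torusCos z.1 * (a z.1 * deriv b z.2)) -
            C * (torusSin z.1 * (a z.1 * deriv b z.2)))) ∂ν := by
        refine integral_congr_ae (Eventually.of_forall fun z => ?_)
        simp only [generator, force, integral_torusSin_sub, ← hS, ← hC]
        ring
    _ = _ := by
        rw [integral_add (htransport.sub' hfriction) ((hcos.sub' hsin).const_mul _),
          integral_sub htransport hfriction, integral_const_mul, integral_const_mul,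
          integral_sub hcos hsin, integral_const_mul, integral_const_mul]

end Generator

/-! ### The weak equation for dominated observables -/

lemma isTestFunction_mul {a : Torus → ℝ} {b c : ℝ → ℝ} (ha : TorusSmooth a)
    (hb : ContDiff ℝ ∞ b) (hbs : HasCompactSupport b) (hc : ContDiff ℝ ∞ c)
    (hcs : HasCompactSupport c) : IsTestFunction fun θ w t => a θ * b w * c t where
  contDiff := by
    have h1 : ContDiff ℝ ∞ fun p : ℝ × ℝ × ℝ => a (p.1 : Torus) :=
      ContDiff.comp (g := fun x : ℝ => a (x : Torus)) ha contDiff_fst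
    have h2 : ContDiff ℝ ∞ fun p : ℝ × ℝ × ℝ => b p.2.1 := hb.comp contDiff_snd.fst
    have h3 : ContDiff ℝ ∞ fun p : ℝ × ℝ × ℝ => c p.2.2 := hc.comp contDiff_snd.snd
    exact ((h1.mul h2).mul h3).of_le (by exact_mod_cast le_top)
  hasCompactSupport := by
    refine HasCompactSupport.intro
      (isCompact_univ.prod (hbs.isCompact.prod hcs.isCompact)) fun p hp => ?_
    simp only [mem_prod, mem_univ, true_and, not_and_or] at hp
    rcases hp with hp | hp <;> simp [image_eq_zero_of_notMem_tsupport hp]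

section WeakEquation

variable {m γ κ : ℝ} {μ : ℝ → ProbabilityMeasure Phase} {a : Torus → ℝ} {b : ℝ → ℝ}

lemma continuous_moment_of_hasCompactSupport (hμ : IsMeasureValuedSolution m γ κ μ)
    (ha : TorusSmooth a) (hb : ContDiff ℝ ∞ b) (hs : HasCompactSupport b) :
    Continuous (moment μ a b) := by
  refine continuous_iff_continuousAt.2 fun t₀ => ?_
  obtain ⟨n, hn⟩ := exists_nat_gt |t₀|
  have hcont := (hμ.weakly_continuous _ (isTestFunction_mul ha hb hs (contDiff_cutoff n)
    (hasCompactSupport_cutoff n))).comp_continuous (f := fun t : ℝ => max t 0) (by fun_prop)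
    fun t => le_max_right t 0
  refine hcont.continuousAt.congr ?_
  filter_upwards [(isOpen_lt continuous_abs continuous_const).mem_nhds hn] with t ht
  have ht' : |max t 0| ≤ n + 1 := by
    rw [abs_of_nonneg (le_max_right _ _)]
    exact max_le (by linarith [le_abs_self t, show |t| < n from ht]) (by positivity)
  simp [moment, state, cutoff_eq_one ht']

lemma moment_sub_moment_of_hasCompactSupport (hμ : IsMeasureValuedSolution m γ κ μ)
    (ha : TorusSmooth a) (hb : ContDiff ℝ ∞ b) (hs : HasCompactSupport b) {t : ℝ} (ht : 0 ≤ t) :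
    moment μ a b t - moment μ a b 0 =
      ∫ s in (0 : ℝ)..t, ∫ z, generator m γ κ (state μ s) a b z ∂state μ s := by
  obtain ⟨n, hn⟩ := exists_nat_gt t
  have hn1 {s : ℝ} (hs : s ∈ Icc 0 t) : |s| < n + 1 := by
    rw [abs_of_nonneg hs.1]
    linarith [hs.2]
  have hweak := hμ.weak_equation _ (isTestFunction_mul ha hb hs (contDiff_cutoff n)
    (hasCompactSupport_cutoff n)) t ht
  simp only [cutoff_eq_one (hn1 (left_mem_Icc.2 ht)).le,
    cutoff_eq_one (hn1 (right_mem_Icc.2 ht)).le, mul_one] at hweak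
  rw [moment, moment, state_of_nonneg μ ht, state_of_nonneg μ le_rfl, hweak]
  refine intervalIntegral.integral_congr fun s hs' => ?_
  rw [uIcc_of_le ht] at hs'
  simp only [state_of_nonneg μ hs'.1]
  refine integral_congr_ae (Eventually.of_forall fun z => ?_)
  simp only [dTime, dTheta, dOmega, deriv_const_mul_field, deriv_mul_const_field,
    deriv_cutoff_eq_zero (hn1 hs'), cutoff_eq_one (hn1 hs').le, generator, torusDeriv]
  ring

lemma integrable_generatorWeight_of_hasCompactSupport {ν : Measure Phase} [IsFiniteMeasure ν]
    (ha : TorusSmooth a) (hb : ContDiff ℝ ∞ b) (hs : HasCompactSupport b) :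
    Integrable (generatorWeight a b) ν := by
  refine (continuous_generatorWeight ha hb).integrable_of_hasCompactSupport ?_
  refine HasCompactSupport.intro (isCompact_univ.prod hs.isCompact) fun z hz => ?_
  have hz2 : z.2 ∉ tsupport b := fun h => hz ⟨mem_univ _, h⟩
  have hz2' : deriv b z.2 = 0 :=
    image_eq_zero_of_notMem_tsupport fun h => hz2 (tsupport_deriv_subset h)
  simp [generatorWeight, image_eq_zero_of_notMem_tsupport hz2, hz2']

lemma integral_generator_state (ha : TorusSmooth a) (hb : ContDiff ℝ ∞ b) {s : ℝ}
    (hI : Integrable (generatorWeight a b) (state μ s)) :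
    ∫ z, generator m γ κ (state μ s) a b z ∂state μ s =
      moment μ (torusDeriv a) (fun w => w * b w) s -
        γ / m * moment μ a (fun w => w * deriv b w) s +
        κ / m * (moment μ torusSin (fun _ => 1) s *
            moment μ (fun θ => torusCos θ * a θ) (deriv b) s -
          moment μ torusCos (fun _ => 1) s *
            moment μ (fun θ => torusSin θ * a θ) (deriv b) s) := by
  simp only [integral_generator ha hb hI, moment, mul_one, mul_assoc,
    mul_left_comm (a _)]

lemma tendsto_moment_mul_cutoff {s : ℝ} (ha : TorusSmooth a) (hb : Continuous b)
    (hI : Integrable (fun z : Phase => a z.1 * b z.2) (state μ s)) :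
    Tendsto (fun n : ℕ => moment μ a (fun w => b w * cutoff n w) s) atTop
      (𝓝 (moment μ a b s)) := by
  refine tendsto_integral_of_dominated_convergence _
    (fun n =>
      (continuous_fst_mul_snd ha (hb.mul (contDiff_cutoff n).continuous)).aestronglyMeasurable)
    hI.norm (fun n => Eventually.of_forall fun z => ?_) (Eventually.of_forall fun z => ?_)
  · rw [← mul_assoc, norm_mul]
    exact mul_le_of_le_one_right (norm_nonneg _) (abs_cutoff_le_one n _)
  · simpa [mul_assoc] using (tendsto_cutoff z.2).const_mul (a z.1 * b z.2)

lemma deriv_mul_cutoff (hb : ContDiff ℝ ∞ b) (n : ℕ) (w : ℝ) :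
    deriv (fun v => b v * cutoff n v) w = deriv b w * cutoff n w + b w * deriv (cutoff n) w :=
  deriv_fun_mul (hb.differentiable (by simp) w) ((contDiff_cutoff n).differentiable (by simp) w)

lemma exists_generatorWeight_mul_cutoff_le (a : Torus → ℝ) (hb : ContDiff ℝ ∞ b) :
    ∃ B : ℝ, 0 ≤ B ∧ ∀ n z,
      generatorWeight a (fun w => b w * cutoff n w) z ≤ B * generatorWeight a b z := by
  obtain ⟨B, hB0, hB⟩ := exists_bound_deriv_cutoff
  refine ⟨1 + B, by positivity, fun n z => ?_⟩
  have hval : |a z.1 * (b z.2 * cutoff n z.2)| ≤ |a z.1 * b z.2| := by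
    rw [← mul_assoc, abs_mul]
    exact mul_le_of_le_one_right (abs_nonneg _) (abs_cutoff_le_one n _)
  have htransport : |torusDeriv a z.1 * (z.2 * (b z.2 * cutoff n z.2))| ≤
      |torusDeriv a z.1 * (z.2 * b z.2)| := by
    rw [← mul_assoc z.2, ← mul_assoc, abs_mul]
    exact mul_le_of_le_one_right (abs_nonneg _) (abs_cutoff_le_one n _)
  have hforce : (1 + |z.2|) * |a z.1 * deriv (fun w => b w * cutoff n w) z.2| ≤
      (1 + |z.2|) * |a z.1 * deriv b z.2| + B * |a z.1 * b z.2| := by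
    calc (1 + |z.2|) * |a z.1 * deriv (fun w => b w * cutoff n w) z.2|
        ≤ (1 + |z.2|) * (|a z.1 * deriv b z.2| * |cutoff n z.2| +
            |a z.1 * b z.2| * |deriv (cutoff n) z.2|) := by
          gcongr
          rw [deriv_mul_cutoff hb, mul_add, ← mul_assoc, ← mul_assoc, ← abs_mul, ← abs_mul]
          exact abs_add_le _ _
      _ ≤ (1 + |z.2|) * (|a z.1 * deriv b z.2| * 1 + |a z.1 * b z.2| * |deriv (cutoff n) z.2|) := by
          gcongr
          exact abs_cutoff_le_one n _
      _ = (1 + |z.2|) * |a z.1 * deriv b z.2| +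
            (1 + |z.2|) * |deriv (cutoff n) z.2| * |a z.1 * b z.2| := by ring
      _ ≤ _ := by gcongr; exact hB n z.2
  have hrest : 0 ≤ B * (|torusDeriv a z.1 * (z.2 * b z.2)| +
      (1 + |z.2|) * |a z.1 * deriv b z.2|) := by positivity
  unfold generatorWeight
  linarith

lemma continuous_generator {ν : Measure Phase} [IsFiniteMeasure ν] (ha : TorusSmooth a)
    (hb : ContDiff ℝ ∞ b) : Continuous (generator m γ κ ν a b) :=
  (continuous_fst_mul_snd ha.torusDeriv (continuous_id.mul hb.continuous)).add
    (continuous_force.mul (continuous_fst_mul_snd ha (hb.continuous_deriv (by simp))))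

lemma contDiff_mul_cutoff (hb : ContDiff ℝ ∞ b) (n : ℕ) :
    ContDiff ℝ ∞ fun w => b w * cutoff n w := hb.mul (contDiff_cutoff n)

lemma hasCompactSupport_mul_cutoff (b : ℝ → ℝ) (n : ℕ) :
    HasCompactSupport fun w => b w * cutoff n w := (hasCompactSupport_cutoff n).mul_left

lemma tendsto_integral_generator_mul_cutoff {ν : Measure Phase} [IsProbabilityMeasure ν]
    (hm : 0 < m) (hγ : 0 < γ) (hκ : 0 < κ) (ha : TorusSmooth a) (hb : ContDiff ℝ ∞ b)
    (hI : Integrable (generatorWeight a b) ν) :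
    Tendsto (fun n : ℕ => ∫ z, generator m γ κ ν a (fun w => b w * cutoff n w) z ∂ν) atTop
      (𝓝 (∫ z, generator m γ κ ν a b z ∂ν)) := by
  obtain ⟨B, -, hB⟩ := exists_generatorWeight_mul_cutoff_le a hb
  have hc : 0 ≤ 1 + (γ + κ) / m := by positivity
  refine tendsto_integral_of_dominated_convergence _
    (fun n => (continuous_generator ha (contDiff_mul_cutoff hb n)).aestronglyMeasurable)
    ((hI.const_mul B).const_mul (1 + (γ + κ) / m))
    (fun n => Eventually.of_forall fun z => (abs_generator_le hm hγ hκ z).trans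
      (mul_le_mul_of_nonneg_left (hB n z) hc)) (Eventually.of_forall fun z => ?_)
  have hcut := tendsto_cutoff z.2
  have hderiv := (hcut.const_mul (deriv b z.2)).add
    ((tendsto_deriv_cutoff z.2).const_mul (b z.2))
  simp only [generator, deriv_mul_cutoff hb]
  simpa using (((hcut.const_mul (b z.2)).const_mul z.2).const_mul (torusDeriv a z.1)).add
    ((hderiv.const_mul (a z.1)).const_mul (force m γ κ ν z.1 z.2))

lemma measurable_moment (hμ : IsMeasureValuedSolution m γ κ μ) (ha : TorusSmooth a)
    (hb : ContDiff ℝ ∞ b) (hI : ∀ s, Integrable (fun z : Phase => a z.1 * b z.2) (state μ s)) :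
    Measurable (moment μ a b) :=
  measurable_of_tendsto_metrizable
    (fun n => (continuous_moment_of_hasCompactSupport hμ ha (contDiff_mul_cutoff hb n)
      (hasCompactSupport_mul_cutoff b n)).measurable)
    (tendsto_pi_nhds.2 fun s => tendsto_moment_mul_cutoff ha hb.continuous (hI s))

lemma measurable_integral_generator_of_hasCompactSupport (hμ : IsMeasureValuedSolution m γ κ μ)
    (ha : TorusSmooth a) (hb : ContDiff ℝ ∞ b) (hs : HasCompactSupport b) :
    Measurable fun s => ∫ z, generator m γ κ (state μ s) a b z ∂state μ s := by
  have hb' : ContDiff ℝ ∞ (deriv b) := (contDiff_infty_iff_deriv.1 hb).2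
  have hharmonic {c : Torus → ℝ} (hc : TorusSmooth c) : Measurable (moment μ c fun _ => 1) :=
    measurable_moment hμ hc contDiff_const fun s => by simpa using hc.integrable
  have hforce {c : Torus → ℝ} (hc : TorusSmooth c) :
      Measurable (moment μ (fun θ => c θ * a θ) (deriv b)) :=
    (continuous_moment_of_hasCompactSupport hμ (hc.mul ha) hb' hs.deriv).measurable
  have htransport := (continuous_moment_of_hasCompactSupport hμ ha.torusDeriv
    (contDiff_id.mul hb) hs.mul_left).measurable
  have hfriction := (continuous_moment_of_hasCompactSupport hμ ha
    (contDiff_id.mul hb') hs.deriv.mul_left).measurable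
  simp only [integral_generator_state ha hb
    (integrable_generatorWeight_of_hasCompactSupport ha hb hs)]
  exact (htransport.sub (hfriction.const_mul _)).add
    ((((hharmonic .torusSin).mul (hforce .torusCos)).sub
      ((hharmonic .torusCos).mul (hforce .torusSin))).const_mul _)

lemma measurable_integral_generator (hμ : IsMeasureValuedSolution m γ κ μ) (hm : 0 < m)
    (hγ : 0 < γ) (hκ : 0 < κ) (ha : TorusSmooth a) (hb : ContDiff ℝ ∞ b)
    (hI : ∀ s, Integrable (generatorWeight a b) (state μ s)) :
    Measurable fun s => ∫ z, generator m γ κ (state μ s) a b z ∂state μ s :=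
  measurable_of_tendsto_metrizable
    (fun n => measurable_integral_generator_of_hasCompactSupport hμ ha (contDiff_mul_cutoff hb n)
      (hasCompactSupport_mul_cutoff b n))
    (tendsto_pi_nhds.2 fun s => tendsto_integral_generator_mul_cutoff hm hγ hκ ha hb (hI s))

/-- Cutting off in `ω` reduces the equation to compactly supported observables. -/
lemma moment_sub_moment (hμ : IsMeasureValuedSolution m γ κ μ) (hm : 0 < m) (hγ : 0 < γ)
    (hκ : 0 < κ) (ha : TorusSmooth a) (hb : ContDiff ℝ ∞ b)
    (hI : ∀ s, Integrable (generatorWeight a b) (state μ s)) {t M : ℝ} (ht : 0 ≤ t)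
    (hM : ∀ s ∈ Icc 0 t, ∫ z, generatorWeight a b z ∂state μ s ≤ M) :
    moment μ a b t - moment μ a b 0 =
      ∫ s in (0 : ℝ)..t, ∫ z, generator m γ κ (state μ s) a b z ∂state μ s := by
  obtain ⟨B, hB0, hB⟩ := exists_generatorWeight_mul_cutoff_le a hb
  have hmoment (s : ℝ) := tendsto_moment_mul_cutoff ha hb.continuous
    (integrable_of_generatorWeight ha hb (hI s))
  refine tendsto_nhds_unique ((hmoment t).sub (hmoment 0)) ?_
  simp only [moment_sub_moment_of_hasCompactSupport hμ ha (contDiff_mul_cutoff hb _)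
    (hasCompactSupport_mul_cutoff b _) ht]
  refine intervalIntegral.tendsto_integral_filter_of_dominated_convergence
    (fun _ => (1 + (γ + κ) / m) * (B * M))
    (Eventually.of_forall fun n => (measurable_integral_generator_of_hasCompactSupport hμ ha
      (contDiff_mul_cutoff hb n) (hasCompactSupport_mul_cutoff b n)).aestronglyMeasurable)
    (Eventually.of_forall fun n => Eventually.of_forall fun s hs => ?_)
    intervalIntegrable_const (Eventually.of_forall fun s _ =>
      tendsto_integral_generator_mul_cutoff hm hγ hκ ha hb (hI s))
  have hs' : s ∈ Icc 0 t := Ioc_subset_Icc_self (by rwa [uIoc_of_le ht] at hs)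
  calc ‖∫ z, generator m γ κ (state μ s) a (fun w => b w * cutoff n w) z ∂state μ s‖
      ≤ ∫ z, (1 + (γ + κ) / m) * (B * generatorWeight a b z) ∂state μ s := by
        refine norm_integral_le_of_norm_le (((hI s).const_mul B).const_mul _)
          (Eventually.of_forall fun z => (abs_generator_le hm hγ hκ z).trans ?_)
        gcongr
        exact hB n z
    _ = (1 + (γ + κ) / m) * (B * ∫ z, generatorWeight a b z ∂state μ s) := by
        rw [integral_const_mul, integral_const_mul]
    _ ≤ (1 + (γ + κ) / m) * (B * M) := by
        gcongr
        exact hM s hs'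

/-! ### The second moment -/

/-- The second moment `∫ ω² dμ_t`, twice the kinetic energy. -/
def kinetic (μ : ℝ → ProbabilityMeasure Phase) (t : ℝ) : ℝ := ∫ z, z.2 ^ 2 ∂state μ t

/-- A bounded smooth function increasing to `ω²` as `n → ∞`. -/
def saturatedSq (n : ℕ) (w : ℝ) : ℝ := w ^ 2 / (1 + w ^ 2 / (n + 1))

lemma contDiff_saturatedSq (n : ℕ) : ContDiff ℝ ∞ (saturatedSq n) := by
  unfold saturatedSq
  exact ContDiff.div (by fun_prop) (by fun_prop) fun w => by positivity

lemma saturatedSq_nonneg (n : ℕ) (w : ℝ) : 0 ≤ saturatedSq n w := by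
  unfold saturatedSq
  positivity

lemma saturatedSq_le_sq (n : ℕ) (w : ℝ) : saturatedSq n w ≤ w ^ 2 :=
  div_le_self (sq_nonneg w) (le_add_of_nonneg_right (by positivity))

lemma tendsto_saturatedSq (w : ℝ) :
    Tendsto (fun n : ℕ => saturatedSq n w) atTop (𝓝 (w ^ 2)) := by
  have hdenom : Tendsto (fun n : ℕ => 1 + w ^ 2 / ((n : ℝ) + 1)) atTop (𝓝 1) := by
    simpa [div_eq_mul_inv] using
      ((tendsto_one_div_add_atTop_nhds_zero_nat (𝕜 := ℝ)).const_mul (w ^ 2)).const_add 1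
  simpa [Pi.div_def, saturatedSq] using (tendsto_const_nhds (x := w ^ 2)).div hdenom one_ne_zero

lemma deriv_saturatedSq (n : ℕ) (w : ℝ) :
    deriv (saturatedSq n) w = 2 * w / (1 + w ^ 2 / (n + 1)) ^ 2 := by
  have hdenom : (1 + w ^ 2 / ((n : ℝ) + 1)) ≠ 0 := by positivity
  have hsq := hasDerivAt_pow 2 w
  refine (hsq.div ((hsq.div_const ((n : ℝ) + 1)).const_add 1) hdenom).deriv.trans ?_
  field_simp
  ring

lemma generatorWeight_saturatedSq_le (n : ℕ) (z : Phase) :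
    generatorWeight (fun _ => 1) (saturatedSq n) z ≤ 5 * (n + 1) := by
  have hq : 1 ≤ 1 + z.2 ^ 2 / ((n : ℝ) + 1) := le_add_of_nonneg_right (by positivity)
  have hle : (1 : ℝ) ≤ n + 1 := by simp
  have hz : (n + 1) * (1 + z.2 ^ 2 / (n + 1)) = n + 1 + z.2 ^ 2 := by field_simp
  have hderiv : (1 + |z.2|) * (2 * |z.2| / (1 + z.2 ^ 2 / (n + 1)) ^ 2) ≤ 4 * (n + 1) := by
    rw [← mul_div_assoc, div_le_iff₀ (by positivity)]
    have hle_sq : 1 + z.2 ^ 2 / ((n : ℝ) + 1) ≤ (1 + z.2 ^ 2 / (n + 1)) ^ 2 := by nlinarith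
    nlinarith [sq_abs z.2, sq_nonneg (|z.2| - 1), hle]
  have hval : saturatedSq n z.2 ≤ n + 1 := by
    rw [saturatedSq, div_le_iff₀ (by positivity), hz]
    linarith
  simp only [generatorWeight, torusDeriv_const, one_mul, zero_mul, abs_zero, add_zero,
    abs_of_nonneg (saturatedSq_nonneg n z.2), deriv_saturatedSq, abs_div, abs_mul, abs_two,
    abs_pow, abs_of_pos (one_pos.trans_le hq)]
  linarith

lemma force_mul_deriv_saturatedSq_le {ν : Measure Phase} [IsProbabilityMeasure ν] (hm : 0 < m)
    (hγ : 0 < γ) (n : ℕ) (θ : Torus) (w : ℝ) :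
    force m γ κ ν θ w * deriv (saturatedSq n) w ≤ κ ^ 2 / (2 * m * γ) := by
  have hσ := (sq_le_one_iff_abs_le_one _).2 (abs_integral_torusSin_sub_le (ν := ν) θ)
  rw [deriv_saturatedSq, force]
  set σ := ∫ z, torusSin (z.1 - θ) ∂ν
  have hq : 1 ≤ (1 + w ^ 2 / ((n : ℝ) + 1)) ^ 2 :=
    one_le_pow₀ (le_add_of_nonneg_right (by positivity))
  have hfriction : 1 / m * (-γ * w + κ * σ) * (2 * w) ≤ κ ^ 2 / (2 * m * γ) := by
    rw [le_div_iff₀ (by positivity)]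
    have hrw : 1 / m * (-γ * w + κ * σ) * (2 * w) * (2 * m * γ) =
        (κ * σ) ^ 2 - (2 * γ * w - κ * σ) ^ 2 := by field_simp; ring
    rw [hrw, mul_pow]
    nlinarith [sq_nonneg (2 * γ * w - κ * σ), sq_nonneg κ]
  rw [← mul_div_assoc]
  exact div_le_of_le_mul₀ (by positivity) (by positivity)
    (hfriction.trans (le_mul_of_one_le_right (by positivity) hq))

lemma integrable_generator {ν : Measure Phase} [IsProbabilityMeasure ν] (hm : 0 < m) (hγ : 0 < γ)
    (hκ : 0 < κ) (ha : TorusSmooth a) (hb : ContDiff ℝ ∞ b)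
    (hI : Integrable (generatorWeight a b) ν) : Integrable (generator m γ κ ν a b) ν :=
  (hI.const_mul _).mono' (continuous_generator ha hb).aestronglyMeasurable
    (Eventually.of_forall fun _ => abs_generator_le hm hγ hκ _)

lemma intervalIntegral_le_mul {f : ℝ → ℝ} {c t : ℝ} (hc : 0 ≤ c) (ht : 0 ≤ t)
    (hf : ∀ s, f s ≤ c) : ∫ s in (0 : ℝ)..t, f s ≤ c * t := by
  by_cases hi : IntervalIntegrable f volume 0 t
  · calc ∫ s in (0 : ℝ)..t, f s ≤ ∫ _ in (0 : ℝ)..t, c :=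
        intervalIntegral.integral_mono_on ht hi intervalIntegrable_const fun s _ => hf s
      _ = c * t := by simp [mul_comm]
  · rw [intervalIntegral.integral_undef hi]
    positivity

lemma integrable_sq (hμ : IsMeasureValuedSolution m γ κ μ) (t : ℝ) :
    Integrable (fun z : Phase => z.2 ^ 2) (state μ t) :=
  hμ.finite_second_moment _ (le_max_right t 0)

lemma kinetic_nonneg (μ : ℝ → ProbabilityMeasure Phase) (t : ℝ) : 0 ≤ kinetic μ t :=
  integral_nonneg fun z => sq_nonneg z.2

lemma kinetic_le (hμ : IsMeasureValuedSolution m γ κ μ) (hm : 0 < m) (hγ : 0 < γ) (hκ : 0 < κ)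
    {t : ℝ} (ht : 0 ≤ t) : kinetic μ t ≤ kinetic μ 0 + κ ^ 2 / (2 * m * γ) * t := by
  have hc (n : ℕ) : Continuous fun z : Phase => 1 * saturatedSq n z.2 :=
    continuous_fst_mul_snd (.const 1) (contDiff_saturatedSq n).continuous
  have hle (n : ℕ) (z : Phase) : ‖1 * saturatedSq n z.2‖ ≤ z.2 ^ 2 := by
    rw [one_mul, Real.norm_of_nonneg (saturatedSq_nonneg n _)]
    exact saturatedSq_le_sq n _
  have hlim : Tendsto (fun n : ℕ => moment μ (fun _ => 1) (saturatedSq n) t) atTop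
      (𝓝 (kinetic μ t)) :=
    tendsto_integral_of_dominated_convergence _ (fun n => (hc n).aestronglyMeasurable)
      (integrable_sq hμ t) (fun n => Eventually.of_forall (hle n))
      (Eventually.of_forall fun z => by simpa using tendsto_saturatedSq z.2)
  refine le_of_tendsto' hlim fun n => ?_
  have hI (s : ℝ) : Integrable (generatorWeight (fun _ => 1) (saturatedSq n)) (state μ s) :=
    .of_bound (continuous_generatorWeight (.const 1) (contDiff_saturatedSq n)).aestronglyMeasurable
      (5 * (n + 1)) (Eventually.of_forall fun z => by
        rw [Real.norm_of_nonneg (generatorWeight_nonneg z)]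
        exact generatorWeight_saturatedSq_le n z)
  have hweak := moment_sub_moment hμ hm hγ hκ (.const 1) (contDiff_saturatedSq n) hI ht
    (M := 5 * (n + 1)) fun s _ => by
      simpa using integral_mono (hI s) (integrable_const _) (generatorWeight_saturatedSq_le n)
  have hrate : ∫ s in (0 : ℝ)..t, ∫ z, generator m γ κ (state μ s) (fun _ => 1) (saturatedSq n) z
      ∂state μ s ≤ κ ^ 2 / (2 * m * γ) * t := by
    refine intervalIntegral_le_mul (by positivity) ht fun s => ?_
    simpa using integral_mono (integrable_generator hm hγ hκ (.const 1) (contDiff_saturatedSq n)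
      (hI s)) (integrable_const (κ ^ 2 / (2 * m * γ))) fun z => by
        simpa [generator] using force_mul_deriv_saturatedSq_le hm hγ n z.1 z.2
  have hinit : moment μ (fun _ => 1) (saturatedSq n) 0 ≤ kinetic μ 0 :=
    integral_mono ((integrable_sq hμ 0).mono' (hc n).aestronglyMeasurable
      (Eventually.of_forall (hle n))) (integrable_sq hμ 0)
      fun z => (le_abs_self _).trans (hle n z)
  linarith

/-- Observables `a(θ) b(ω)` of at most quadratic growth in `ω`, together with their image under
the generator; their moments are differentiable in time. -/
structure Admissible (a : Torus → ℝ) (b : ℝ → ℝ) : Prop where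
  phase : TorusSmooth a
  freq : ContDiff ℝ ∞ b
  growth : ∃ B : ℝ, ∀ z, generatorWeight a b z ≤ B * (1 + z.2 ^ 2)

lemma admissible_one (ha : TorusSmooth a) : Admissible a fun _ => 1 where
  phase := ha
  freq := contDiff_const
  growth := by
    obtain ⟨A, hA0, hA⟩ := ha.exists_bound
    obtain ⟨A', hA'0, hA'⟩ := ha.torusDeriv.exists_bound
    refine ⟨A + A', fun z => ?_⟩
    have hz : |z.2| ≤ 1 + z.2 ^ 2 := by nlinarith [sq_abs z.2, sq_nonneg (|z.2| - 1)]
    have htransport : |torusDeriv a z.1| * |z.2| ≤ A' * (1 + z.2 ^ 2) := by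
      gcongr
      exact hA' z.1
    simp only [generatorWeight, deriv_const, mul_one, mul_zero, abs_zero, add_zero, abs_mul]
    nlinarith [hA z.1, sq_nonneg z.2]

lemma admissible_id (ha : TorusSmooth a) : Admissible a fun w => w where
  phase := ha
  freq := contDiff_id
  growth := by
    obtain ⟨A, hA0, hA⟩ := ha.exists_bound
    obtain ⟨A', hA'0, hA'⟩ := ha.torusDeriv.exists_bound
    refine ⟨3 * A + A', fun z => ?_⟩
    have hz : |z.2| ≤ 1 + z.2 ^ 2 := by nlinarith [sq_abs z.2, sq_nonneg (|z.2| - 1)]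
    have hval : |a z.1| * |z.2| ≤ A * (1 + z.2 ^ 2) := by
      gcongr
      exact hA z.1
    have htransport : |torusDeriv a z.1| * z.2 ^ 2 ≤ A' * z.2 ^ 2 := by
      gcongr
      exact hA' z.1
    simp only [generatorWeight, deriv_id'', mul_one, abs_mul, ← sq, abs_of_nonneg (sq_nonneg z.2)]
    nlinarith [hA z.1, sq_nonneg z.2]

lemma admissible_sq : Admissible (fun _ => 1) fun w => w ^ 2 where
  phase := .const 1
  freq := by fun_prop
  growth := by
    refine ⟨5, fun z => ?_⟩
    simp only [generatorWeight, torusDeriv_const, one_mul, zero_mul, abs_zero, add_zero, abs_pow,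
      sq_abs, deriv_pow_field, Nat.cast_ofNat, Nat.add_one_sub_one, pow_one, abs_mul, abs_two]
    nlinarith [sq_abs z.2, sq_nonneg (|z.2| - 1)]

lemma Admissible.exists_bound (h : Admissible a b) :
    ∃ B : ℝ, 0 ≤ B ∧ ∀ z, generatorWeight a b z ≤ B * (1 + z.2 ^ 2) := by
  obtain ⟨B, hB⟩ := h.growth
  refine ⟨|B|, abs_nonneg B, fun z => (hB z).trans ?_⟩
  gcongr
  exact le_abs_self B

lemma integrable_one_add_sq (hμ : IsMeasureValuedSolution m γ κ μ) (t : ℝ) :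
    Integrable (fun z : Phase => 1 + z.2 ^ 2) (state μ t) :=
  (integrable_const (1 : ℝ)).add (integrable_sq hμ t)

lemma integral_one_add_sq (hμ : IsMeasureValuedSolution m γ κ μ) (t : ℝ) :
    ∫ z, (1 + z.2 ^ 2) ∂state μ t = 1 + kinetic μ t := by
  rw [integral_add (integrable_const 1) (integrable_sq hμ t), kinetic]
  simp

lemma Admissible.integrable_generatorWeight (h : Admissible a b)
    (hμ : IsMeasureValuedSolution m γ κ μ) (t : ℝ) :
    Integrable (generatorWeight a b) (state μ t) := by
  obtain ⟨B, -, hB⟩ := h.exists_bound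
  refine ((integrable_one_add_sq hμ t).const_mul B).mono'
    (continuous_generatorWeight h.phase h.freq).aestronglyMeasurable
    (Eventually.of_forall fun z => ?_)
  rw [Real.norm_of_nonneg (generatorWeight_nonneg z)]
  exact hB z

lemma integral_generatorWeight_le (hμ : IsMeasureValuedSolution m γ κ μ) (h : Admissible a b)
    {B : ℝ} (hB : ∀ z, generatorWeight a b z ≤ B * (1 + z.2 ^ 2)) (t : ℝ) :
    ∫ z, generatorWeight a b z ∂state μ t ≤ B * (1 + kinetic μ t) := by
  rw [← integral_one_add_sq hμ, ← integral_const_mul]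
  exact integral_mono (h.integrable_generatorWeight hμ t)
    ((integrable_one_add_sq hμ t).const_mul B) hB

lemma state_max (μ : ℝ → ProbabilityMeasure Phase) (t : ℝ) : state μ (max t 0) = state μ t := by
  simp [state]

lemma kinetic_le_max (hμ : IsMeasureValuedSolution m γ κ μ) (hm : 0 < m) (hγ : 0 < γ)
    (hκ : 0 < κ) (t : ℝ) : kinetic μ t ≤ kinetic μ 0 + κ ^ 2 / (2 * m * γ) * max t 0 := by
  simpa only [kinetic, state_max] using kinetic_le hμ hm hγ hκ (le_max_right t 0)

lemma moment_eq_add_integral (hμ : IsMeasureValuedSolution m γ κ μ) (hm : 0 < m) (hγ : 0 < γ)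
    (hκ : 0 < κ) (h : Admissible a b) {t : ℝ} (ht : 0 ≤ t) :
    moment μ a b t = moment μ a b 0 +
      ∫ s in (0 : ℝ)..t, ∫ z, generator m γ κ (state μ s) a b z ∂state μ s := by
  obtain ⟨B, hB0, hB⟩ := h.exists_bound
  rw [← moment_sub_moment hμ hm hγ hκ h.phase h.freq (h.integrable_generatorWeight hμ) ht
    (M := B * (1 + (kinetic μ 0 + κ ^ 2 / (2 * m * γ) * t))) fun s hs => ?_]
  · ring
  refine (integral_generatorWeight_le hμ h hB s).trans ?_
  gcongr
  exact (kinetic_le hμ hm hγ hκ hs.1).trans (by gcongr; exact hs.2)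

lemma intervalIntegrable_integral_generator (hμ : IsMeasureValuedSolution m γ κ μ) (hm : 0 < m)
    (hγ : 0 < γ) (hκ : 0 < κ) (h : Admissible a b) (t₀ t₁ : ℝ) :
    IntervalIntegrable (fun s => ∫ z, generator m γ κ (state μ s) a b z ∂state μ s)
      volume t₀ t₁ := by
  obtain ⟨B, hB0, hB⟩ := h.exists_bound
  have hbound : Continuous fun s : ℝ => (1 + (γ + κ) / m) *
      (B * (1 + (kinetic μ 0 + κ ^ 2 / (2 * m * γ) * max s 0))) := by fun_prop
  refine (hbound.intervalIntegrable t₀ t₁).mono_fun'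
    (measurable_integral_generator hμ hm hγ hκ h.phase h.freq
      (h.integrable_generatorWeight hμ)).aestronglyMeasurable (Eventually.of_forall fun s => ?_)
  calc ‖∫ z, generator m γ κ (state μ s) a b z ∂state μ s‖
      ≤ ∫ z, (1 + (γ + κ) / m) * generatorWeight a b z ∂state μ s :=
        norm_integral_le_of_norm_le ((h.integrable_generatorWeight hμ s).const_mul _)
          (Eventually.of_forall (abs_generator_le hm hγ hκ))
    _ = (1 + (γ + κ) / m) * ∫ z, generatorWeight a b z ∂state μ s := integral_const_mul _ _
    _ ≤ _ := by
        refine mul_le_mul_of_nonneg_left ((integral_generatorWeight_le hμ h hB s).trans ?_)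
          (by positivity)
        gcongr
        exact kinetic_le_max hμ hm hγ hκ s

lemma moment_one_sq (μ : ℝ → ProbabilityMeasure Phase) :
    moment μ (fun _ => 1) (fun w => w ^ 2) = kinetic μ := by
  ext t
  simp [moment, kinetic]

lemma continuous_kinetic (hμ : IsMeasureValuedSolution m γ κ μ) (hm : 0 < m) (hγ : 0 < γ)
    (hκ : 0 < κ) : Continuous (kinetic μ) := by
  have hprimitive := (intervalIntegral.continuous_primitive
    (intervalIntegrable_integral_generator hμ hm hγ hκ admissible_sq) 0).comp
    (continuous_id.max (continuous_const (y := (0 : ℝ))))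
  refine (hprimitive.const_add (kinetic μ 0)).congr fun t => ?_
  have hweak := moment_eq_add_integral hμ hm hγ hκ admissible_sq (le_max_right t 0)
  simp only [moment_one_sq] at hweak
  rw [Function.comp_apply, id, ← hweak, kinetic, state_max, kinetic]

/-- By Dini's theorem: continuity of the second moment makes it uniformly integrable, locally in
time. -/
lemma tendstoLocallyUniformly_cutoff (hμ : IsMeasureValuedSolution m γ κ μ) (hm : 0 < m)
    (hγ : 0 < γ) (hκ : 0 < κ) :
    TendstoLocallyUniformly (fun (n : ℕ) t => moment μ (fun _ => 1)
      (fun w => (1 + w ^ 2) * cutoff n w) t) (fun t => 1 + kinetic μ t) atTop := by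
  have hsmooth : ContDiff ℝ ∞ fun w : ℝ => 1 + w ^ 2 := by fun_prop
  have hint (n : ℕ) (t : ℝ) : Integrable (fun z : Phase => 1 * ((1 + z.2 ^ 2) * cutoff n z.2))
      (state μ t) := by
    refine (integrable_one_add_sq hμ t).mono' (continuous_fst_mul_snd (.const 1)
      (contDiff_mul_cutoff hsmooth n).continuous).aestronglyMeasurable
      (Eventually.of_forall fun z => ?_)
    rw [one_mul, norm_mul, Real.norm_of_nonneg (by positivity : (0 : ℝ) ≤ 1 + z.2 ^ 2)]
    exact mul_le_of_le_one_right (by positivity) (abs_cutoff_le_one n _)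
  refine Monotone.tendstoLocallyUniformly_of_forall_tendsto
    (fun n => continuous_moment_of_hasCompactSupport hμ (.const 1)
      (contDiff_mul_cutoff hsmooth n) (hasCompactSupport_mul_cutoff _ n))
    (fun k n hkn t => integral_mono (hint k t) (hint n t) fun z => ?_)
    ((continuous_kinetic hμ hm hγ hκ).const_add 1) fun t => ?_
  · simp only [one_mul]
    gcongr
    exact monotone_cutoff z.2 hkn
  · have hlim := tendsto_moment_mul_cutoff (μ := μ) (s := t) (.const 1) hsmooth.continuous
      (by simpa using integrable_one_add_sq hμ t)
    simpa only [moment, one_mul, integral_one_add_sq hμ] using hlim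

lemma integrable_mul_of_le_one_add_sq (hμ : IsMeasureValuedSolution m γ κ μ)
    (ha : TorusSmooth a) (hb : Continuous b) {B : ℝ}
    (hB : ∀ z : Phase, |a z.1 * b z.2| ≤ B * (1 + z.2 ^ 2)) (t : ℝ) :
    Integrable (fun z : Phase => a z.1 * b z.2) (state μ t) :=
  ((integrable_one_add_sq hμ t).const_mul B).mono'
    (continuous_fst_mul_snd ha hb).aestronglyMeasurable (Eventually.of_forall hB)

lemma abs_moment_sub_moment_mul_cutoff_le (hμ : IsMeasureValuedSolution m γ κ μ)
    (ha : TorusSmooth a) (hb : Continuous b) {B : ℝ}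
    (hB : ∀ z : Phase, |a z.1 * b z.2| ≤ B * (1 + z.2 ^ 2)) (n : ℕ) (t : ℝ) :
    |moment μ a b t - moment μ a (fun w => b w * cutoff n w) t| ≤
      B * (1 + kinetic μ t - moment μ (fun _ => 1) (fun w => (1 + w ^ 2) * cutoff n w) t) := by
  have hint {f : ℝ → ℝ} {c : Torus → ℝ} (hc : TorusSmooth c) (hf : Continuous f) {A : ℝ}
      (hA : ∀ z : Phase, |c z.1 * f z.2| ≤ A * (1 + z.2 ^ 2)) :
      Integrable (fun z : Phase => c z.1 * (f z.2 * cutoff n z.2)) (state μ t) := by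
    refine integrable_mul_of_le_one_add_sq (b := fun w => f w * cutoff n w) hμ hc
      (hf.mul (contDiff_cutoff n).continuous) (B := A) (fun z => ?_) t
    rw [← mul_assoc, abs_mul]
    exact (mul_le_of_le_one_right (abs_nonneg _) (abs_cutoff_le_one n _)).trans (hA z)
  have hone := integrable_one_add_sq hμ t
  have hcut : Integrable (fun z : Phase => (1 : ℝ) * ((1 + z.2 ^ 2) * cutoff n z.2))
      (state μ t) :=
    hint (.const 1) (f := fun w => 1 + w ^ 2) (by fun_prop) (A := 1) fun z => by
      simpa using (abs_of_nonneg (by positivity : (0 : ℝ) ≤ 1 + z.2 ^ 2)).le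
  rw [moment, moment, ← integral_sub (integrable_mul_of_le_one_add_sq hμ ha hb hB t)
    (hint ha hb hB), ← integral_one_add_sq hμ, moment, ← integral_sub hone hcut,
    ← integral_const_mul]
  refine norm_integral_le_of_norm_le (G := ℝ) ((hone.sub hcut).const_mul B)
    (Eventually.of_forall fun z => ?_)
  have hχ : 0 ≤ 1 - cutoff n z.2 := sub_nonneg.2 (cutoff_le_one n _)
  calc ‖a z.1 * b z.2 - a z.1 * (b z.2 * cutoff n z.2)‖
      = |a z.1 * b z.2| * (1 - cutoff n z.2) := by
        rw [Real.norm_eq_abs, ← mul_assoc, ← mul_one_sub, abs_mul, abs_of_nonneg hχ]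
    _ ≤ B * (1 + z.2 ^ 2) * (1 - cutoff n z.2) := by gcongr; exact hB z
    _ = _ := by ring

lemma continuous_moment (hμ : IsMeasureValuedSolution m γ κ μ) (hm : 0 < m) (hγ : 0 < γ)
    (hκ : 0 < κ) (ha : TorusSmooth a) (hb : ContDiff ℝ ∞ b) {B : ℝ}
    (hB : ∀ z : Phase, |a z.1 * b z.2| ≤ B * (1 + z.2 ^ 2)) : Continuous (moment μ a b) := by
  have hB0 : 0 ≤ B := by simpa using (abs_nonneg _).trans (hB 0)
  have hunif : TendstoLocallyUniformly (fun (n : ℕ) t => moment μ a (fun w => b w * cutoff n w) t)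
      (moment μ a b) atTop := by
    refine Metric.tendstoLocallyUniformly_iff.2 fun ε hε t₀ => ?_
    obtain ⟨U, hU, hlim⟩ := Metric.tendstoLocallyUniformly_iff.1
      (tendstoLocallyUniformly_cutoff hμ hm hγ hκ) (ε / (B + 1)) (by positivity) t₀
    refine ⟨U, hU, hlim.mono fun n hn t ht => ?_⟩
    have htail := (le_abs_self _).trans_lt (hn t ht)
    calc |moment μ a b t - moment μ a (fun w => b w * cutoff n w) t|
        ≤ B * (1 + kinetic μ t - moment μ (fun _ => 1) (fun w => (1 + w ^ 2) * cutoff n w) t) :=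
          abs_moment_sub_moment_mul_cutoff_le hμ ha hb.continuous hB n t
      _ ≤ B * (ε / (B + 1)) := by gcongr
      _ < ε := by
          rw [mul_div_assoc', div_lt_iff₀ (by positivity)]
          linarith
  exact hunif.continuous (Frequently.of_forall fun n => continuous_moment_of_hasCompactSupport hμ
    ha (contDiff_mul_cutoff hb n) (hasCompactSupport_mul_cutoff b n))

lemma Admissible.continuous_moment (h : Admissible a b) (hμ : IsMeasureValuedSolution m γ κ μ)
    (hm : 0 < m) (hγ : 0 < γ) (hκ : 0 < κ) : Continuous (moment μ a b) := by
  obtain ⟨B, hB⟩ := h.growth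
  exact KineticKuramoto.continuous_moment hμ hm hγ hκ h.phase h.freq fun z =>
    (abs_mul_le_generatorWeight z).trans (hB z)

lemma continuous_integral_generator (hμ : IsMeasureValuedSolution m γ κ μ) (hm : 0 < m)
    (hγ : 0 < γ) (hκ : 0 < κ) (h : Admissible a b) :
    Continuous fun s => ∫ z, generator m γ κ (state μ s) a b z ∂state μ s := by
  obtain ⟨B, hB⟩ := h.growth
  have hb' : ContDiff ℝ ∞ (deriv b) := (contDiff_infty_iff_deriv.1 h.freq).2
  have htransport := continuous_moment hμ hm hγ hκ h.phase.torusDeriv (contDiff_id.mul h.freq)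
    (B := B) fun z => by
      have := (mul_abs_deriv_le_generatorWeight z).trans (hB z)
      refine le_trans ?_ (hB z)
      simp only [generatorWeight, id]
      nlinarith [abs_nonneg (a z.1 * b z.2), abs_nonneg z.2, abs_nonneg (a z.1 * deriv b z.2)]
  have hweight {g : ℝ} {z : Phase} (hg : |g| ≤ 1 + |z.2|) :
      |g * (a z.1 * deriv b z.2)| ≤ B * (1 + z.2 ^ 2) := by
    rw [abs_mul]
    exact (mul_le_mul_of_nonneg_right hg (abs_nonneg _)).trans
      ((mul_abs_deriv_le_generatorWeight z).trans (hB z))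
  have hfriction := continuous_moment hμ hm hγ hκ h.phase (contDiff_id.mul hb') fun z => by
    simpa only [id, mul_left_comm (a z.1)] using hweight (g := z.2) (z := z) (by linarith)
  have hforce {c : Torus → ℝ} (hc : TorusSmooth c) (hc1 : ∀ θ, |c θ| ≤ 1) :
      Continuous (moment μ (fun θ => c θ * a θ) (deriv b)) :=
    continuous_moment hμ hm hγ hκ (hc.mul h.phase) hb' fun z => by
      simpa only [mul_assoc] using hweight (g := c z.1) (z := z) ((hc1 _).trans (by simp))
  have hharmonic {c : Torus → ℝ} (hc : TorusSmooth c) : Continuous (moment μ c fun _ => 1) :=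
    (admissible_one hc).continuous_moment hμ hm hγ hκ
  simp only [integral_generator_state h.phase h.freq (h.integrable_generatorWeight hμ _)]
  exact (htransport.sub (hfriction.const_mul _)).add
    ((((hharmonic .torusSin).mul (hforce .torusCos abs_torusCos_le_one)).sub
      ((hharmonic .torusCos).mul (hforce .torusSin abs_torusSin_le_one))).const_mul _)

lemma hasDerivWithinAt_moment (hμ : IsMeasureValuedSolution m γ κ μ) (hm : 0 < m) (hγ : 0 < γ)
    (hκ : 0 < κ) (h : Admissible a b) {t : ℝ} (ht : 0 ≤ t) :
    HasDerivWithinAt (moment μ a b)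
      (moment μ (torusDeriv a) (fun w => w * b w) t -
        γ / m * moment μ a (fun w => w * deriv b w) t +
        κ / m * (moment μ torusSin (fun _ => 1) t *
            moment μ (fun θ => torusCos θ * a θ) (deriv b) t -
          moment μ torusCos (fun _ => 1) t *
            moment μ (fun θ => torusSin θ * a θ) (deriv b) t)) (Ici 0) t := by
  rw [← integral_generator_state h.phase h.freq (h.integrable_generatorWeight hμ t)]
  have hderiv := ((continuous_integral_generator hμ hm hγ hκ h).integral_hasStrictDerivAt 0
    t).hasDerivAt.hasDerivWithinAt (s := Ici 0)
  exact (hderiv.const_add (moment μ a b 0)).congr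
    (fun s hs => moment_eq_add_integral hμ hm hγ hκ h hs) (moment_eq_add_integral hμ hm hγ hκ h ht)

/-! ### Macroscopic quantities -/

/-- The moment `∫ a(θ) ω^k dμ_t`. -/
def freqMoment (μ : ℝ → ProbabilityMeasure Phase) (k : ℕ) (a : Torus → ℝ) (t : ℝ) : ℝ :=
  moment μ a (fun w => w ^ k) t

lemma abs_pow_le_one_add_sq {k : ℕ} (hk : k ≤ 2) (w : ℝ) : |w ^ k| ≤ 1 + w ^ 2 := by
  rw [abs_pow]
  interval_cases k <;> nlinarith [sq_abs w, sq_nonneg (|w| - 1)]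

lemma exists_abs_mul_pow_le (ha : TorusSmooth a) {k : ℕ} (hk : k ≤ 2) :
    ∃ B, ∀ z : Phase, |a z.1 * z.2 ^ k| ≤ B * (1 + z.2 ^ 2) := by
  obtain ⟨A, hA0, hA⟩ := ha.exists_bound
  refine ⟨A, fun z => ?_⟩
  rw [abs_mul]
  gcongr
  exacts [hA _, abs_pow_le_one_add_sq hk _]

lemma integrable_mul_pow (hμ : IsMeasureValuedSolution m γ κ μ) (ha : TorusSmooth a) {k : ℕ}
    (hk : k ≤ 2) (t : ℝ) : Integrable (fun z : Phase => a z.1 * z.2 ^ k) (state μ t) := by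
  obtain ⟨B, hB⟩ := exists_abs_mul_pow_le ha hk
  exact integrable_mul_of_le_one_add_sq hμ ha (continuous_pow k) hB t

lemma continuous_freqMoment (hμ : IsMeasureValuedSolution m γ κ μ) (hm : 0 < m) (hγ : 0 < γ)
    (hκ : 0 < κ) (ha : TorusSmooth a) {k : ℕ} (hk : k ≤ 2) : Continuous (freqMoment μ k a) := by
  obtain ⟨B, hB⟩ := exists_abs_mul_pow_le ha hk
  exact continuous_moment hμ hm hγ hκ ha (contDiff_id.pow k) hB

lemma freqMoment_add_mul (hμ : IsMeasureValuedSolution m γ κ μ) {a₁ a₂ : Torus → ℝ}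
    (h₁ : TorusSmooth a₁) (h₂ : TorusSmooth a₂) {k : ℕ} (hk : k ≤ 2) (c₁ c₂ t : ℝ) :
    freqMoment μ k (fun θ => c₁ * a₁ θ + c₂ * a₂ θ) t =
      c₁ * freqMoment μ k a₁ t + c₂ * freqMoment μ k a₂ t := by
  have hi₁ := (integrable_mul_pow hμ h₁ hk t).const_mul c₁
  have hi₂ := (integrable_mul_pow hμ h₂ hk t).const_mul c₂
  simp only [freqMoment, moment, add_mul, mul_assoc]
  rw [integral_add hi₁ hi₂, integral_const_mul, integral_const_mul]

lemma freqMoment_add_mul₃ (hμ : IsMeasureValuedSolution m γ κ μ) {a₁ a₂ a₃ : Torus → ℝ}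
    (h₁ : TorusSmooth a₁) (h₂ : TorusSmooth a₂) (h₃ : TorusSmooth a₃) {k : ℕ} (hk : k ≤ 2)
    (c₁ c₂ c₃ t : ℝ) :
    freqMoment μ k (fun θ => c₁ * a₁ θ + c₂ * a₂ θ + c₃ * a₃ θ) t =
      c₁ * freqMoment μ k a₁ t + c₂ * freqMoment μ k a₂ t + c₃ * freqMoment μ k a₃ t := by
  have hsum : TorusSmooth fun θ => c₁ * a₁ θ + c₂ * a₂ θ :=
    ((TorusSmooth.const c₁).mul h₁).add ((TorusSmooth.const c₂).mul h₂)
  simpa only [one_mul, freqMoment_add_mul hμ h₁ h₂ hk] using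
    freqMoment_add_mul hμ hsum h₃ hk 1 c₃ t

lemma freqMoment_le (hμ : IsMeasureValuedSolution m γ κ μ) (ha : TorusSmooth a)
    {b : Torus → ℝ} (hb : TorusSmooth b) {k : ℕ} (hk : k ≤ 2) {t c β : ℝ}
    (h : ∀ θ w, a θ * w ^ k ≤ c + b θ + β * w ^ 2) :
    freqMoment μ k a t ≤ c + freqMoment μ 0 b t + β * kinetic μ t := by
  have hib : Integrable (fun z : Phase => b z.1) (state μ t) := hb.integrable
  have hicb : Integrable (fun z : Phase => c + b z.1) (state μ t) := (integrable_const c).add hib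
  have hiω := (integrable_sq hμ t).const_mul β
  calc freqMoment μ k a t ≤ ∫ z, (c + b z.1 + β * z.2 ^ 2) ∂state μ t :=
        integral_mono (integrable_mul_pow hμ ha hk t) (hicb.add hiω) fun z => h z.1 z.2
    _ = c + freqMoment μ 0 b t + β * kinetic μ t := by
        rw [integral_add hicb hiω, integral_add (integrable_const c) hib, integral_const_mul]
        simp [freqMoment, moment, kinetic]

/-- The mean of `cos θ`. -/
def cosMean (μ : ℝ → ProbabilityMeasure Phase) (t : ℝ) : ℝ := freqMoment μ 0 torusCos t

/-- The mean of `sin θ`. -/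
def sinMean (μ : ℝ → ProbabilityMeasure Phase) (t : ℝ) : ℝ := freqMoment μ 0 torusSin t

/-- The square of the order parameter. -/
def orderSq (μ : ℝ → ProbabilityMeasure Phase) (t : ℝ) : ℝ := cosMean μ t ^ 2 + sinMean μ t ^ 2

/-- With `R e^{iψ}` the mean of `e^{iθ}`, this is `R sin (θ - ψ)`. -/
def normal (μ : ℝ → ProbabilityMeasure Phase) (t : ℝ) (θ : Torus) : ℝ :=
  cosMean μ t * torusSin θ + -sinMean μ t * torusCos θ

/-- With `R e^{iψ}` the mean of `e^{iθ}`, this is `R cos (θ - ψ)`. -/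
def tangent (μ : ℝ → ProbabilityMeasure Phase) (t : ℝ) (θ : Torus) : ℝ :=
  cosMean μ t * torusCos θ + sinMean μ t * torusSin θ

/-- The second moment of `normal`; it vanishes exactly on bi-polar phase distributions when the
order parameter does not. -/
def spread (μ : ℝ → ProbabilityMeasure Phase) (t : ℝ) : ℝ :=
  freqMoment μ 0 (fun θ => normal μ t θ ^ 2) t

/-- The correlation of `normal` with the frequency. -/
def drift (μ : ℝ → ProbabilityMeasure Phase) (t : ℝ) : ℝ := freqMoment μ 1 (normal μ t) t

/-- The total energy: kinetic energy plus the potential energy of the mean field. -/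
def energy (m κ : ℝ) (μ : ℝ → ProbabilityMeasure Phase) (t : ℝ) : ℝ :=
  kinetic μ t / 2 - κ / (2 * m) * orderSq μ t

lemma torusSmooth_normal (μ : ℝ → ProbabilityMeasure Phase) (t : ℝ) :
    TorusSmooth (normal μ t) :=
  ((TorusSmooth.const _).mul .torusSin).add ((TorusSmooth.const _).mul .torusCos)

lemma torusSmooth_tangent (μ : ℝ → ProbabilityMeasure Phase) (t : ℝ) :
    TorusSmooth (tangent μ t) :=
  ((TorusSmooth.const _).mul .torusCos).add ((TorusSmooth.const _).mul .torusSin)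

lemma torusSmooth_normal_sq (μ : ℝ → ProbabilityMeasure Phase) (t : ℝ) :
    TorusSmooth fun θ => normal μ t θ ^ 2 := by
  simpa only [sq] using (torusSmooth_normal μ t).mul (torusSmooth_normal μ t)

lemma normal_sq_add_tangent_sq (μ : ℝ → ProbabilityMeasure Phase) (t : ℝ) (θ : Torus) :
    normal μ t θ ^ 2 + tangent μ t θ ^ 2 = orderSq μ t := by
  unfold normal tangent orderSq
  linear_combination (cosMean μ t ^ 2 + sinMean μ t ^ 2) * torusSin_sq_add_torusCos_sq θ

lemma orderSq_nonneg (μ : ℝ → ProbabilityMeasure Phase) (t : ℝ) : 0 ≤ orderSq μ t := by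
  unfold orderSq
  positivity

lemma freqMoment_zero_fun (μ : ℝ → ProbabilityMeasure Phase) (k : ℕ) (t : ℝ) :
    freqMoment μ k (fun _ => 0) t = 0 := by
  simp [freqMoment, moment]

lemma orderSq_le_one (hμ : IsMeasureValuedSolution m γ κ μ) (t : ℝ) : orderSq μ t ≤ 1 := by
  have htangent : freqMoment μ 0 (tangent μ t) t = orderSq μ t := by
    rw [orderSq, sq, sq]
    exact freqMoment_add_mul hμ .torusCos .torusSin (Nat.zero_le 2) _ _ t
  have hyoung := freqMoment_le hμ (torusSmooth_tangent μ t) (.const 0) (Nat.zero_le 2)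
    (t := t) (c := (1 + orderSq μ t) / 2) (β := 0) fun θ w => by
      nlinarith [normal_sq_add_tangent_sq μ t θ, sq_nonneg (normal μ t θ),
        sq_nonneg (tangent μ t θ - 1)]
  rw [freqMoment_zero_fun] at hyoung
  linarith

lemma tangent_sq_le_one (hμ : IsMeasureValuedSolution m γ κ μ) (t : ℝ) (θ : Torus) :
    tangent μ t θ ^ 2 ≤ 1 := by
  linarith [normal_sq_add_tangent_sq μ t θ, sq_nonneg (normal μ t θ), orderSq_le_one hμ t]

lemma normal_sq_le_one (hμ : IsMeasureValuedSolution m γ κ μ) (t : ℝ) (θ : Torus) :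
    normal μ t θ ^ 2 ≤ 1 := by
  linarith [normal_sq_add_tangent_sq μ t θ, sq_nonneg (tangent μ t θ), orderSq_le_one hμ t]

lemma spread_nonneg (μ : ℝ → ProbabilityMeasure Phase) (t : ℝ) : 0 ≤ spread μ t :=
  integral_nonneg fun z => by positivity

lemma spread_le_orderSq (hμ : IsMeasureValuedSolution m γ κ μ) (t : ℝ) :
    spread μ t ≤ orderSq μ t := by
  have hle := freqMoment_le hμ (torusSmooth_normal_sq μ t) (.const 0) (Nat.zero_le 2) (t := t)
    (c := orderSq μ t) (β := 0) fun θ w => by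
      nlinarith [normal_sq_add_tangent_sq μ t θ, sq_nonneg (tangent μ t θ)]
  simpa [freqMoment, moment, spread] using hle

lemma drift_eq (hμ : IsMeasureValuedSolution m γ κ μ) (t : ℝ) :
    drift μ t = cosMean μ t * freqMoment μ 1 torusSin t +
      -sinMean μ t * freqMoment μ 1 torusCos t :=
  freqMoment_add_mul hμ .torusSin .torusCos one_le_two _ _ t

lemma spread_eq (hμ : IsMeasureValuedSolution m γ κ μ) (t : ℝ) :
    spread μ t = cosMean μ t ^ 2 * freqMoment μ 0 (fun θ => torusSin θ * torusSin θ) t +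
      -(2 * cosMean μ t * sinMean μ t) * freqMoment μ 0 (fun θ => torusSin θ * torusCos θ) t +
      sinMean μ t ^ 2 * freqMoment μ 0 (fun θ => torusCos θ * torusCos θ) t := by
  rw [← freqMoment_add_mul₃ hμ (TorusSmooth.torusSin.mul .torusSin)
    (TorusSmooth.torusSin.mul .torusCos) (TorusSmooth.torusCos.mul .torusCos) (Nat.zero_le 2),
    spread]
  congr 1
  ext θ
  rw [normal]
  ring

lemma freqMoment_zero (μ : ℝ → ProbabilityMeasure Phase) (a : Torus → ℝ) :
    freqMoment μ 0 a = moment μ a fun _ => 1 := by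
  ext t
  simp [freqMoment, moment]

lemma freqMoment_one (μ : ℝ → ProbabilityMeasure Phase) (a : Torus → ℝ) :
    freqMoment μ 1 a = moment μ a fun w => w := by
  ext t
  simp [freqMoment, moment]

lemma freqMoment_const_mul (μ : ℝ → ProbabilityMeasure Phase) (k : ℕ) (c : ℝ) (a : Torus → ℝ)
    (t : ℝ) : freqMoment μ k (fun θ => c * a θ) t = c * freqMoment μ k a t := by
  simp only [freqMoment, moment, mul_assoc, integral_const_mul]

lemma freqMoment_neg (μ : ℝ → ProbabilityMeasure Phase) (k : ℕ) (a : Torus → ℝ) (t : ℝ) :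
    freqMoment μ k (fun θ => -a θ) t = -freqMoment μ k a t := by
  simp [freqMoment, moment, integral_neg]

lemma hasDerivWithinAt_freqMoment_zero (hμ : IsMeasureValuedSolution m γ κ μ) (hm : 0 < m)
    (hγ : 0 < γ) (hκ : 0 < κ) (ha : TorusSmooth a) {t : ℝ} (ht : 0 ≤ t) :
    HasDerivWithinAt (freqMoment μ 0 a) (freqMoment μ 1 (torusDeriv a) t) (Ici 0) t := by
  rw [freqMoment_zero, freqMoment_one]
  simpa [moment] using hasDerivWithinAt_moment hμ hm hγ hκ (admissible_one ha) ht

lemma hasDerivWithinAt_freqMoment_one (hμ : IsMeasureValuedSolution m γ κ μ) (hm : 0 < m)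
    (hγ : 0 < γ) (hκ : 0 < κ) (ha : TorusSmooth a) {t : ℝ} (ht : 0 ≤ t) :
    HasDerivWithinAt (freqMoment μ 1 a)
      (freqMoment μ 2 (torusDeriv a) t - γ / m * freqMoment μ 1 a t +
        κ / m * (sinMean μ t * freqMoment μ 0 (fun θ => torusCos θ * a θ) t -
          cosMean μ t * freqMoment μ 0 (fun θ => torusSin θ * a θ) t)) (Ici 0) t := by
  rw [sinMean, cosMean, freqMoment_one, freqMoment_zero, freqMoment_zero, freqMoment_zero,
    freqMoment_zero]
  simpa [freqMoment, sq] using hasDerivWithinAt_moment hμ hm hγ hκ (admissible_id ha) ht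

lemma hasDerivWithinAt_kinetic (hμ : IsMeasureValuedSolution m γ κ μ) (hm : 0 < m)
    (hγ : 0 < γ) (hκ : 0 < κ) {t : ℝ} (ht : 0 ≤ t) :
    HasDerivWithinAt (kinetic μ) (-(2 * γ / m) * kinetic μ t - 2 * κ / m * drift μ t)
      (Ici 0) t := by
  have hderiv := hasDerivWithinAt_moment hμ hm hγ hκ admissible_sq ht
  have hsq : deriv (fun w : ℝ => w ^ 2) = fun w => 2 * w := by
    ext w
    simp
  have htwice (c : Torus → ℝ) : moment μ c (fun w => 2 * w) t = 2 * freqMoment μ 1 c t := by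
    simp only [freqMoment, moment, ← integral_const_mul]
    ring_nf
  have hkinetic : moment μ (fun _ => 1) (fun w => w * (2 * w)) t = 2 * kinetic μ t := by
    simp only [moment, kinetic, ← integral_const_mul]
    ring_nf
  have hzero : moment μ (fun _ => 0) (fun w => w * w ^ 2) t = 0 := by simp [moment]
  simp only [moment_one_sq, torusDeriv_const, mul_one, hsq, hzero, hkinetic, htwice,
    ← freqMoment_zero] at hderiv
  refine hderiv.congr_deriv ?_
  rw [drift_eq hμ, cosMean, sinMean]
  ring

lemma hasDerivWithinAt_cosMean (hμ : IsMeasureValuedSolution m γ κ μ) (hm : 0 < m)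
    (hγ : 0 < γ) (hκ : 0 < κ) {t : ℝ} (ht : 0 ≤ t) :
    HasDerivWithinAt (cosMean μ) (-freqMoment μ 1 torusSin t) (Ici 0) t := by
  rw [← freqMoment_neg, ← torusDeriv_torusCos]
  exact hasDerivWithinAt_freqMoment_zero hμ hm hγ hκ .torusCos ht

lemma hasDerivWithinAt_sinMean (hμ : IsMeasureValuedSolution m γ κ μ) (hm : 0 < m)
    (hγ : 0 < γ) (hκ : 0 < κ) {t : ℝ} (ht : 0 ≤ t) :
    HasDerivWithinAt (sinMean μ) (freqMoment μ 1 torusCos t) (Ici 0) t := by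
  rw [← torusDeriv_torusSin]
  exact hasDerivWithinAt_freqMoment_zero hμ hm hγ hκ .torusSin ht

lemma hasDerivWithinAt_orderSq (hμ : IsMeasureValuedSolution m γ κ μ) (hm : 0 < m)
    (hγ : 0 < γ) (hκ : 0 < κ) {t : ℝ} (ht : 0 ≤ t) :
    HasDerivWithinAt (orderSq μ) (-2 * drift μ t) (Ici 0) t := by
  refine (((hasDerivWithinAt_cosMean hμ hm hγ hκ ht).pow 2).add
    ((hasDerivWithinAt_sinMean hμ hm hγ hκ ht).pow 2)).congr_deriv ?_
  rw [drift_eq hμ]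
  ring

lemma hasDerivWithinAt_energy (hμ : IsMeasureValuedSolution m γ κ μ) (hm : 0 < m)
    (hγ : 0 < γ) (hκ : 0 < κ) {t : ℝ} (ht : 0 ≤ t) :
    HasDerivWithinAt (energy m κ μ) (-(γ / m) * kinetic μ t) (Ici 0) t := by
  refine (((hasDerivWithinAt_kinetic hμ hm hγ hκ ht).div_const 2).sub
    ((hasDerivWithinAt_orderSq hμ hm hγ hκ ht).const_mul (κ / (2 * m)))).congr_deriv ?_
  field_simp
  ring

lemma hasDerivWithinAt_drift (hμ : IsMeasureValuedSolution m γ κ μ) (hm : 0 < m)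
    (hγ : 0 < γ) (hκ : 0 < κ) {t : ℝ} (ht : 0 ≤ t) :
    HasDerivWithinAt (drift μ)
      (freqMoment μ 2 (tangent μ t) t - freqMoment μ 1 torusSin t ^ 2 -
        freqMoment μ 1 torusCos t ^ 2 - γ / m * drift μ t - κ / m * spread μ t) (Ici 0) t := by
  have hX := hasDerivWithinAt_freqMoment_one hμ hm hγ hκ .torusSin ht
  have hY := hasDerivWithinAt_freqMoment_one hμ hm hγ hκ .torusCos ht
  have htangent : freqMoment μ 2 (tangent μ t) t =
      cosMean μ t * freqMoment μ 2 torusCos t + sinMean μ t * freqMoment μ 2 torusSin t :=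
    freqMoment_add_mul hμ .torusCos .torusSin le_rfl _ _ t
  rw [funext (drift_eq hμ)]
  refine (((hasDerivWithinAt_cosMean hμ hm hγ hκ ht).mul hX).add
    ((hasDerivWithinAt_sinMean hμ hm hγ hκ ht).neg.mul hY)).congr_deriv ?_
  rw [htangent, spread_eq hμ, torusDeriv_torusSin, torusDeriv_torusCos, freqMoment_neg]
  simp only [mul_comm (torusCos _) (torusSin _), Pi.neg_apply]
  ring

lemma freqMoment_normal_mul_torusSin (hμ : IsMeasureValuedSolution m γ κ μ) (t : ℝ) :
    freqMoment μ 0 (fun θ => normal μ t θ * torusSin θ) t =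
      cosMean μ t * freqMoment μ 0 (fun θ => torusSin θ * torusSin θ) t +
        -sinMean μ t * freqMoment μ 0 (fun θ => torusSin θ * torusCos θ) t := by
  rw [← freqMoment_add_mul hμ (TorusSmooth.torusSin.mul .torusSin)
    (TorusSmooth.torusSin.mul .torusCos) (Nat.zero_le 2)]
  congr 1
  ext θ
  rw [normal]
  ring

lemma freqMoment_normal_mul_torusCos (hμ : IsMeasureValuedSolution m γ κ μ) (t : ℝ) :
    freqMoment μ 0 (fun θ => normal μ t θ * torusCos θ) t =
      cosMean μ t * freqMoment μ 0 (fun θ => torusSin θ * torusCos θ) t +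
        -sinMean μ t * freqMoment μ 0 (fun θ => torusCos θ * torusCos θ) t := by
  rw [← freqMoment_add_mul hμ (TorusSmooth.torusSin.mul .torusCos)
    (TorusSmooth.torusCos.mul .torusCos) (Nat.zero_le 2)]
  congr 1
  ext θ
  rw [normal]
  ring

lemma freqMoment_normal_mul_tangent (hμ : IsMeasureValuedSolution m γ κ μ) {k : ℕ} (hk : k ≤ 2)
    (t : ℝ) : freqMoment μ k (fun θ => normal μ t θ * tangent μ t θ) t =
      (cosMean μ t ^ 2 - sinMean μ t ^ 2) *
          freqMoment μ k (fun θ => torusSin θ * torusCos θ) t +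
        cosMean μ t * sinMean μ t * freqMoment μ k (fun θ => torusSin θ * torusSin θ) t +
        -(cosMean μ t * sinMean μ t) * freqMoment μ k (fun θ => torusCos θ * torusCos θ) t := by
  rw [← freqMoment_add_mul₃ hμ (TorusSmooth.torusSin.mul .torusCos)
    (TorusSmooth.torusSin.mul .torusSin) (TorusSmooth.torusCos.mul .torusCos) hk]
  congr 1
  ext θ
  rw [normal, tangent]
  ring

/-- The products with `normal` are kept together, since only they are controlled by `spread`. -/
lemma hasDerivWithinAt_spread (hμ : IsMeasureValuedSolution m γ κ μ) (hm : 0 < m)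
    (hγ : 0 < γ) (hκ : 0 < κ) {t : ℝ} (ht : 0 ≤ t) :
    HasDerivWithinAt (spread μ)
      (2 * freqMoment μ 1 (fun θ => normal μ t θ * tangent μ t θ) t -
        2 * freqMoment μ 1 torusSin t * freqMoment μ 0 (fun θ => normal μ t θ * torusSin θ) t -
        2 * freqMoment μ 1 torusCos t * freqMoment μ 0 (fun θ => normal μ t θ * torusCos θ) t)
      (Ici 0) t := by
  have hss := TorusSmooth.torusSin.mul .torusSin
  have hsc := TorusSmooth.torusSin.mul .torusCos
  have hcc := TorusSmooth.torusCos.mul .torusCos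
  have hmoment {a : Torus → ℝ} (ha : TorusSmooth a) :=
    hasDerivWithinAt_freqMoment_zero hμ hm hγ hκ ha ht
  have hC := hasDerivWithinAt_cosMean hμ hm hγ hκ ht
  have hS := hasDerivWithinAt_sinMean hμ hm hγ hκ ht
  rw [funext (spread_eq hμ)]
  refine ((((hC.pow 2).mul (hmoment hss)).add
    (((hC.const_mul 2).mul hS).neg.mul (hmoment hsc))).add
    ((hS.pow 2).mul (hmoment hcc))).congr_deriv ?_
  rw [freqMoment_normal_mul_tangent hμ one_le_two, freqMoment_normal_mul_torusSin hμ,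
    freqMoment_normal_mul_torusCos hμ, torusDeriv_torusSin_mul_torusSin,
    torusDeriv_torusSin_mul_torusCos, torusDeriv_torusCos_mul_torusCos, freqMoment_const_mul,
    freqMoment_const_mul, freqMoment_add_mul hμ hcc hss one_le_two]
  simp only [Pi.mul_apply, Pi.pow_apply, Pi.neg_apply]
  ring

lemma abs_freqMoment_le (hμ : IsMeasureValuedSolution m γ κ μ) (ha : TorusSmooth a)
    {b : Torus → ℝ} (hb : TorusSmooth b) {k : ℕ} (hk : k ≤ 2) {t c β : ℝ}
    (h : ∀ θ w, |a θ * w ^ k| ≤ c + b θ + β * w ^ 2) :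
    |freqMoment μ k a t| ≤ c + freqMoment μ 0 b t + β * kinetic μ t := by
  refine abs_le'.2 ⟨freqMoment_le hμ ha hb hk fun θ w => (le_abs_self _).trans (h θ w), ?_⟩
  rw [← neg_one_mul, ← freqMoment_const_mul]
  refine freqMoment_le hμ ((TorusSmooth.const (-1)).mul ha) hb hk fun θ w => ?_
  rw [mul_assoc, neg_one_mul]
  exact (neg_le_abs _).trans (h θ w)

lemma abs_freqMoment_one_normal_mul_le (hμ : IsMeasureValuedSolution m γ κ μ)
    (ha : TorusSmooth a) (hle : ∀ θ, a θ ^ 2 ≤ 1) {ε : ℝ} (hε : 0 < ε) (t : ℝ) :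
    |freqMoment μ 1 (fun θ => normal μ t θ * a θ) t| ≤
      ε / 2 * spread μ t + 1 / (2 * ε) * kinetic μ t := by
  have hbound := abs_freqMoment_le hμ ((torusSmooth_normal μ t).mul ha)
    ((TorusSmooth.const (ε / 2)).mul (torusSmooth_normal_sq μ t)) one_le_two (t := t) (c := 0)
    (β := 1 / (2 * ε)) fun θ w => ?_
  · rwa [freqMoment_const_mul, zero_add] at hbound
  · have hsq : (a θ * w) ^ 2 ≤ w ^ 2 := by
      rw [mul_pow]
      exact mul_le_of_le_one_left (sq_nonneg w) (hle θ)
    have hyoung : 2 * |normal μ t θ * (a θ * w)| ≤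
        ε * normal μ t θ ^ 2 + 1 / ε * (a θ * w) ^ 2 := by
      have hsquare : 0 ≤ 1 / ε * (ε * |normal μ t θ| - |a θ * w|) ^ 2 := by positivity
      rw [abs_mul, ← sq_abs (normal μ t θ), ← sq_abs (a θ * w)]
      refine sub_nonneg.1 (hsquare.trans_eq ?_)
      field_simp
      ring
    have hmono : 1 / ε * (a θ * w) ^ 2 ≤ 1 / ε * w ^ 2 := by gcongr
    rw [pow_one, mul_assoc]
    calc |normal μ t θ * (a θ * w)|
        ≤ (ε * normal μ t θ ^ 2 + 1 / ε * w ^ 2) / 2 := by linarith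
      _ = 0 + ε / 2 * normal μ t θ ^ 2 + 1 / (2 * ε) * w ^ 2 := by
          field_simp
          ring

lemma freqMoment_normal_mul_sq_le (hμ : IsMeasureValuedSolution m γ κ μ) (ha : TorusSmooth a)
    (hle : ∀ θ, a θ ^ 2 ≤ 1) (t : ℝ) :
    freqMoment μ 0 (fun θ => normal μ t θ * a θ) t ^ 2 ≤ spread μ t := by
  set I := freqMoment μ 0 (fun θ => normal μ t θ * a θ) t with hI
  have hyoung := freqMoment_le hμ ((TorusSmooth.const I).mul ((torusSmooth_normal μ t).mul ha))
    ((TorusSmooth.const (1 / 2)).mul (torusSmooth_normal_sq μ t)) (Nat.zero_le 2) (t := t)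
    (c := I ^ 2 / 2) (β := 0) fun θ w => by
      nlinarith [sq_nonneg (I * a θ - normal μ t θ), mul_nonneg (sq_nonneg I)
        (sub_nonneg.2 (hle θ))]
  rw [freqMoment_const_mul, freqMoment_const_mul, ← hI, ← spread] at hyoung
  linarith

lemma freqMoment_one_sq_le (hμ : IsMeasureValuedSolution m γ κ μ) (ha : TorusSmooth a)
    (hle : ∀ θ, a θ ^ 2 ≤ 1) (t : ℝ) : freqMoment μ 1 a t ^ 2 ≤ kinetic μ t := by
  set I := freqMoment μ 1 a t with hI
  have hyoung := freqMoment_le hμ ((TorusSmooth.const I).mul ha) (.const 0) one_le_two (t := t)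
    (c := I ^ 2 / 2) (β := 1 / 2) fun θ w => by
      nlinarith [sq_nonneg (I * a θ - w), mul_nonneg (sq_nonneg I) (sub_nonneg.2 (hle θ))]
  rw [freqMoment_const_mul, ← hI, freqMoment_zero_fun] at hyoung
  linarith

lemma abs_drift_le (hμ : IsMeasureValuedSolution m γ κ μ) {ε : ℝ} (hε : 0 < ε) (t : ℝ) :
    |drift μ t| ≤ ε / 2 * spread μ t + 1 / (2 * ε) * kinetic μ t := by
  simpa only [drift, mul_one] using
    abs_freqMoment_one_normal_mul_le hμ (.const 1) (fun _ => (one_pow 2).le) hε t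

lemma freqMoment_two_tangent_le (hμ : IsMeasureValuedSolution m γ κ μ) (t : ℝ) :
    freqMoment μ 2 (tangent μ t) t ≤ kinetic μ t := by
  have hle := freqMoment_le hμ (torusSmooth_tangent μ t) (.const 0) le_rfl (t := t) (c := 0)
    (β := 1) fun θ w => by
      nlinarith [sq_nonneg w, abs_le.1 (abs_le_one_iff_mul_self_le_one.2
        ((sq (tangent μ t θ)).symm.trans_le (tangent_sq_le_one hμ t θ)))]
  rw [freqMoment_zero_fun] at hle
  linarith

lemma torusSin_sq_le_one (θ : Torus) : torusSin θ ^ 2 ≤ 1 :=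
  (sq_le_one_iff_abs_le_one _).2 (abs_torusSin_le_one θ)

lemma torusCos_sq_le_one (θ : Torus) : torusCos θ ^ 2 ≤ 1 := by
  linarith [torusSin_sq_add_torusCos_sq θ, sq_nonneg (torusSin θ)]

lemma abs_deriv_spread_le (hμ : IsMeasureValuedSolution m γ κ μ) (t : ℝ) :
    |2 * freqMoment μ 1 (fun θ => normal μ t θ * tangent μ t θ) t -
        2 * freqMoment μ 1 torusSin t * freqMoment μ 0 (fun θ => normal μ t θ * torusSin θ) t -
        2 * freqMoment μ 1 torusCos t * freqMoment μ 0 (fun θ => normal μ t θ * torusCos θ) t| ≤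
      3 * (spread μ t + kinetic μ t) := by
  have hNT := abs_le.1 <| abs_freqMoment_one_normal_mul_le hμ (torusSmooth_tangent μ t)
    (tangent_sq_le_one hμ t) one_pos t
  have hX := freqMoment_one_sq_le hμ .torusSin torusSin_sq_le_one t
  have hY := freqMoment_one_sq_le hμ .torusCos torusCos_sq_le_one t
  have hP := freqMoment_normal_mul_sq_le hμ .torusSin torusSin_sq_le_one t
  have hQ := freqMoment_normal_mul_sq_le hμ .torusCos torusCos_sq_le_one t
  have hyoung (x y : ℝ) : -(x ^ 2 + y ^ 2) ≤ 2 * x * y ∧ 2 * x * y ≤ x ^ 2 + y ^ 2 :=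
    ⟨by linarith [sq_nonneg (x + y)], two_mul_le_add_sq x y⟩
  obtain ⟨hX₁, hX₂⟩ := hyoung (freqMoment μ 1 torusSin t)
    (freqMoment μ 0 (fun θ => normal μ t θ * torusSin θ) t)
  obtain ⟨hY₁, hY₂⟩ := hyoung (freqMoment μ 1 torusCos t)
    (freqMoment μ 0 (fun θ => normal μ t θ * torusCos θ) t)
  rw [abs_le]
  constructor <;> linarith

lemma deriv_drift_le (hμ : IsMeasureValuedSolution m γ κ μ) (hm : 0 < m) (hγ : 0 < γ)
    (hκ : 0 < κ) (t : ℝ) :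
    freqMoment μ 2 (tangent μ t) t - freqMoment μ 1 torusSin t ^ 2 -
        freqMoment μ 1 torusCos t ^ 2 - γ / m * drift μ t - κ / m * spread μ t ≤
      (1 + γ ^ 2 / (2 * κ * m)) * kinetic μ t - κ / (2 * m) * spread μ t := by
  have hdrift : -(γ / m * drift μ t) ≤
      κ / (2 * m) * spread μ t + γ ^ 2 / (2 * κ * m) * kinetic μ t := by
    calc -(γ / m * drift μ t) = γ / m * -drift μ t := by ring
      _ ≤ γ / m * (κ / γ / 2 * spread μ t + 1 / (2 * (κ / γ)) * kinetic μ t) := by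
          gcongr
          exact (neg_le_abs _).trans (abs_drift_le hμ (div_pos hκ hγ) t)
      _ = κ / (2 * m) * spread μ t + γ ^ 2 / (2 * κ * m) * kinetic μ t := by
          field_simp
  have hhalf : κ / m * spread μ t = 2 * (κ / (2 * m) * spread μ t) := by
    field_simp
  linarith [freqMoment_two_tangent_le hμ t, sq_nonneg (freqMoment μ 1 torusSin t),
    sq_nonneg (freqMoment μ 1 torusCos t)]

lemma antitoneOn_energy (hμ : IsMeasureValuedSolution m γ κ μ) (hm : 0 < m) (hγ : 0 < γ)
    (hκ : 0 < κ) : AntitoneOn (energy m κ μ) (Ici 0) := by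
  refine antitoneOn_of_deriv_nonpos (fun t ht => hasDerivWithinAt_energy hμ hm hγ hκ ht)
    fun t _ => ?_
  rw [neg_mul]
  have hk := kinetic_nonneg μ t
  exact neg_nonpos.2 (by positivity)

lemma neg_le_energy (hμ : IsMeasureValuedSolution m γ κ μ) (hm : 0 < m) (hκ : 0 < κ) (t : ℝ) :
    -(κ / (2 * m)) ≤ energy m κ μ t := by
  have hpotential : κ / (2 * m) * orderSq μ t ≤ κ / (2 * m) :=
    mul_le_of_le_one_right (by positivity) (orderSq_le_one hμ t)
  rw [energy]
  linarith [kinetic_nonneg μ t]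

lemma kinetic_le_orderSq (hμ : IsMeasureValuedSolution m γ κ μ) (hm : 0 < m) (hγ : 0 < γ)
    (hκ : 0 < κ) (h0 : energy m κ μ 0 ≤ 0) {t : ℝ} (ht : 0 ≤ t) :
    kinetic μ t ≤ κ / m * orderSq μ t := by
  have henergy := (antitoneOn_energy hμ hm hγ hκ self_mem_Ici ht ht).trans h0
  have hhalf : κ / m * orderSq μ t = 2 * (κ / (2 * m) * orderSq μ t) := by
    field_simp
  rw [energy] at henergy
  linarith

lemma abs_drift_le_orderSq (hμ : IsMeasureValuedSolution m γ κ μ) (hm : 0 < m) (hγ : 0 < γ)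
    (hκ : 0 < κ) (h0 : energy m κ μ 0 ≤ 0) {t : ℝ} (ht : 0 ≤ t) :
    |drift μ t| ≤ (1 + κ / m) / 2 * orderSq μ t := by
  linarith [abs_drift_le hμ one_pos t, spread_le_orderSq hμ t,
    kinetic_le_orderSq hμ hm hγ hκ h0 ht]

lemma continuous_cosMean (hμ : IsMeasureValuedSolution m γ κ μ) (hm : 0 < m) (hγ : 0 < γ)
    (hκ : 0 < κ) : Continuous (cosMean μ) :=
  continuous_freqMoment hμ hm hγ hκ .torusCos (Nat.zero_le 2)

lemma continuous_sinMean (hμ : IsMeasureValuedSolution m γ κ μ) (hm : 0 < m) (hγ : 0 < γ)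
    (hκ : 0 < κ) : Continuous (sinMean μ) :=
  continuous_freqMoment hμ hm hγ hκ .torusSin (Nat.zero_le 2)

lemma continuous_spread (hμ : IsMeasureValuedSolution m γ κ μ) (hm : 0 < m) (hγ : 0 < γ)
    (hκ : 0 < κ) : Continuous (spread μ) := by
  have hC := continuous_cosMean hμ hm hγ hκ
  have hS := continuous_sinMean hμ hm hγ hκ
  have hmoment {a : Torus → ℝ} (ha : TorusSmooth a) : Continuous (freqMoment μ 0 a) :=
    continuous_freqMoment hμ hm hγ hκ ha (Nat.zero_le 2)
  rw [funext (spread_eq hμ)]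
  exact (((hC.pow 2).mul (hmoment (TorusSmooth.torusSin.mul .torusSin))).add
    (((hC.const_mul 2).mul hS).neg.mul (hmoment (TorusSmooth.torusSin.mul .torusCos)))).add
    ((hS.pow 2).mul (hmoment (TorusSmooth.torusCos.mul .torusCos)))

/-- A multiple of the energy compensates the kinetic energy produced by `drift`. -/
lemma integrableOn_kinetic_add_spread (hμ : IsMeasureValuedSolution m γ κ μ) (hm : 0 < m)
    (hγ : 0 < γ) (hκ : 0 < κ) (h0 : energy m κ μ 0 ≤ 0) :
    IntegrableOn (fun t => kinetic μ t + κ / (2 * m) * spread μ t) (Ioi 0) := by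
  set A := 1 + γ ^ 2 / (2 * κ * m)
  have hA0 : 0 ≤ (A + 1) * (m / γ) := by positivity
  refine integrableOn_Ioi_of_deriv_le_neg
    (f := fun t => drift μ t + (A + 1) * (m / γ) * energy m κ μ t)
    (B := -((1 + κ / m) / 2) - (A + 1) * (m / γ) * (κ / (2 * m)))
    (fun t ht => (hasDerivWithinAt_drift hμ hm hγ hκ ht).add
      ((hasDerivWithinAt_energy hμ hm hγ hκ ht).const_mul ((A + 1) * (m / γ)))) ?_ ?_ ?_ ?_
  · exact (continuous_kinetic hμ hm hγ hκ).add ((continuous_spread hμ hm hγ hκ).const_mul _)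
  · intro t _
    have hk := kinetic_nonneg μ t
    have hs := spread_nonneg μ t
    positivity
  · intro t _
    have hdrift := deriv_drift_le hμ hm hγ hκ t
    have henergy : (A + 1) * (m / γ) * (-(γ / m) * kinetic μ t) = -(A + 1) * kinetic μ t := by
      field_simp
    linarith
  · intro t ht
    have hdrift := (abs_drift_le_orderSq hμ hm hγ hκ h0 ht).trans
      (mul_le_of_le_one_right (by positivity) (orderSq_le_one hμ t))
    have henergy := mul_le_mul_of_nonneg_left (neg_le_energy hμ hm hκ t) hA0
    linarith [neg_abs_le (drift μ t)]

lemma integrableOn_kinetic (hμ : IsMeasureValuedSolution m γ κ μ) (hm : 0 < m) (hγ : 0 < γ)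
    (hκ : 0 < κ) (h0 : energy m κ μ 0 ≤ 0) : IntegrableOn (kinetic μ) (Ioi 0) := by
  refine (integrableOn_kinetic_add_spread hμ hm hγ hκ h0).mono'
    (continuous_kinetic hμ hm hγ hκ).aestronglyMeasurable (ae_of_all _ fun t => ?_)
  have hs := spread_nonneg μ t
  rw [Real.norm_of_nonneg (kinetic_nonneg μ t)]
  exact le_add_of_nonneg_right (by positivity)

lemma integrableOn_spread (hμ : IsMeasureValuedSolution m γ κ μ) (hm : 0 < m) (hγ : 0 < γ)
    (hκ : 0 < κ) (h0 : energy m κ μ 0 ≤ 0) : IntegrableOn (spread μ) (Ioi 0) := by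
  have hdiff := ((integrableOn_kinetic_add_spread hμ hm hγ hκ h0).sub
    (integrableOn_kinetic hμ hm hγ hκ h0)).const_mul (2 * m / κ)
  refine hdiff.congr (ae_of_all _ fun t => ?_)
  simp only [Pi.sub_apply]
  field_simp
  ring

lemma tendsto_kinetic (hμ : IsMeasureValuedSolution m γ κ μ) (hm : 0 < m) (hγ : 0 < γ)
    (hκ : 0 < κ) (h0 : energy m κ μ 0 ≤ 0) : Tendsto (kinetic μ) atTop (𝓝 0) := by
  have hint := integrableOn_kinetic hμ hm hγ hκ h0
  refine tendsto_zero_of_abs_deriv_le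
    (g := fun t => (2 * γ / m + κ / m) * kinetic μ t + κ / m * spread μ t)
    (fun t ht => hasDerivWithinAt_kinetic hμ hm hγ hκ ht) (fun t _ => ?_)
    ((hint.const_mul _).add ((integrableOn_spread hμ hm hγ hκ h0).const_mul _)) hint
  have hdrift := mul_le_mul_of_nonneg_left (abs_drift_le hμ one_pos t)
    (by positivity : 0 ≤ 2 * κ / m)
  calc |-(2 * γ / m) * kinetic μ t - 2 * κ / m * drift μ t|
      ≤ |-(2 * γ / m) * kinetic μ t| + |2 * κ / m * drift μ t| := abs_sub _ _
    _ = 2 * γ / m * kinetic μ t + 2 * κ / m * |drift μ t| := by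
        rw [neg_mul, abs_neg, abs_of_nonneg (mul_nonneg (by positivity) (kinetic_nonneg μ t)),
          abs_mul, abs_of_nonneg (by positivity : 0 ≤ 2 * κ / m)]
    _ ≤ 2 * γ / m * kinetic μ t +
          2 * κ / m * (1 / 2 * spread μ t + 1 / (2 * 1) * kinetic μ t) := by linarith
    _ = (2 * γ / m + κ / m) * kinetic μ t + κ / m * spread μ t := by ring

lemma tendsto_spread (hμ : IsMeasureValuedSolution m γ κ μ) (hm : 0 < m) (hγ : 0 < γ)
    (hκ : 0 < κ) (h0 : energy m κ μ 0 ≤ 0) : Tendsto (spread μ) atTop (𝓝 0) :=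
  have hint := integrableOn_spread hμ hm hγ hκ h0
  tendsto_zero_of_abs_deriv_le (fun _ ht => hasDerivWithinAt_spread hμ hm hγ hκ ht)
    (fun t _ => abs_deriv_spread_le hμ t)
    ((hint.add (integrableOn_kinetic hμ hm hγ hκ h0)).const_mul 3) hint

lemma exists_tendsto_orderSq (hμ : IsMeasureValuedSolution m γ κ μ) (hm : 0 < m) (hγ : 0 < γ)
    (hκ : 0 < κ) (h0 : energy m κ μ 0 ≤ 0) : ∃ l, Tendsto (orderSq μ) atTop (𝓝 l) := by
  refine exists_tendsto_of_abs_deriv_le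
    (fun _ ht => hasDerivWithinAt_orderSq hμ hm hγ hκ ht) (fun t _ => ?_)
    ((integrableOn_spread hμ hm hγ hκ h0).add (integrableOn_kinetic hμ hm hγ hκ h0))
  rw [abs_mul, abs_neg, abs_two]
  change _ ≤ spread μ t + kinetic μ t
  linarith [abs_drift_le hμ one_pos t]

lemma neg_energy_le_orderSq (hm : 0 < m) (hκ : 0 < κ) (t : ℝ) :
    -(2 * m / κ) * energy m κ μ t ≤ orderSq μ t := by
  have hk : 0 ≤ m / κ * kinetic μ t := mul_nonneg (by positivity) (kinetic_nonneg μ t)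
  calc -(2 * m / κ) * energy m κ μ t = orderSq μ t - m / κ * kinetic μ t := by
        rw [energy]
        field_simp
        ring
    _ ≤ orderSq μ t := sub_le_self _ hk

lemma energy_neg (hμ : IsMeasureValuedSolution m γ κ μ) (hm : 0 < m) (hγ : 0 < γ) (hκ : 0 < κ)
    (h0 : energy m κ μ 0 ≤ 0) (hR : 0 < orderSq μ 0) {t : ℝ} (ht : 0 < t) :
    energy m κ μ t < 0 := by
  have hanti := antitoneOn_energy hμ hm hγ hκ
  by_contra! hcon
  have hzero : ∀ s ∈ Icc 0 t, energy m κ μ s = 0 := fun s hs =>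
    le_antisymm ((hanti self_mem_Ici hs.1 hs.1).trans h0) (hcon.trans (hanti hs.1 ht.le hs.2))
  have hmem : (0 : ℝ) ∈ Icc 0 t := left_mem_Icc.2 ht.le
  have hderiv : -(γ / m) * kinetic μ 0 = 0 :=
    (uniqueDiffOn_Icc ht 0 hmem).eq_deriv _
      ((hasDerivWithinAt_energy hμ hm hγ hκ le_rfl).mono Icc_subset_Ici_self)
      ((hasDerivWithinAt_const _ _ (0 : ℝ)).congr hzero (hzero 0 hmem))
  have hkinetic : kinetic μ 0 = 0 := by
    simpa [hm.ne', hγ.ne'] using hderiv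
  have henergy := hzero 0 hmem
  rw [energy, hkinetic, zero_div, zero_sub, neg_eq_zero] at henergy
  exact (by positivity : κ / (2 * m) * orderSq μ 0 ≠ 0) henergy

lemma orderSq_pos (hμ : IsMeasureValuedSolution m γ κ μ) (hm : 0 < m) (hγ : 0 < γ) (hκ : 0 < κ)
    (h0 : energy m κ μ 0 ≤ 0) (hR : 0 < orderSq μ 0) {t : ℝ} (ht : 0 ≤ t) : 0 < orderSq μ t := by
  rcases ht.eq_or_lt with rfl | ht
  · exact hR
  · refine lt_of_lt_of_le ?_ (neg_energy_le_orderSq (κ := κ) hm hκ t)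
    exact mul_pos_of_neg_of_neg (neg_lt_zero.2 (by positivity)) (energy_neg hμ hm hγ hκ h0 hR ht)

lemma continuous_orderSq (hμ : IsMeasureValuedSolution m γ κ μ) (hm : 0 < m) (hγ : 0 < γ)
    (hκ : 0 < κ) : Continuous (orderSq μ) :=
  ((continuous_cosMean hμ hm hγ hκ).pow 2).add ((continuous_sinMean hμ hm hγ hκ).pow 2)

lemma exists_pos_le_orderSq (hμ : IsMeasureValuedSolution m γ κ μ) (hm : 0 < m) (hγ : 0 < γ)
    (hκ : 0 < κ) (h0 : energy m κ μ 0 ≤ 0) (hR : 0 < orderSq μ 0) :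
    ∃ r, 0 < r ∧ ∀ t, 0 ≤ t → r ≤ orderSq μ t := by
  obtain ⟨s, hs, hmin⟩ := isCompact_Icc.exists_isMinOn (nonempty_Icc.2 zero_le_one)
    (continuous_orderSq hμ hm hγ hκ).continuousOn
  have henergy : 0 < -(2 * m / κ) * energy m κ μ 1 :=
    mul_pos_of_neg_of_neg (neg_lt_zero.2 (by positivity)) (energy_neg hμ hm hγ hκ h0 hR one_pos)
  refine ⟨min (orderSq μ s) (-(2 * m / κ) * energy m κ μ 1),
    lt_min (orderSq_pos hμ hm hγ hκ h0 hR hs.1) henergy, fun t ht => ?_⟩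
  rcases le_total t 1 with h1 | h1
  · exact (min_le_left _ _).trans (hmin ⟨ht, h1⟩)
  · refine (min_le_right _ _).trans (le_trans ?_ (neg_energy_le_orderSq (κ := κ) hm hκ t))
    rw [neg_mul, neg_mul]
    gcongr
    exact antitoneOn_energy hμ hm hγ hκ (mem_Ici.2 zero_le_one) (mem_Ici.2 ht) h1

/-! ### Convergence of the Fourier modes -/

/-- The mean of `cos 2θ`. -/
def cosTwoMean (μ : ℝ → ProbabilityMeasure Phase) (t : ℝ) : ℝ :=
  freqMoment μ 0 (fun θ => torusCos θ * torusCos θ) t -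
    freqMoment μ 0 (fun θ => torusSin θ * torusSin θ) t

/-- The mean of `sin 2θ`. -/
def sinTwoMean (μ : ℝ → ProbabilityMeasure Phase) (t : ℝ) : ℝ :=
  2 * freqMoment μ 0 (fun θ => torusSin θ * torusCos θ) t

lemma hasDerivWithinAt_cosTwoMean (hμ : IsMeasureValuedSolution m γ κ μ) (hm : 0 < m)
    (hγ : 0 < γ) (hκ : 0 < κ) {t : ℝ} (ht : 0 ≤ t) :
    HasDerivWithinAt (cosTwoMean μ) (-4 * freqMoment μ 1 (fun θ => torusSin θ * torusCos θ) t)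
      (Ici 0) t := by
  refine ((hasDerivWithinAt_freqMoment_zero hμ hm hγ hκ (TorusSmooth.torusCos.mul .torusCos)
    ht).sub (hasDerivWithinAt_freqMoment_zero hμ hm hγ hκ (TorusSmooth.torusSin.mul .torusSin)
    ht)).congr_deriv ?_
  rw [torusDeriv_torusSin_mul_torusSin, torusDeriv_torusCos_mul_torusCos, freqMoment_const_mul,
    freqMoment_const_mul]
  ring

lemma hasDerivWithinAt_sinTwoMean (hμ : IsMeasureValuedSolution m γ κ μ) (hm : 0 < m)
    (hγ : 0 < γ) (hκ : 0 < κ) {t : ℝ} (ht : 0 ≤ t) :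
    HasDerivWithinAt (sinTwoMean μ)
      (2 * (freqMoment μ 1 (fun θ => torusCos θ * torusCos θ) t -
        freqMoment μ 1 (fun θ => torusSin θ * torusSin θ) t)) (Ici 0) t := by
  refine ((hasDerivWithinAt_freqMoment_zero hμ hm hγ hκ (TorusSmooth.torusSin.mul .torusCos)
    ht).const_mul 2).congr_deriv ?_
  rw [torusDeriv_torusSin_mul_torusCos, freqMoment_add_mul hμ
    (TorusSmooth.torusCos.mul .torusCos) (TorusSmooth.torusSin.mul .torusSin) one_le_two]
  ring

/-- The mean frequency `∫ ω dμ_t`. -/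
def meanFreq (μ : ℝ → ProbabilityMeasure Phase) (t : ℝ) : ℝ := freqMoment μ 1 (fun _ => 1) t

lemma hasDerivWithinAt_meanFreq (hμ : IsMeasureValuedSolution m γ κ μ) (hm : 0 < m)
    (hγ : 0 < γ) (hκ : 0 < κ) {t : ℝ} (ht : 0 ≤ t) :
    HasDerivWithinAt (meanFreq μ) (-(γ / m) * meanFreq μ t) (Ici 0) t := by
  refine (hasDerivWithinAt_freqMoment_one hμ hm hγ hκ (.const 1) ht).congr_deriv ?_
  simp only [torusDeriv_const, freqMoment_zero_fun, mul_one, cosMean, sinMean, meanFreq]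
  ring

lemma meanFreq_eq (hμ : IsMeasureValuedSolution m γ κ μ) (hm : 0 < m) (hγ : 0 < γ) (hκ : 0 < κ)
    {t : ℝ} (ht : 0 ≤ t) : meanFreq μ t = meanFreq μ 0 * Real.exp (-(γ / m) * t) := by
  have hderiv (s : ℝ) (hs : 0 ≤ s) :
      HasDerivWithinAt (fun s => meanFreq μ s * Real.exp (γ / m * s)) 0 (Ici 0) s := by
    have hexp : HasDerivAt (fun s => Real.exp (γ / m * s)) (Real.exp (γ / m * s) * (γ / m)) s := by
      simpa using ((hasDerivAt_id s).const_mul (γ / m)).exp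
    refine ((hasDerivWithinAt_meanFreq hμ hm hγ hκ hs).mul
      hexp.hasDerivWithinAt).congr_deriv ?_
    ring
  have hconst := constant_of_has_deriv_right_zero
    (fun s hs => (hderiv s hs.1).continuousWithinAt.mono Icc_subset_Ici_self)
    (fun s hs => (hderiv s hs.1).mono (Ici_subset_Ici.2 hs.1)) t (right_mem_Icc.2 ht)
  rw [mul_zero, Real.exp_zero, mul_one] at hconst
  rw [← hconst, mul_assoc, ← Real.exp_add]
  simp

lemma integrableOn_meanFreq (hμ : IsMeasureValuedSolution m γ κ μ) (hm : 0 < m) (hγ : 0 < γ)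
    (hκ : 0 < κ) : IntegrableOn (meanFreq μ) (Ioi 0) :=
  IntegrableOn.congr_fun ((exp_neg_integrableOn_Ioi 0 (div_pos hγ hm)).const_mul (meanFreq μ 0))
    (fun _ ht => (meanFreq_eq hμ hm hγ hκ (le_of_lt ht)).symm) measurableSet_Ioi

/-- Second harmonics are transported by the mean frequency, up to terms controlled by `normal`. -/
lemma orderSq_sq_mul_abs_freqMoment_one_le (hμ : IsMeasureValuedSolution m γ κ μ)
    {t u v w : ℝ} (hu : |u| ≤ 1 / 2) (hv : |v| ≤ 1) (hw : |w| ≤ 1)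
    (h : ∀ θ, orderSq μ t ^ 2 * a θ =
      u * 1 + v * (normal μ t θ * normal μ t θ) + w * (normal μ t θ * tangent μ t θ)) :
    orderSq μ t ^ 2 * |freqMoment μ 1 a t| ≤
      1 / 2 * |meanFreq μ t| + (spread μ t + kinetic μ t) := by
  have hN := torusSmooth_normal μ t
  have hT := torusSmooth_tangent μ t
  have hNN := abs_freqMoment_one_normal_mul_le hμ hN (normal_sq_le_one hμ t) one_pos t
  have hNT := abs_freqMoment_one_normal_mul_le hμ hT (tangent_sq_le_one hμ t) one_pos t
  set A := freqMoment μ 1 (fun θ => normal μ t θ * normal μ t θ) t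
  set B := freqMoment μ 1 (fun θ => normal μ t θ * tangent μ t θ) t
  calc orderSq μ t ^ 2 * |freqMoment μ 1 a t|
      = |freqMoment μ 1 (fun θ => orderSq μ t ^ 2 * a θ) t| := by
        rw [freqMoment_const_mul, abs_mul, abs_sq]
    _ = |u * meanFreq μ t + v * A + w * B| := by
        simp only [h]
        rw [freqMoment_add_mul₃ hμ (.const 1) (hN.mul hN) (hN.mul hT) one_le_two, meanFreq]
    _ ≤ |u| * |meanFreq μ t| + |v| * |A| + |w| * |B| := by
        simpa only [abs_mul] using abs_add_three (u * meanFreq μ t) (v * A) (w * B)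
    _ ≤ 1 / 2 * |meanFreq μ t| + 1 * |A| + 1 * |B| := by gcongr
    _ ≤ 1 / 2 * |meanFreq μ t| + (spread μ t + kinetic μ t) := by linarith

lemma abs_cosMean_sq_sub_sinMean_sq_le_one (hμ : IsMeasureValuedSolution m γ κ μ) (t : ℝ) :
    |cosMean μ t ^ 2 - sinMean μ t ^ 2| ≤ 1 := by
  have hle : cosMean μ t ^ 2 + sinMean μ t ^ 2 ≤ 1 := orderSq_le_one hμ t
  exact abs_le.2 ⟨by linarith [sq_nonneg (cosMean μ t)], by linarith [sq_nonneg (sinMean μ t)]⟩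

lemma abs_cosMean_mul_sinMean_le (hμ : IsMeasureValuedSolution m γ κ μ) (t : ℝ) :
    |cosMean μ t * sinMean μ t| ≤ 1 / 2 := by
  have hle : cosMean μ t ^ 2 + sinMean μ t ^ 2 ≤ 1 := orderSq_le_one hμ t
  exact abs_le.2 ⟨by linarith [sq_nonneg (cosMean μ t + sinMean μ t)],
    by linarith [sq_nonneg (cosMean μ t - sinMean μ t)]⟩

lemma orderSq_sq_mul_abs_deriv_cosTwoMean_le (hμ : IsMeasureValuedSolution m γ κ μ) (t : ℝ) :
    orderSq μ t ^ 2 * |-4 * freqMoment μ 1 (fun θ => torusSin θ * torusCos θ) t| ≤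
      2 * |meanFreq μ t| + 4 * (spread μ t + kinetic μ t) := by
  have hCS := abs_cosMean_mul_sinMean_le hμ t
  have hbound := orderSq_sq_mul_abs_freqMoment_one_le hμ
    (a := fun θ => torusSin θ * torusCos θ) (t := t) (u := cosMean μ t * sinMean μ t * orderSq μ t)
    (v := -2 * (cosMean μ t * sinMean μ t)) (w := cosMean μ t ^ 2 - sinMean μ t ^ 2)
    ?_ ?_ (abs_cosMean_sq_sub_sinMean_sq_le_one hμ t) fun θ => ?_
  · rw [abs_mul, abs_neg, abs_of_pos (four_pos (α := ℝ))]
    linarith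
  · rw [abs_mul, abs_of_nonneg (orderSq_nonneg μ t)]
    exact (mul_le_of_le_one_right (abs_nonneg _) (orderSq_le_one hμ t)).trans hCS
  · rw [abs_mul, abs_neg, abs_two]
    linarith
  · have htwo : orderSq μ t ^ 2 * (torusSin θ * torusCos θ) =
        cosMean μ t * sinMean μ t * (tangent μ t θ ^ 2 - normal μ t θ ^ 2) +
          (cosMean μ t ^ 2 - sinMean μ t ^ 2) * (normal μ t θ * tangent μ t θ) := by
      unfold orderSq tangent normal
      ring
    linear_combination htwo + cosMean μ t * sinMean μ t * normal_sq_add_tangent_sq μ t θ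

lemma orderSq_sq_mul_abs_deriv_sinTwoMean_le (hμ : IsMeasureValuedSolution m γ κ μ) (t : ℝ) :
    orderSq μ t ^ 2 * |2 * (freqMoment μ 1 (fun θ => torusCos θ * torusCos θ) t -
        freqMoment μ 1 (fun θ => torusSin θ * torusSin θ) t)| ≤
      2 * |meanFreq μ t| + 4 * (spread μ t + kinetic μ t) := by
  have hcc := TorusSmooth.torusCos.mul .torusCos
  have hss := TorusSmooth.torusSin.mul .torusSin
  have hCS := abs_cosMean_mul_sinMean_le hμ t
  have hCC := abs_cosMean_sq_sub_sinMean_sq_le_one hμ t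
  have hbound := orderSq_sq_mul_abs_freqMoment_one_le hμ
    (a := fun θ => 1 / 2 * (torusCos θ * torusCos θ) + -1 / 2 * (torusSin θ * torusSin θ)) (t := t)
    (u := (cosMean μ t ^ 2 - sinMean μ t ^ 2) / 2 * orderSq μ t)
    (v := -(cosMean μ t ^ 2 - sinMean μ t ^ 2)) (w := -2 * (cosMean μ t * sinMean μ t))
    ?_ ?_ ?_ fun θ => ?_
  · rw [freqMoment_add_mul hμ hcc hss one_le_two] at hbound
    have hfour (x y : ℝ) : |2 * (x - y)| = 4 * |1 / 2 * x + -1 / 2 * y| := by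
      calc |2 * (x - y)| = |4 * (1 / 2 * x + -1 / 2 * y)| := by ring_nf
        _ = 4 * |1 / 2 * x + -1 / 2 * y| := by rw [abs_mul, abs_of_pos four_pos]
    rw [hfour]
    linarith
  · rw [abs_mul, abs_of_nonneg (orderSq_nonneg μ t), abs_div, abs_two]
    exact (mul_le_of_le_one_right (by positivity) (orderSq_le_one hμ t)).trans (by linarith)
  · rwa [abs_neg]
  · rw [abs_mul, abs_neg, abs_two]
    linarith
  · have htwo : orderSq μ t ^ 2 * (torusCos θ * torusCos θ - torusSin θ * torusSin θ) =
        (cosMean μ t ^ 2 - sinMean μ t ^ 2) * (tangent μ t θ ^ 2 - normal μ t θ ^ 2) -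
          4 * (cosMean μ t * sinMean μ t) * (normal μ t θ * tangent μ t θ) := by
      unfold orderSq tangent normal
      ring
    linear_combination htwo / 2 +
      (cosMean μ t ^ 2 - sinMean μ t ^ 2) / 2 * normal_sq_add_tangent_sq μ t θ

/-- The complex order parameter `∫ e^{iθ} dμ_t`. -/
def firstMode (μ : ℝ → ProbabilityMeasure Phase) (t : ℝ) : ℂ := ⟨cosMean μ t, sinMean μ t⟩

/-- The second Fourier mode `∫ e^{2iθ} dμ_t`. -/
def secondMode (μ : ℝ → ProbabilityMeasure Phase) (t : ℝ) : ℂ := ⟨cosTwoMean μ t, sinTwoMean μ t⟩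

lemma norm_firstMode_sq (μ : ℝ → ProbabilityMeasure Phase) (t : ℝ) :
    ‖firstMode μ t‖ ^ 2 = orderSq μ t := by
  rw [← Complex.normSq_eq_norm_sq, Complex.normSq_apply, orderSq, sq, sq, firstMode]

lemma continuous_firstMode (hμ : IsMeasureValuedSolution m γ κ μ) (hm : 0 < m) (hγ : 0 < γ)
    (hκ : 0 < κ) : Continuous (firstMode μ) :=
  Complex.equivRealProdCLM.symm.continuous.comp
    ((continuous_cosMean hμ hm hγ hκ).prodMk (continuous_sinMean hμ hm hγ hκ))

lemma exists_tendsto_secondMode (hμ : IsMeasureValuedSolution m γ κ μ) (hm : 0 < m)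
    (hγ : 0 < γ) (hκ : 0 < κ) (h0 : energy m κ μ 0 ≤ 0) (hR : 0 < orderSq μ 0) :
    ∃ ζ, Tendsto (secondMode μ) atTop (𝓝 ζ) := by
  obtain ⟨r, hr, hle⟩ := exists_pos_le_orderSq hμ hm hγ hκ h0 hR
  have hint : IntegrableOn (fun t => (2 * |meanFreq μ t| + 4 * (spread μ t + kinetic μ t)) / r ^ 2)
      (Ioi 0) :=
    (((integrableOn_meanFreq hμ hm hγ hκ).abs.const_mul 2).add
      (((integrableOn_spread hμ hm hγ hκ h0).add
        (integrableOn_kinetic hμ hm hγ hκ h0)).const_mul 4)).div_const (r ^ 2)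
  have hdiv {t x y : ℝ} (ht : 0 ≤ t) (hx : 0 ≤ x) (h : orderSq μ t ^ 2 * x ≤ y) :
      x ≤ y / r ^ 2 := by
    rw [le_div_iff₀' (by positivity)]
    exact (by gcongr; exact hle t ht : r ^ 2 * x ≤ orderSq μ t ^ 2 * x).trans h
  obtain ⟨p, hp⟩ := exists_tendsto_of_abs_deriv_le
    (fun t ht => hasDerivWithinAt_cosTwoMean hμ hm hγ hκ ht)
    (fun t ht => hdiv ht (abs_nonneg _) (orderSq_sq_mul_abs_deriv_cosTwoMean_le hμ t)) hint
  obtain ⟨q, hq⟩ := exists_tendsto_of_abs_deriv_le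
    (fun t ht => hasDerivWithinAt_sinTwoMean hμ hm hγ hκ ht)
    (fun t ht => hdiv ht (abs_nonneg _) (orderSq_sq_mul_abs_deriv_sinTwoMean_le hμ t)) hint
  exact ⟨⟨p, q⟩, tendsto_complexMk hp hq⟩

/-- This is the mean of `(R cos (θ - ψ) + i R sin (θ - ψ)) ^ 2`, where `R e^{iψ}` is the first
mode. -/
lemma conj_firstMode_sq_mul_secondMode (hμ : IsMeasureValuedSolution m γ κ μ) (t : ℝ) :
    starRingEnd ℂ (firstMode μ t ^ 2) * secondMode μ t =
      ⟨orderSq μ t - 2 * spread μ t,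
        2 * freqMoment μ 0 (fun θ => normal μ t θ * tangent μ t θ) t⟩ := by
  have hpythagoras : freqMoment μ 0 (fun θ => torusSin θ * torusSin θ) t +
      freqMoment μ 0 (fun θ => torusCos θ * torusCos θ) t = 1 := by
    have hadd := freqMoment_add_mul hμ (TorusSmooth.torusSin.mul .torusSin)
      (TorusSmooth.torusCos.mul .torusCos) (Nat.zero_le 2) 1 1 t
    simp only [one_mul, ← sq, torusSin_sq_add_torusCos_sq] at hadd
    simpa [freqMoment, moment, sq] using hadd.symm
  apply Complex.ext
  · simp only [firstMode, secondMode, cosTwoMean, sinTwoMean, spread_eq hμ, orderSq, sq, map_mul,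
      Complex.mul_re, Complex.mul_im, Complex.conj_re, Complex.conj_im]
    linear_combination (cosMean μ t ^ 2 + sinMean μ t ^ 2) * hpythagoras
  · simp only [firstMode, secondMode, cosTwoMean, sinTwoMean, sq, map_mul, Complex.mul_re,
      Complex.mul_im, Complex.conj_re, Complex.conj_im,
      freqMoment_normal_mul_tangent hμ (Nat.zero_le 2)]
    ring

lemma tendsto_conj_firstMode_sq_mul_secondMode (hμ : IsMeasureValuedSolution m γ κ μ)
    (hm : 0 < m) (hγ : 0 < γ) (hκ : 0 < κ) (h0 : energy m κ μ 0 ≤ 0) {l : ℝ}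
    (hl : Tendsto (orderSq μ) atTop (𝓝 l)) :
    Tendsto (fun t => starRingEnd ℂ (firstMode μ t ^ 2) * secondMode μ t) atTop (𝓝 l) := by
  have hspread := tendsto_spread hμ hm hγ hκ h0
  have htwist : Tendsto (fun t => freqMoment μ 0 (fun θ => normal μ t θ * tangent μ t θ) t)
      atTop (𝓝 0) := by
    refine squeeze_zero_norm (fun t => Real.abs_le_sqrt (freqMoment_normal_mul_sq_le hμ
      (torusSmooth_tangent μ t) (tangent_sq_le_one hμ t) t)) ?_
    simpa using hspread.sqrt
  simp only [conj_firstMode_sq_mul_secondMode hμ]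
  rw [Complex.ofReal_def]
  simpa using tendsto_complexMk (hl.sub (hspread.const_mul 2)) (htwist.const_mul 2)

lemma exists_tendsto_firstMode (hμ : IsMeasureValuedSolution m γ κ μ) (hm : 0 < m)
    (hγ : 0 < γ) (hκ : 0 < κ) (h0 : energy m κ μ 0 ≤ 0) (hR : 0 < orderSq μ 0) :
    ∃ ζ, ζ ≠ 0 ∧ Tendsto (firstMode μ) atTop (𝓝 ζ) := by
  obtain ⟨l, hl⟩ := exists_tendsto_orderSq hμ hm hγ hκ h0
  obtain ⟨r, hr, hle⟩ := exists_pos_le_orderSq hμ hm hγ hκ h0 hR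
  have hl0 : (l : ℂ) ≠ 0 := Complex.ofReal_ne_zero.2 <| ne_of_gt <| hr.trans_le <|
    ge_of_tendsto hl ((eventually_ge_atTop 0).mono hle)
  obtain ⟨ζ, hζ⟩ := exists_tendsto_secondMode hμ hm hγ hκ h0 hR
  have hprod := tendsto_conj_firstMode_sq_mul_secondMode hμ hm hγ hκ h0 hl
  have hζ0 : ζ ≠ 0 := by
    rintro rfl
    have hnorm : Tendsto (fun t => orderSq μ t * ‖secondMode μ t‖) atTop (𝓝 ‖(l : ℂ)‖) :=
      hprod.norm.congr fun t => by rw [norm_mul, RCLike.norm_conj, norm_pow, norm_firstMode_sq]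
    have hzero := tendsto_nhds_unique hnorm (hl.mul hζ.norm)
    rw [norm_zero, mul_zero] at hzero
    exact hl0 (norm_eq_zero.1 hzero)
  have hquot := hprod.div hζ hζ0
  have hsq : Tendsto (fun t => firstMode μ t ^ 2) atTop (𝓝 (starRingEnd ℂ (l / ζ))) := by
    have hconj : Tendsto (fun t => starRingEnd ℂ (firstMode μ t ^ 2)) atTop (𝓝 (l / ζ)) :=
      hquot.congr' <| (hζ.eventually_ne hζ0).mono fun t ht => mul_div_cancel_right₀ _ ht
    exact ((Complex.continuous_conj.tendsto _).comp hconj).congr fun t => Complex.conj_conj _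
  have hconj0 : starRingEnd ℂ (l / ζ) ≠ 0 := (map_ne_zero _).2 (div_ne_zero hl0 hζ0)
  obtain ⟨b, hb, hlim⟩ := exists_tendsto_of_tendsto_sq (continuous_firstMode hμ hm hγ hκ) hconj0 hsq
  exact ⟨b, by rintro rfl; simp [← hb] at hconj0, hlim⟩

lemma exists_tendsto_cosMean_sinMean (hμ : IsMeasureValuedSolution m γ κ μ) (hm : 0 < m)
    (hγ : 0 < γ) (hκ : 0 < κ) (h0 : energy m κ μ 0 ≤ 0) (hR : 0 < orderSq μ 0) :
    ∃ R φ : ℝ, 0 < R ∧ Tendsto (cosMean μ) atTop (𝓝 (R * Real.cos φ)) ∧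
      Tendsto (sinMean μ) atTop (𝓝 (R * Real.sin φ)) := by
  obtain ⟨ζ, hζ, hlim⟩ := exists_tendsto_firstMode hμ hm hγ hκ h0 hR
  refine ⟨‖ζ‖, ζ.arg, norm_pos_iff.2 hζ, ?_, ?_⟩
  · rw [Complex.norm_mul_cos_arg]
    exact (Complex.continuous_re.tendsto ζ).comp hlim
  · rw [Complex.norm_mul_sin_arg]
    exact (Complex.continuous_im.tendsto ζ).comp hlim

lemma TorusSmooth.comp_sub_const (ha : TorusSmooth a) (φ : Torus) :
    TorusSmooth fun θ => a (θ - φ) := by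
  induction φ using QuotientAddGroup.induction_on with
  | H y => exact ha.comp (contDiff_id.sub contDiff_const)

lemma torusSmooth_torusSin_sub_sq (φ : Torus) : TorusSmooth fun θ => torusSin (θ - φ) ^ 2 := by
  simpa only [sq] using (TorusSmooth.torusSin.comp_sub_const φ).mul
    (TorusSmooth.torusSin.comp_sub_const φ)

lemma tendsto_freqMoment_torusCos_sub (hμ : IsMeasureValuedSolution m γ κ μ) {R : ℝ} {φ : Torus}
    (hC : Tendsto (cosMean μ) atTop (𝓝 (R * torusCos φ)))
    (hS : Tendsto (sinMean μ) atTop (𝓝 (R * torusSin φ))) :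
    Tendsto (freqMoment μ 0 fun θ => torusCos (θ - φ)) atTop (𝓝 R) := by
  have hlim := (hC.const_mul (torusCos φ)).add (hS.const_mul (torusSin φ))
  have hR : torusCos φ * (R * torusCos φ) + torusSin φ * (R * torusSin φ) = R := by
    linear_combination R * torusSin_sq_add_torusCos_sq φ
  rw [hR] at hlim
  refine hlim.congr fun t => ?_
  rw [cosMean, sinMean,
    ← freqMoment_add_mul hμ TorusSmooth.torusCos TorusSmooth.torusSin (Nat.zero_le 2)]
  simp only [torusCos_sub, mul_comm]

lemma sq_mul_torusSin_sub_sq_le (μ : ℝ → ProbabilityMeasure Phase) (R t : ℝ) (θ φ : Torus) :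
    R ^ 2 * torusSin (θ - φ) ^ 2 ≤ 2 * normal μ t θ ^ 2 +
      2 * ((cosMean μ t - R * torusCos φ) ^ 2 + (sinMean μ t - R * torusSin φ) ^ 2) := by
  have herror (p q : ℝ) : (p * torusSin θ - q * torusCos θ) ^ 2 ≤ p ^ 2 + q ^ 2 := by
    have hcauchy : (p * torusSin θ - q * torusCos θ) ^ 2 =
        p ^ 2 + q ^ 2 - (p * torusCos θ + q * torusSin θ) ^ 2 := by
      linear_combination (p ^ 2 + q ^ 2) * torusSin_sq_add_torusCos_sq θ
    rw [hcauchy]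
    exact sub_le_self _ (sq_nonneg _)
  have hyoung (x y : ℝ) : (x - y) ^ 2 ≤ 2 * (x ^ 2 + y ^ 2) := by
    linarith [sq_nonneg (x + y), add_sq x y, sub_sq x y]
  calc R ^ 2 * torusSin (θ - φ) ^ 2 = (normal μ t θ - ((cosMean μ t - R * torusCos φ) * torusSin θ -
        (sinMean μ t - R * torusSin φ) * torusCos θ)) ^ 2 := by
        rw [torusSin_sub, normal]
        ring
    _ ≤ 2 * normal μ t θ ^ 2 + 2 * ((cosMean μ t - R * torusCos φ) * torusSin θ -
        (sinMean μ t - R * torusSin φ) * torusCos θ) ^ 2 := by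
        rw [← mul_add]
        exact hyoung _ _
    _ ≤ _ := by
        gcongr
        exact herror _ _

lemma tendsto_freqMoment_torusSin_sub_sq (hμ : IsMeasureValuedSolution m γ κ μ) (hm : 0 < m)
    (hγ : 0 < γ) (hκ : 0 < κ) (h0 : energy m κ μ 0 ≤ 0) {R : ℝ} (hR : 0 < R) {φ : Torus}
    (hC : Tendsto (cosMean μ) atTop (𝓝 (R * torusCos φ)))
    (hS : Tendsto (sinMean μ) atTop (𝓝 (R * torusSin φ))) :
    Tendsto (freqMoment μ 0 fun θ => torusSin (θ - φ) ^ 2) atTop (𝓝 0) := by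
  let error (t : ℝ) := (cosMean μ t - R * torusCos φ) ^ 2 + (sinMean μ t - R * torusSin φ) ^ 2
  have hbound : Tendsto (fun t => 2 / R ^ 2 * (error t + spread μ t)) atTop (𝓝 0) := by
    have herror := ((hC.sub_const (R * torusCos φ)).pow 2).add
      ((hS.sub_const (R * torusSin φ)).pow 2)
    simpa using (herror.add (tendsto_spread hμ hm hγ hκ h0)).const_mul (2 / R ^ 2)
  refine squeeze_zero (fun t => integral_nonneg fun z => by positivity) (fun t => ?_) hbound
  have hle := freqMoment_le hμ (torusSmooth_torusSin_sub_sq φ)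
    ((TorusSmooth.const (2 / R ^ 2)).mul (torusSmooth_normal_sq μ t)) (Nat.zero_le 2) (t := t)
    (c := 2 / R ^ 2 * error t) (β := 0) fun θ w => ?_
  · rw [freqMoment_const_mul] at hle
    rw [mul_add]
    simpa [spread] using hle
  · have hpoint := sq_mul_torusSin_sub_sq_le μ R t θ φ
    rw [pow_zero, mul_one, zero_mul, add_zero, ← mul_add, div_mul_eq_mul_div,
      le_div_iff₀ (by positivity)]
    linarith

lemma orderParameter_eq_sqrt (μ : ℝ → ProbabilityMeasure Phase) {t : ℝ} (ht : 0 ≤ t) :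
    orderParameter (μ t : Measure Phase) = √(orderSq μ t) := by
  have hmean : ∫ z, torusExp z.1 ∂(μ t : Measure Phase) =
      (cosMean μ t : ℂ) + (sinMean μ t : ℂ) * Complex.I := by
    simp only [cosMean, sinMean, freqMoment, moment, pow_zero, mul_one, state_of_nonneg μ ht,
      torusExp_eq]
    rw [integral_add TorusSmooth.torusCos.integrable.ofReal
      (TorusSmooth.torusSin.integrable.ofReal.mul_const _), integral_mul_const,
      integral_complex_ofReal, integral_complex_ofReal]
  rw [orderParameter, hmean, Complex.norm_add_mul_I, orderSq]

lemma orderParameter_sq (μ : ℝ → ProbabilityMeasure Phase) {t : ℝ} (ht : 0 ≤ t) :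
    orderParameter (μ t : Measure Phase) ^ 2 = orderSq μ t := by
  rw [orderParameter_eq_sqrt μ ht, Real.sq_sqrt (orderSq_nonneg μ t)]

/-! ### Stationarity when the order parameter vanishes -/

lemma orderSq_eq_zero (hμ : IsMeasureValuedSolution m γ κ μ) (hm : 0 < m) (hγ : 0 < γ)
    (hκ : 0 < κ) (h0 : energy m κ μ 0 ≤ 0) (hR : orderSq μ 0 = 0) {t : ℝ} (ht : 0 ≤ t) :
    orderSq μ t = 0 := by
  have hbound (s : ℝ) (hs : s ∈ Ico 0 t) :
      ‖-2 * drift μ s‖ ≤ (1 + κ / m) * ‖orderSq μ s‖ := by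
    rw [norm_mul, Real.norm_eq_abs (drift μ s), Real.norm_of_nonneg (orderSq_nonneg μ s), norm_neg,
      Real.norm_ofNat]
    linarith [abs_drift_le_orderSq hμ hm hγ hκ h0 hs.1]
  exact eq_zero_of_abs_deriv_le_mul_abs_self_of_eq_zero_right
    (continuous_orderSq hμ hm hγ hκ).continuousOn
    (fun s hs => (hasDerivWithinAt_orderSq hμ hm hγ hκ hs.1).mono (Ici_subset_Ici.2 hs.1))
    hR hbound t (right_mem_Icc.2 ht)

lemma ae_snd_eq_zero (hμ : IsMeasureValuedSolution m γ κ μ) (hm : 0 < m) (hγ : 0 < γ)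
    (hκ : 0 < κ) (h0 : energy m κ μ 0 ≤ 0) (hR : orderSq μ 0 = 0) {t : ℝ} (ht : 0 ≤ t) :
    ∀ᵐ z ∂state μ t, z.2 = 0 := by
  have hkinetic : kinetic μ t = 0 := by
    refine le_antisymm ?_ (kinetic_nonneg μ t)
    simpa [orderSq_eq_zero hμ hm hγ hκ h0 hR ht] using kinetic_le_orderSq hμ hm hγ hκ h0 ht
  filter_upwards [(integral_eq_zero_iff_of_nonneg (fun z : Phase => sq_nonneg z.2)
    (integrable_sq hμ t)).1 hkinetic] with z hz
  exact pow_eq_zero_iff two_ne_zero |>.1 hz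

lemma freqMoment_zero_eq_initial (hμ : IsMeasureValuedSolution m γ κ μ) (hm : 0 < m) (hγ : 0 < γ)
    (hκ : 0 < κ) (h0 : energy m κ μ 0 ≤ 0) (hR : orderSq μ 0 = 0) (ha : TorusSmooth a) {t : ℝ}
    (ht : 0 ≤ t) : freqMoment μ 0 a t = freqMoment μ 0 a 0 := by
  have hflux (s : ℝ) (hs : 0 ≤ s) : freqMoment μ 1 (torusDeriv a) s = 0 := by
    refine integral_eq_zero_of_ae ?_
    filter_upwards [ae_snd_eq_zero hμ hm hγ hκ h0 hR hs] with z hz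
    simp [hz]
  have hderiv (s : ℝ) (hs : 0 ≤ s) : HasDerivWithinAt (freqMoment μ 0 a) 0 (Ici 0) s :=
    hflux s hs ▸ hasDerivWithinAt_freqMoment_zero hμ hm hγ hκ ha hs
  exact constant_of_has_deriv_right_zero
    (fun s hs => (hderiv s hs.1).continuousWithinAt.mono Icc_subset_Ici_self)
    (fun s hs => (hderiv s hs.1).mono (Ici_subset_Ici.2 hs.1)) t (right_mem_Icc.2 ht)

lemma contDiff_fourier_coe (n : ℤ) :
    ContDiff ℝ ∞ fun x : ℝ => (fourier n (x : Torus) : ℂ) := by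
  simp_rw [fourier_coe_apply]
  exact ((contDiff_const.mul Complex.ofRealCLM.contDiff).div_const _).cexp

lemma integrable_comp_fst (ν : Measure Phase) [IsFiniteMeasure ν] (f : C(Torus, ℂ)) :
    Integrable (fun z : Phase => f z.1) ν :=
  .of_bound (f.continuous.comp continuous_fst).aestronglyMeasurable ‖f‖
    (.of_forall fun z => f.norm_coe_le_norm z.1)

/-- Integration of continuous functions of the phase against `ν`, as a continuous linear form, so
that two such forms can be compared on a dense subspace. -/
def phaseIntegral (ν : Measure Phase) [IsFiniteMeasure ν] : C(Torus, ℂ) →L[ℂ] ℂ :=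
  LinearMap.mkContinuous
    { toFun := fun f => ∫ z, f z.1 ∂ν
      map_add' := fun f g => integral_add (integrable_comp_fst ν f) (integrable_comp_fst ν g)
      map_smul' := fun c f => integral_const_mul c fun z : Phase => f z.1 } (ν.real univ)
    fun f => (norm_integral_le_of_norm_le_const (.of_forall fun z : Phase =>
      f.norm_coe_le_norm z.1)).trans_eq (mul_comm _ _)

lemma phaseIntegral_congr {ν₁ ν₂ : Measure Phase} [IsFiniteMeasure ν₁] [IsFiniteMeasure ν₂]
    (h : ∀ a : Torus → ℝ, TorusSmooth a → ∫ z, a z.1 ∂ν₁ = ∫ z, a z.1 ∂ν₂) :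
    phaseIntegral ν₁ = phaseIntegral ν₂ := by
  refine ContinuousLinearMap.ext_on
    (Submodule.dense_iff_topologicalClosure_eq_top.2 span_fourier_closure_eq_top) ?_
  rintro _ ⟨n, rfl⟩
  have hre : TorusSmooth fun θ => (fourier n θ : ℂ).re :=
    Complex.reCLM.contDiff.comp (contDiff_fourier_coe n)
  have him : TorusSmooth fun θ => (fourier n θ : ℂ).im :=
    Complex.imCLM.contDiff.comp (contDiff_fourier_coe n)
  have hsplit (ν : Measure Phase) [IsFiniteMeasure ν] : phaseIntegral ν (fourier n) =
      ((∫ z, (fourier n z.1 : ℂ).re ∂ν : ℝ) : ℂ) +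
        (∫ z, (fourier n z.1 : ℂ).im ∂ν : ℝ) * Complex.I := by
    rw [← integral_complex_ofReal, ← integral_complex_ofReal, ← integral_mul_const,
      ← integral_add hre.integrable.ofReal (him.integrable.ofReal.mul_const _)]
    exact integral_congr_ae (.of_forall fun z : Phase =>
      (Complex.re_add_im (fourier n z.1 : ℂ)).symm)
  rw [hsplit, hsplit, h _ hre, h _ him]

lemma ext_of_ae_snd_eq_zero {ν₁ ν₂ : Measure Phase} [IsFiniteMeasure ν₁] [IsFiniteMeasure ν₂]
    (h₁ : ∀ᵐ z ∂ν₁, z.2 = 0) (h₂ : ∀ᵐ z ∂ν₂, z.2 = 0)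
    (h : ∀ a : Torus → ℝ, TorusSmooth a → ∫ z, a z.1 ∂ν₁ = ∫ z, a z.1 ∂ν₂) : ν₁ = ν₂ := by
  refine ext_of_forall_integral_eq_of_IsFiniteMeasure fun f => ?_
  let slice : C(Torus, ℂ) := ⟨fun θ => (f (θ, 0) : ℂ), by fun_prop⟩
  have hrestrict {ν : Measure Phase} [IsFiniteMeasure ν] (hν : ∀ᵐ z ∂ν, z.2 = 0) :
      ((∫ z, f z ∂ν : ℝ) : ℂ) = phaseIntegral ν slice := by
    rw [← integral_complex_ofReal]
    change ∫ z, (f z : ℂ) ∂ν = ∫ z, (f (z.1, 0) : ℂ) ∂ν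
    refine integral_congr_ae ?_
    filter_upwards [hν] with z hz
    rw [← hz]
  exact_mod_cast (hrestrict h₁).trans ((congrArg (· slice) (phaseIntegral_congr h)).trans
    (hrestrict h₂).symm)

lemma eq_initial_of_orderSq_eq_zero (hμ : IsMeasureValuedSolution m γ κ μ) (hm : 0 < m)
    (hγ : 0 < γ) (hκ : 0 < κ) (h0 : energy m κ μ 0 ≤ 0) (hR : orderSq μ 0 = 0) {t : ℝ}
    (ht : 0 ≤ t) : μ t = μ 0 := by
  have hstate : state μ t = state μ 0 :=
    ext_of_ae_snd_eq_zero (ae_snd_eq_zero hμ hm hγ hκ h0 hR ht)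
      (ae_snd_eq_zero hμ hm hγ hκ h0 hR le_rfl) fun a ha => by
        simpa only [freqMoment, moment, pow_zero, mul_one] using
          freqMoment_zero_eq_initial hμ hm hγ hκ h0 hR ha ht
  rw [state_of_nonneg μ ht, state_of_nonneg μ le_rfl] at hstate
  exact Subtype.ext hstate

end WeakEquation

/-! ### Couplings with two-point measures -/

section TwoPoint

variable {α β : Type*} [MeasurableSpace α] [MeasurableSpace β] {ν : Measure α}
  {w : α → ℝ} {c : ℝ}

lemma integrable_of_mem_Icc [IsFiniteMeasure ν] (hw : Measurable w)
    (hw01 : ∀ z, w z ∈ Icc (0 : ℝ) 1) : Integrable w ν :=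
  .of_mem_Icc 0 1 hw.aemeasurable (.of_forall hw01)

lemma exists_weight_of_le_integral (hw : Measurable w) (hw01 : ∀ z, w z ∈ Icc (0 : ℝ) 1)
    (hc : 0 ≤ c) (hle : c ≤ ∫ z, w z ∂ν) :
    ∃ v : α → ℝ, Measurable v ∧ (∀ z, v z ∈ Icc (0 : ℝ) 1) ∧ ∫ z, v z ∂ν = c ∧
      ∫ z, |v z - w z| ∂ν ≤ |∫ z, w z ∂ν - c| := by
  set A := ∫ z, w z ∂ν
  have hA : 0 ≤ A := hc.trans hle
  have hmul : c / A * A = c := div_mul_cancel_of_imp fun h => le_antisymm (h ▸ hle) hc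
  have hratio : c / A ∈ Icc (0 : ℝ) 1 := ⟨div_nonneg hc hA, div_le_one_of_le₀ hle hA⟩
  refine ⟨fun z => c / A * w z, hw.const_mul _, fun z => unitInterval.mul_mem hratio (hw01 z), ?_,
    le_of_eq ?_⟩
  · rw [integral_const_mul, hmul]
  · have hdiff (z : α) : |c / A * w z - w z| = (1 - c / A) * w z := by
      rw [abs_sub_comm, abs_of_nonneg] <;> nlinarith [(hw01 z).1, hratio.2]
    simp_rw [hdiff]
    rw [integral_const_mul, abs_of_nonneg (sub_nonneg.2 hle), sub_mul, one_mul, hmul]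

lemma integral_one_sub [IsProbabilityMeasure ν] (hw : Integrable w ν) :
    ∫ z, (1 - w z) ∂ν = 1 - ∫ z, w z ∂ν := by
  rw [integral_sub (integrable_const 1) hw]
  simp

lemma exists_weight_integral_eq [IsProbabilityMeasure ν] (hw : Measurable w)
    (hw01 : ∀ z, w z ∈ Icc (0 : ℝ) 1) (hc : c ∈ Icc (0 : ℝ) 1) :
    ∃ v : α → ℝ, Measurable v ∧ (∀ z, v z ∈ Icc (0 : ℝ) 1) ∧ ∫ z, v z ∂ν = c ∧
      ∫ z, |v z - w z| ∂ν ≤ |∫ z, w z ∂ν - c| := by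
  have hcompl := integral_one_sub (integrable_of_mem_Icc (ν := ν) hw hw01)
  rcases le_total c (∫ z, w z ∂ν) with hle | hle
  · exact exists_weight_of_le_integral hw hw01 hc.1 hle
  · obtain ⟨v, hv, hv01, hint, hdist⟩ := exists_weight_of_le_integral (ν := ν) (hw.const_sub 1)
      (fun z => Icc.one_sub_mem (hw01 z)) (sub_nonneg.2 hc.2)
      (by rw [hcompl]; linarith)
    refine ⟨fun z => 1 - v z, hv.const_sub 1,
      fun z => Icc.one_sub_mem (hv01 z), ?_, ?_⟩
    · rw [integral_one_sub (integrable_of_mem_Icc hv hv01), hint, sub_sub_cancel]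
    · rw [hcompl, sub_sub_sub_cancel_left, abs_sub_comm] at hdist
      refine le_of_eq_of_le (integral_congr_ae (.of_forall fun z => ?_)) hdist
      rw [← abs_neg]
      ring_nf

/-- The coupling that sends the share `w z` of the mass of `ν` at `z` to `p` and the remaining
share to `q`. -/
def twoPointCoupling (ν : Measure α) (w : α → ℝ) (p q : β) : Measure (α × β) :=
  (ν.withDensity fun z => ENNReal.ofReal (w z)).map (fun z => (z, p)) +
    (ν.withDensity fun z => ENNReal.ofReal (1 - w z)).map (fun z => (z, q))

lemma map_fst_twoPointCoupling (hw : Measurable w) (hw01 : ∀ z, w z ∈ Icc (0 : ℝ) 1) (p q : β) :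
    (twoPointCoupling ν w p q).map Prod.fst = ν := by
  have hone : ((fun z => ENNReal.ofReal (w z)) + fun z => ENNReal.ofReal (1 - w z)) = 1 := by
    funext z
    rw [Pi.add_apply, ← ENNReal.ofReal_add (hw01 z).1 (sub_nonneg.2 (hw01 z).2)]
    simp
  rw [twoPointCoupling, Measure.map_add _ _ measurable_fst,
    Measure.map_map measurable_fst measurable_prodMk_right,
    Measure.map_map measurable_fst measurable_prodMk_right]
  change Measure.map id _ + Measure.map id _ = ν
  rw [Measure.map_id, Measure.map_id, ← withDensity_add_left hw.ennreal_ofReal, hone,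
    withDensity_one]

lemma map_snd_twoPointCoupling [IsProbabilityMeasure ν] (hw : Measurable w)
    (hw01 : ∀ z, w z ∈ Icc (0 : ℝ) 1) (p q : β) :
    (twoPointCoupling ν w p q).map Prod.snd =
      ENNReal.ofReal (∫ z, w z ∂ν) • Measure.dirac p +
        ENNReal.ofReal (1 - ∫ z, w z ∂ν) • Measure.dirac q := by
  have hint : Integrable w ν := integrable_of_mem_Icc hw hw01
  rw [twoPointCoupling, Measure.map_add _ _ measurable_snd,
    Measure.map_map measurable_snd measurable_prodMk_right,
    Measure.map_map measurable_snd measurable_prodMk_right]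
  change Measure.map (fun _ => p) _ + Measure.map (fun _ => q) _ = _
  rw [Measure.map_const, Measure.map_const, withDensity_apply _ .univ, withDensity_apply _ .univ,
    Measure.restrict_univ,
    ofReal_integral_eq_lintegral_ofReal hint (.of_forall fun z => (hw01 z).1),
    ← integral_one_sub hint, ofReal_integral_eq_lintegral_ofReal
      (integrable_of_mem_Icc (hw.const_sub 1) fun z => Icc.one_sub_mem (hw01 z))
      (.of_forall fun z => sub_nonneg.2 (hw01 z).2)]

lemma lintegral_twoPointCoupling (hw : Measurable w) (p q : β) {g : α × β → ℝ≥0∞}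
    (hg : Measurable g) :
    ∫⁻ x, g x ∂twoPointCoupling ν w p q =
      ∫⁻ z, (ENNReal.ofReal (w z) * g (z, p) + ENNReal.ofReal (1 - w z) * g (z, q)) ∂ν := by
  have hpair (r : β) : Measurable fun z : α => (z, r) := measurable_prodMk_right
  have hslice (r : β) : Measurable fun z : α => g (z, r) := hg.comp (hpair r)
  rw [twoPointCoupling, lintegral_add_measure, lintegral_map hg (hpair p),
    lintegral_map hg (hpair q),
    lintegral_withDensity_eq_lintegral_mul _ hw.ennreal_ofReal (hslice p),
    lintegral_withDensity_eq_lintegral_mul _ (hw.const_sub 1).ennreal_ofReal (hslice q),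
    ← lintegral_add_left (hw.ennreal_ofReal.mul (hslice p))]
  rfl

end TwoPoint

/-! ### The Wasserstein distance -/

lemma measurable_edist_sq_add_edist_sq :
    Measurable fun p : Phase × Phase => edist p.1.1 p.2.1 ^ 2 + edist p.1.2 p.2.2 ^ 2 :=
  ((measurable_fst.fst.edist measurable_snd.fst).pow_const 2).add
    ((measurable_fst.snd.edist measurable_snd.snd).pow_const 2)

lemma enorm_sub_le_of_lipschitzWith {f : Phase → ℝ} {L : NNReal} (hf : LipschitzWith L f)
    (x y : Phase) : ‖f x - f y‖ₑ ^ 2 ≤ L ^ 2 * (edist x.1 y.1 ^ 2 + edist x.2 y.2 ^ 2) := by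
  have hmax : edist x y ^ 2 ≤ edist x.1 y.1 ^ 2 + edist x.2 y.2 ^ 2 := by
    rcases max_choice (edist x.1 y.1) (edist x.2 y.2) with h | h <;>
      rw [Prod.edist_eq, h] <;> simp
  calc ‖f x - f y‖ₑ ^ 2 = edist (f x) (f y) ^ 2 := by rw [edist_eq_enorm_sub]
    _ ≤ (L * edist x y) ^ 2 := by gcongr; exact hf x y
    _ = L ^ 2 * edist x y ^ 2 := mul_pow _ _ _
    _ ≤ _ := by gcongr

lemma enorm_integral_sub_integral_le_mul_wasserstein2 {ν₁ ν₂ : Measure Phase}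
    [IsProbabilityMeasure ν₁] {f : Phase → ℝ} (h₁ : Integrable f ν₁) (h₂ : Integrable f ν₂)
    {L : NNReal} (hL : L ≠ 0) (hf : LipschitzWith L f) :
    ‖∫ z, f z ∂ν₁ - ∫ z, f z ∂ν₂‖ₑ ≤ L * wasserstein2 ν₁ ν₂ := by
  have hL' : (L : ℝ≥0∞) ≠ 0 := ENNReal.coe_ne_zero.2 hL
  simp only [wasserstein2, ENNReal.mul_iInf_of_ne hL' ENNReal.coe_ne_top]
  refine le_iInf fun ρ => le_iInf fun hρ₁ => le_iInf fun hρ₂ => ?_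
  subst hρ₁ hρ₂
  have : IsProbabilityMeasure ρ := Measure.isProbabilityMeasure_of_map Prod.fst
  have hcont := hf.continuous
  have hfst : Integrable (fun p : Phase × Phase => f p.1) ρ := h₁.comp_measurable measurable_fst
  have hsnd : Integrable (fun p : Phase × Phase => f p.2) ρ := h₂.comp_measurable measurable_snd
  have hdiff : AEStronglyMeasurable (fun p : Phase × Phase => f p.1 - f p.2) ρ := by fun_prop
  calc ‖∫ z, f z ∂ρ.map Prod.fst - ∫ z, f z ∂ρ.map Prod.snd‖ₑ
      = ‖∫ p, (f p.1 - f p.2) ∂ρ‖ₑ := by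
        rw [integral_map measurable_fst.aemeasurable h₁.1,
          integral_map measurable_snd.aemeasurable h₂.1, ← integral_sub hfst hsnd]
    _ ≤ eLpNorm (fun p : Phase × Phase => f p.1 - f p.2) 1 ρ := by
        rw [eLpNorm_one_eq_lintegral_enorm]
        exact enorm_integral_le_lintegral_enorm _
    _ ≤ eLpNorm (fun p : Phase × Phase => f p.1 - f p.2) 2 ρ :=
        eLpNorm_le_eLpNorm_of_exponent_le one_le_two hdiff
    _ = (∫⁻ p, ‖f p.1 - f p.2‖ₑ ^ 2 ∂ρ) ^ (1 / 2 : ℝ) := by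
        simp [eLpNorm_eq_lintegral_rpow_enorm_toReal two_ne_zero ENNReal.ofNat_ne_top]
    _ ≤ (∫⁻ p, L ^ 2 * (edist p.1.1 p.2.1 ^ 2 + edist p.1.2 p.2.2 ^ 2) ∂ρ) ^ (1 / 2 : ℝ) := by
        gcongr with p
        exact enorm_sub_le_of_lipschitzWith hf p.1 p.2
    _ = L * (∫⁻ p, (edist p.1.1 p.2.1 ^ 2 + edist p.1.2 p.2.2 ^ 2) ∂ρ) ^ (1 / 2 : ℝ) := by
        rw [lintegral_const_mul _ measurable_edist_sq_add_edist_sq,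
          ENNReal.mul_rpow_of_nonneg _ _ (by norm_num), ← ENNReal.rpow_natCast_mul]
        norm_num

lemma tendsto_of_tendsto_wasserstein2 {ι : Type*} {l : Filter ι} [l.IsCountablyGenerated]
    {νs : ι → ProbabilityMeasure Phase} {ν : ProbabilityMeasure Phase}
    (h : Tendsto (fun i => wasserstein2 (νs i) ν) l (𝓝 0)) : Tendsto νs l (𝓝 ν) := by
  refine tendsto_iff_forall_lipschitz_integral_tendsto.2 ?_
  rintro f ⟨M, hM⟩ ⟨L, hL⟩
  have hint (ν : ProbabilityMeasure Phase) : Integrable f (ν : Measure Phase) := by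
    refine .of_bound hL.continuous.aestronglyMeasurable (‖f 0‖ + M) (.of_forall fun z => ?_)
    rw [add_comm]
    exact (norm_le_norm_sub_add (f z) (f 0)).trans (by gcongr; exact hM z 0)
  have hlim := ENNReal.Tendsto.const_mul h (.inr (ENNReal.coe_ne_top (r := L + 1)))
  rw [mul_zero] at hlim
  rw [tendsto_iff_edist_tendsto_0]
  refine tendsto_of_tendsto_of_tendsto_of_le_of_le tendsto_const_nhds hlim
    (fun i => zero_le) fun i => ?_
  rw [edist_eq_enorm_sub]
  exact enorm_integral_sub_integral_le_mul_wasserstein2 (hint _) (hint _) (by positivity)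
    (hL.weaken (le_add_of_nonneg_right zero_le_one))

section BipolarStates

variable {m γ κ : ℝ} {μ : ℝ → ProbabilityMeasure Phase}

/-! ### Bi-polar states -/

lemma torusCos_sub_pi (α : Torus) : torusCos (α - ((Real.pi : ℝ) : Torus)) = -torusCos α := by
  simp [torusCos_sub]

lemma norm_sq_le_pi_sq_mul (α : Torus) : ‖α‖ ^ 2 ≤ Real.pi ^ 2 * ((1 - torusCos α) / 2) := by
  obtain ⟨x, hx, rfl⟩ : α ∈ ((↑) : ℝ → Torus) '' Ico (-Real.pi) (-Real.pi + 2 * Real.pi) :=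
    AddCircle.coe_image_Ico_eq (2 * Real.pi) (-Real.pi) ▸ mem_univ α
  have habs : |x| ≤ Real.pi := abs_le.2 ⟨hx.1, by linarith [hx.2]⟩
  have hnorm : ‖(x : Torus)‖ = |x| := by
    refine (AddCircle.norm_coe_eq_abs_iff _ Real.two_pi_pos.ne').2 ?_
    rw [abs_of_pos Real.two_pi_pos]
    linarith
  calc ‖(x : Torus)‖ ^ 2 = Real.pi ^ 2 * ((2 / Real.pi ^ 2 * x ^ 2) / 2) := by
        rw [hnorm, sq_abs]
        field_simp
    _ ≤ Real.pi ^ 2 * ((1 - torusCos x) / 2) := by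
        rw [torusCos_coe]
        gcongr
        exact le_sub_comm.1 (Real.cos_le_one_sub_mul_cos_sq habs)

lemma dist_sq_le_pi_sq (θ φ : Torus) : dist θ φ ^ 2 ≤ Real.pi ^ 2 := by
  rw [dist_eq_norm]
  refine (norm_sq_le_pi_sq_mul _).trans (mul_le_of_le_one_right (sq_nonneg _) ?_)
  linarith [neg_le_of_abs_le (abs_torusCos_le_one (θ - φ))]

/-- The squared distance from `z` to the point `(φ, 0)`. -/
def distSqTo (φ : Torus) (z : Phase) : ℝ := dist z.1 φ ^ 2 + z.2 ^ 2

lemma distSqTo_nonneg (φ : Torus) (z : Phase) : 0 ≤ distSqTo φ z := by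
  unfold distSqTo
  positivity

lemma edist_sq_add_edist_sq (φ : Torus) (z : Phase) :
    edist z.1 φ ^ 2 + edist z.2 0 ^ 2 = ENNReal.ofReal (distSqTo φ z) := by
  rw [distSqTo, edist_dist, edist_dist, ENNReal.ofReal_add (by positivity) (by positivity),
    ENNReal.ofReal_pow dist_nonneg, ← sq_abs z.2, ENNReal.ofReal_pow (abs_nonneg _)]
  simp

/-- The share of the mass at `(θ, ω)` that is sent to the pole `φ` when `ν` is transported to a
bi-polar state with poles `φ` and `φ + π`, namely `(1 + cos (θ - φ)) / 2`. -/
def poleWeight (φ : Torus) (z : Phase) : ℝ := (1 + torusCos (z.1 - φ)) / 2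

lemma measurable_poleWeight (φ : Torus) : Measurable (poleWeight φ) :=
  (((TorusSmooth.torusCos.comp_sub_const φ).continuous.measurable.comp measurable_fst).const_add
    1).div_const 2

lemma poleWeight_mem_Icc (φ : Torus) (z : Phase) : poleWeight φ z ∈ Icc (0 : ℝ) 1 := by
  obtain ⟨hl, hu⟩ := abs_le.1 (abs_torusCos_le_one (z.1 - φ))
  exact ⟨by unfold poleWeight; linarith, by unfold poleWeight; linarith⟩

lemma integral_poleWeight (ν : Measure Phase) [IsProbabilityMeasure ν] (φ : Torus) :
    ∫ z, poleWeight φ z ∂ν = (1 + ∫ z, torusCos (z.1 - φ) ∂ν) / 2 := by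
  simp only [poleWeight]
  rw [integral_div, integral_add (integrable_const 1)
    (TorusSmooth.torusCos.comp_sub_const φ).integrable]
  simp

lemma weighted_distSqTo_le {w : ℝ} (φ : Torus) (z : Phase) :
    w * distSqTo φ z + (1 - w) * distSqTo (φ + ((Real.pi : ℝ) : Torus)) z ≤
      Real.pi ^ 2 / 2 * torusSin (z.1 - φ) ^ 2 +
        Real.pi ^ 2 * |w - poleWeight φ z| + z.2 ^ 2 := by
  unfold poleWeight
  set C := torusCos (z.1 - φ)
  set x := dist z.1 φ ^ 2 with hxdef
  set y := dist z.1 (φ + ((Real.pi : ℝ) : Torus)) ^ 2 with hydef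
  obtain ⟨hC, hC'⟩ := abs_le.1 (abs_torusCos_le_one (z.1 - φ))
  have hx : x ≤ Real.pi ^ 2 * ((1 - C) / 2) := by
    rw [hxdef, dist_eq_norm]
    exact norm_sq_le_pi_sq_mul _
  have hy : y ≤ Real.pi ^ 2 * ((1 + C) / 2) := by
    rw [hydef, dist_eq_norm, ← sub_sub, ← sub_neg_eq_add 1 C, ← torusCos_sub_pi]
    exact norm_sq_le_pi_sq_mul _
  have hxy : |x - y| ≤ Real.pi ^ 2 :=
    abs_sub_le_of_nonneg_of_le (sq_nonneg _) (dist_sq_le_pi_sq _ _) (sq_nonneg _)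
      (dist_sq_le_pi_sq _ _)
  have hsplit : (1 + C) / 2 * x + (1 - C) / 2 * y ≤ Real.pi ^ 2 / 2 * torusSin (z.1 - φ) ^ 2 :=
    calc (1 + C) / 2 * x + (1 - C) / 2 * y
        ≤ (1 + C) / 2 * (Real.pi ^ 2 * ((1 - C) / 2)) +
          (1 - C) / 2 * (Real.pi ^ 2 * ((1 + C) / 2)) := by
          exact add_le_add (mul_le_mul_of_nonneg_left hx (by linarith))
            (mul_le_mul_of_nonneg_left hy (by linarith))
      _ = Real.pi ^ 2 / 2 * torusSin (z.1 - φ) ^ 2 := by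
          linear_combination -(Real.pi ^ 2 / 2) * torusSin_sq_add_torusCos_sq (z.1 - φ)
  have hshift : (w - (1 + C) / 2) * (x - y) ≤ Real.pi ^ 2 * |w - (1 + C) / 2| := by
    rw [mul_comm (Real.pi ^ 2)]
    exact (le_abs_self _).trans ((abs_mul _ _).trans_le (by gcongr))
  calc w * distSqTo φ z + (1 - w) * distSqTo (φ + ((Real.pi : ℝ) : Torus)) z
      = (1 + C) / 2 * x + (1 - C) / 2 * y + (w - (1 + C) / 2) * (x - y) + z.2 ^ 2 := by
        simp only [distSqTo, ← hxdef, ← hydef]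
        ring
    _ ≤ _ := by gcongr

/-- The bi-polar state with poles `φ`, `φ + π` and masses `c`, `1 - c`. -/
def bipolarMeasure (φ : Torus) (c : ℝ) : Measure Phase :=
  (ENNReal.ofReal c • Measure.dirac φ
    + ENNReal.ofReal (1 - c) • Measure.dirac (φ + ((Real.pi : ℝ) : Torus))).prod
      (Measure.dirac (0 : ℝ))

lemma bipolarMeasure_eq (φ : Torus) (c : ℝ) :
    bipolarMeasure φ c = ENNReal.ofReal c • Measure.dirac (φ, 0)
      + ENNReal.ofReal (1 - c) • Measure.dirac (φ + ((Real.pi : ℝ) : Torus), 0) := by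
  simp only [bipolarMeasure, Measure.add_prod, Measure.prod_smul_left, Measure.dirac_prod_dirac]

lemma isProbabilityMeasure_bipolarMeasure (φ : Torus) {c : ℝ} (hc : c ∈ Icc (0 : ℝ) 1) :
    IsProbabilityMeasure (bipolarMeasure φ c) := by
  constructor
  rw [bipolarMeasure_eq, Measure.add_apply, Measure.smul_apply, Measure.smul_apply, measure_univ,
    measure_univ, smul_eq_mul, smul_eq_mul, mul_one, mul_one,
    ← ENNReal.ofReal_add hc.1 (sub_nonneg.2 hc.2), add_sub_cancel, ENNReal.ofReal_one]

/-- An upper bound for the squared Wasserstein distance from `ν` to `bipolarMeasure φ c`. The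
middle term pays for correcting the mass that `poleWeight φ` sends to the pole `φ`. -/
def bipolarDefect (ν : Measure Phase) (φ : Torus) (c : ℝ) : ℝ :=
  Real.pi ^ 2 / 2 * ∫ z, torusSin (z.1 - φ) ^ 2 ∂ν +
    Real.pi ^ 2 * |∫ z, poleWeight φ z ∂ν - c| + ∫ z, z.2 ^ 2 ∂ν

lemma wasserstein2_bipolarMeasure_le_of_weight {ν : Measure Phase} [IsProbabilityMeasure ν]
    {w : Phase → ℝ} (hw : Measurable w) (hw01 : ∀ z, w z ∈ Icc (0 : ℝ) 1) (φ : Torus) :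
    wasserstein2 ν (bipolarMeasure φ (∫ z, w z ∂ν)) ≤
      (∫⁻ z, ENNReal.ofReal (w z * distSqTo φ z +
        (1 - w z) * distSqTo (φ + ((Real.pi : ℝ) : Torus)) z) ∂ν) ^ (1 / 2 : ℝ) := by
  refine iInf_le_of_le (twoPointCoupling ν w (φ, 0) (φ + ((Real.pi : ℝ) : Torus), 0)) <|
    iInf_le_of_le (map_fst_twoPointCoupling hw hw01 _ _) <| iInf_le_of_le ?_ <| le_of_eq ?_
  · rw [map_snd_twoPointCoupling hw hw01, bipolarMeasure_eq]
  · rw [lintegral_twoPointCoupling hw _ _ measurable_edist_sq_add_edist_sq]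
    congr 1
    refine lintegral_congr fun z => ?_
    have h1 : 0 ≤ 1 - w z := sub_nonneg.2 (hw01 z).2
    simp only [edist_sq_add_edist_sq]
    rw [← ENNReal.ofReal_mul (hw01 z).1, ← ENNReal.ofReal_mul h1, ← ENNReal.ofReal_add
      (mul_nonneg (hw01 z).1 (distSqTo_nonneg _ _)) (mul_nonneg h1 (distSqTo_nonneg _ _))]

lemma wasserstein2_bipolarMeasure_le {ν : Measure Phase} [IsProbabilityMeasure ν]
    (hν : Integrable (fun z : Phase => z.2 ^ 2) ν) (φ : Torus) {c : ℝ} (hc : c ∈ Icc (0 : ℝ) 1) :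
    wasserstein2 ν (bipolarMeasure φ c) ≤ ENNReal.ofReal (bipolarDefect ν φ c) ^ (1 / 2 : ℝ) := by
  obtain ⟨w, hw, hw01, rfl, hdist⟩ :=
    exists_weight_integral_eq (ν := ν) (measurable_poleWeight φ) (poleWeight_mem_Icc φ) hc
  have hint₁ : Integrable (fun z : Phase => Real.pi ^ 2 / 2 * torusSin (z.1 - φ) ^ 2) ν :=
    (torusSmooth_torusSin_sub_sq φ).integrable.const_mul _
  have hint₂ : Integrable (fun z => Real.pi ^ 2 * |w z - poleWeight φ z|) ν :=
    ((integrable_of_mem_Icc hw hw01).sub (integrable_of_mem_Icc (measurable_poleWeight φ)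
      (poleWeight_mem_Icc φ))).abs.const_mul _
  have hint₁₂ : Integrable (fun z : Phase => Real.pi ^ 2 / 2 * torusSin (z.1 - φ) ^ 2 +
      Real.pi ^ 2 * |w z - poleWeight φ z|) ν := hint₁.add hint₂
  have hint : Integrable (fun z : Phase => Real.pi ^ 2 / 2 * torusSin (z.1 - φ) ^ 2 +
      Real.pi ^ 2 * |w z - poleWeight φ z| + z.2 ^ 2) ν := hint₁₂.add hν
  refine (wasserstein2_bipolarMeasure_le_of_weight hw hw01 φ).trans ?_
  gcongr
  calc ∫⁻ z, ENNReal.ofReal (w z * distSqTo φ z +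
        (1 - w z) * distSqTo (φ + ((Real.pi : ℝ) : Torus)) z) ∂ν
      ≤ ∫⁻ z, ENNReal.ofReal (Real.pi ^ 2 / 2 * torusSin (z.1 - φ) ^ 2 +
        Real.pi ^ 2 * |w z - poleWeight φ z| + z.2 ^ 2) ∂ν :=
        lintegral_mono fun z => ENNReal.ofReal_le_ofReal (weighted_distSqTo_le φ z)
    _ = ENNReal.ofReal (∫ z, (Real.pi ^ 2 / 2 * torusSin (z.1 - φ) ^ 2 +
        Real.pi ^ 2 * |w z - poleWeight φ z| + z.2 ^ 2) ∂ν) :=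
        (ofReal_integral_eq_lintegral_ofReal hint (.of_forall fun z => by positivity)).symm
    _ ≤ ENNReal.ofReal (bipolarDefect ν φ (∫ z, w z ∂ν)) := by
        rw [integral_add hint₁₂ hν, integral_add hint₁ hint₂, integral_const_mul,
          integral_const_mul, bipolarDefect]
        gcongr

lemma tendsto_bipolarDefect (hμ : IsMeasureValuedSolution m γ κ μ) (hm : 0 < m)
    (hγ : 0 < γ) (hκ : 0 < κ) (h0 : energy m κ μ 0 ≤ 0) {R : ℝ} (hR : 0 < R) {φ : Torus}
    (hC : Tendsto (cosMean μ) atTop (𝓝 (R * torusCos φ)))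
    (hS : Tendsto (sinMean μ) atTop (𝓝 (R * torusSin φ))) :
    Tendsto (fun t => bipolarDefect (μ t) φ ((1 + R) / 2)) atTop (𝓝 0) := by
  have hcos := tendsto_freqMoment_torusCos_sub hμ hC hS
  have hsin := tendsto_freqMoment_torusSin_sub_sq hμ hm hγ hκ h0 hR hC hS
  have hlim := ((hsin.const_mul (Real.pi ^ 2 / 2)).add
    ((((hcos.const_add 1).div_const 2).sub_const ((1 + R) / 2)).abs.const_mul (Real.pi ^ 2))).add
      (tendsto_kinetic hμ hm hγ hκ h0)
  simp only [mul_zero, sub_self, abs_zero, add_zero] at hlim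
  refine hlim.congr' ?_
  filter_upwards [eventually_ge_atTop 0] with t ht
  simp only [bipolarDefect, integral_poleWeight, kinetic, freqMoment, moment,
    state_of_nonneg μ ht, pow_zero, mul_one]

lemma tendsto_wasserstein2_bipolarMeasure (hμ : IsMeasureValuedSolution m γ κ μ) {φ : Torus}
    {c : ℝ} (hc : c ∈ Icc (0 : ℝ) 1)
    (h : Tendsto (fun t => bipolarDefect (μ t) φ c) atTop (𝓝 0)) :
    Tendsto (fun t => wasserstein2 (μ t) (bipolarMeasure φ c)) atTop (𝓝 0) := by
  have hlim := ((ENNReal.continuous_rpow_const (y := (1 / 2 : ℝ))).tendsto _).comp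
    (ENNReal.tendsto_ofReal h)
  rw [ENNReal.ofReal_zero, ENNReal.zero_rpow_of_pos (by norm_num)] at hlim
  refine tendsto_of_tendsto_of_tendsto_of_le_of_le' tendsto_const_nhds hlim
    (.of_forall fun t => zero_le) ?_
  filter_upwards [eventually_ge_atTop 0] with t ht
  exact wasserstein2_bipolarMeasure_le (hμ.finite_second_moment t ht) φ hc

/-! ### The two regimes -/

lemma energy_initial_nonpos (h : (1 / 2) * ∫ z, z.2 ^ 2 ∂(μ 0 : Measure Phase) ≤
    κ * orderParameter (μ 0 : Measure Phase) ^ 2 / (2 * m)) : energy m κ μ 0 ≤ 0 := by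
  rw [orderParameter_sq μ le_rfl, mul_div_right_comm] at h
  rw [energy, sub_nonpos]
  simpa [kinetic, freqMoment, moment, state_of_nonneg μ le_rfl, div_eq_inv_mul] using h

lemma exists_tendsto_orderParameter (hμ : IsMeasureValuedSolution m γ κ μ) (hm : 0 < m)
    (hγ : 0 < γ) (hκ : 0 < κ) (h0 : energy m κ μ 0 ≤ 0) (hR : 0 < orderSq μ 0) :
    ∃ (R : ℝ) (φ : Torus), 0 < R ∧ R ≤ 1 ∧
      Tendsto (fun t => orderParameter (μ t)) atTop (𝓝 R) ∧
      Tendsto (fun t => wasserstein2 (μ t) (bipolarMeasure φ ((1 + R) / 2))) atTop (𝓝 0) := by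
  obtain ⟨R, φ, hRpos, hC, hS⟩ := exists_tendsto_cosMean_sinMean hμ hm hγ hκ h0 hR
  have hsqrt : √((R * Real.cos φ) ^ 2 + (R * Real.sin φ) ^ 2) = R := by
    rw [mul_pow, mul_pow, ← mul_add, Real.cos_sq_add_sin_sq, mul_one, Real.sqrt_sq hRpos.le]
  have horder : Tendsto (fun t => √(orderSq μ t)) atTop (𝓝 R) :=
    hsqrt ▸ ((hC.pow 2).add (hS.pow 2)).sqrt
  have hR1 : R ≤ 1 :=
    le_of_tendsto' horder fun t => Real.sqrt_le_one.2 (orderSq_le_one hμ t)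
  rw [← torusCos_coe] at hC
  rw [← torusSin_coe] at hS
  refine ⟨R, φ, hRpos, hR1, horder.congr' ?_, tendsto_wasserstein2_bipolarMeasure hμ
    ⟨by linarith, by linarith⟩ (tendsto_bipolarDefect hμ hm hγ hκ h0 hRpos hC hS)⟩
  filter_upwards [eventually_ge_atTop 0] with t ht
  rw [orderParameter_eq_sqrt μ ht]

end BipolarStates

end

end KineticKuramoto

theorem theorem3p7 (m γ κ : ℝ) (hm : 0 < m) (hγ : 0 < γ) (hκ : 0 < κ)
    (μ : ℝ → ProbabilityMeasure KineticKuramoto.Phase)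
    (hμ : KineticKuramoto.IsMeasureValuedSolution m γ κ μ)
    (hin : (1 / 2) * ∫ z, z.2 ^ 2 ∂(μ 0 : Measure KineticKuramoto.Phase)
      ≤ κ * KineticKuramoto.orderParameter (μ 0 : Measure KineticKuramoto.Phase) ^ 2 / (2 * m)) :
    (KineticKuramoto.orderParameter (μ 0 : Measure KineticKuramoto.Phase) = 0 →
      ∀ t, 0 ≤ t →
        μ t = μ 0 ∧
        (∀ᵐ z ∂(μ t : Measure KineticKuramoto.Phase), z.2 = 0) ∧
        KineticKuramoto.orderParameter (μ t : Measure KineticKuramoto.Phase) = 0) ∧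
    (0 < KineticKuramoto.orderParameter (μ 0 : Measure KineticKuramoto.Phase) →
      (∃ Rlow : ℝ, 0 < Rlow ∧ ∀ t, 0 ≤ t →
        Rlow ≤ KineticKuramoto.orderParameter (μ t : Measure KineticKuramoto.Phase)) ∧
      (∃ Rlim : ℝ, 0 < Rlim ∧
        Tendsto (fun t : ℝ =>
          KineticKuramoto.orderParameter (μ t : Measure KineticKuramoto.Phase)) atTop (𝓝 Rlim)) ∧
      (∃ (c₁ c₂ : ℝ) (ν : ProbabilityMeasure KineticKuramoto.Phase),
        KineticKuramoto.IsBipolarState c₁ c₂ (ν : Measure KineticKuramoto.Phase) ∧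
        Tendsto μ atTop (𝓝 ν) ∧
        Tendsto (fun t : ℝ => KineticKuramoto.wasserstein2
          (μ t : Measure KineticKuramoto.Phase) (ν : Measure KineticKuramoto.Phase))
          atTop (𝓝 0))) := by
  open KineticKuramoto in
  have h0 : energy m κ μ 0 ≤ 0 := energy_initial_nonpos hin
  refine ⟨fun hR t ht => ?_, fun hR => ?_⟩
  · have hR0 : orderSq μ 0 = 0 := by rw [← orderParameter_sq μ le_rfl, hR, sq, zero_mul]
    refine ⟨eq_initial_of_orderSq_eq_zero hμ hm hγ hκ h0 hR0 ht,
      state_of_nonneg μ ht ▸ ae_snd_eq_zero hμ hm hγ hκ h0 hR0 ht, ?_⟩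
    rw [orderParameter_eq_sqrt μ ht, orderSq_eq_zero hμ hm hγ hκ h0 hR0 ht, Real.sqrt_zero]
  · have hR0 : 0 < orderSq μ 0 := by rw [← orderParameter_sq μ le_rfl]; positivity
    obtain ⟨r, hr, hrle⟩ := exists_pos_le_orderSq hμ hm hγ hκ h0 hR0
    obtain ⟨R, φ, hRpos, hR1, horder, hW⟩ := exists_tendsto_orderParameter hμ hm hγ hκ h0 hR0
    refine ⟨⟨√r, Real.sqrt_pos.2 hr, fun t ht => ?_⟩, ⟨R, hRpos, horder⟩, ?_⟩
    · rw [orderParameter_eq_sqrt μ ht]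
      exact Real.sqrt_le_sqrt (hrle t ht)
    · let ν : ProbabilityMeasure Phase := ⟨bipolarMeasure φ ((1 + R) / 2),
        isProbabilityMeasure_bipolarMeasure φ ⟨by linarith, by linarith⟩⟩
      exact ⟨(1 + R) / 2, 1 - (1 + R) / 2, ν, ⟨by linarith, by linarith, by ring, φ, rfl⟩,
        tendsto_of_tendsto_wasserstein2 (ν := ν) hW, hW⟩
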